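/- **Setting.** Let $X_t=\int_0^t\gamma_u\,du+\int_0^t\sigma_u\,dW_u+\sum_{j=1}^{N_t}\zeta_j$, $t\ge 0$, where $W$ is a Brownian motion, $N$ is a non-homogeneous Poisson process with intensity function $\lambda$, the $\zeta_j$ are i.i.d. with density $f$ and independent of $N$, and the continuous component $X^c_t=\int_0^t\gamma_u\,du+\int_0^t\sigma_u\,dW_u$ is independent of $(N,(\zeta_j)_j)$. The functions $\gamma,\sigma,\lambda$ on $[0,\infty)$ are deterministic, each has strictly positive infimum and finite supremum on $[0,t]$ for every $t>0$ ($\gamma,\lambda$ measurable), and $\sigma$ is continuous. The density is $f(x)=pf_+(x)\mathbf 1_{x\ge 0}+(1-p)f_-(x)\mathbf 1_{x<0}$ with $p\in[0,1]$ and bounded $f_+:[0,\infty)\to[0,\infty)$, $f_-:(-\infty,0]\to[0,\infty)$, each of integral $1$, such that $f_\pm(0)=\lim_{x\to0^\pm}f_\pm(x)\in(0,\infty)$, $f_+\in C^1([0,b))$ and $f_-\in C^1((a,0])$ for some $a<0<b$. Put $\mathcal C_0(f)=\lim_{\varepsilon\to0^+}\frac1{2\varepsilon}\int_{-\varepsilon}^{\varepsilon}f(x)\,dx$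 (which equals $\tfrac12(pf_+(0)+(1-p)f_-(0))$), $$\bar\gamma_{t,h}=\frac1h\int_t^{t+h}\gamma_u\,du,\quad \bar\sigma^2_{t,h}=\frac1h\int_t^{t+h}\sigma_u^2\,du,\quad \bar\lambda_{t,h}=\frac1h\int_t^{t+h}\lambda_u\,du,$$ and let $\phi_{t,h}$ be the Gaussian density with mean $h\bar\gamma_{t,h}$ and variance $h\bar\sigma^2_{t,h}$, and $f^{*k}$ the $k$-fold convolution power of $f$. An optimal threshold $B^*_{t,h}$ is a minimizer over $B\ge 0$ of $$L_{t,h}(B)=\mathbb P(|X_{t+h}-X_t|>B,\;N_{t+h}-N_t=0)+\mathbb P(|X_{t+h}-X_t|\le B,\;N_{t+h}-N_t\ne0).$$ **Theorem (Characterizations of the optimal threshold).** For every $T>0$ there is $h_0=h_0(T)>0$ such that, for all $t\in[0,T]$ and $h\in(0,h_0)$, $L_{t,h}$ has a unique minimizer $B^*_{t,h}$ on $[0,\infty)$, and: 1. For all $t\in[0,T]$ and $h\in(0,h_0)$, with a convergent series of positive sum and a nonnegative bracket, $$B^*_{t,h}=h\bar\gamma_{t,h}+\sqrt{2h\bar\sigma^2_{t,h}}\left[\ln\!\left(1+e^{-2B^*_{t,h}\bar\gamma_{t,h}/\bar\sigma^2_{t,h}}\right)-\ln\!\left(\sqrt{2\pi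 h\bar\sigma^2_{t,h}}\sum_{k=1}^\infty\frac{(h\bar\lambda_{t,h})^k}{k!}\left[\phi_{t,h}*f^{*k}(B^*_{t,h})+\phi_{t,h}*f^{*k}(-B^*_{t,h})\right]\right)\right]^{1/2}.$$ 2. For every $\alpha\in(0,1/2)$, as $h\to0^+$, $$B^*_{t,h}=\sqrt h\,\bar\sigma_{t,h}\left[3\log(1/h)-2\log\!\left(\sqrt{2\pi}\,\mathcal C_0(f)\,\bar\sigma_{t,h}\bar\lambda_{t,h}\right)\right]^{1/2}+o(h^{1/2+\alpha}),$$ uniformly in $t\in[0,T]$. 3. If, furthermore, $\sigma^2$ and $\lambda$ are $C^1$ on $(0,T)$ and continuous on $[0,T]$, then for every $\alpha\in(0,1/2)$, as $h\to0^+$, $$B^*_{t,h}=\sqrt h\,\sigma_t\left[3\log(1/h)-2\log\!\left(\sqrt{2\pi}\,\mathcal C_0(f)\,\sigma_t\lambda_t\right)\right]^{1/2}+o(h^{1/2+\alpha})$$ for every $t\in(0,T)$, uniformly in $t$ on compact subsets of $(0,T)$. -/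

import Mathlib

open MeasureTheory ProbabilityTheory Filter Topology
open scoped NNReal

noncomputable section

namespace OptimalThreshold

/-! ### Deterministic data: coefficients and jump density -/

/-- Standing conditions on the deterministic drift `γ`, volatility `σ` and jump intensity `lam`,
as functions on `[0, ∞)` (values at negative arguments are irrelevant). For a set `S` of reals,
`0 < sInf S` forces `S` to be bounded below, since `sInf S = 0` otherwise. -/
structure CoefficientConditions (γ σ lam : ℝ → ℝ) : Prop where
  γ_meas : AEStronglyMeasurable γ (volume.restrict (Set.Ici 0))
  lam_meas : AEStronglyMeasurable lam (volume.restrict (Set.Ici 0))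
  σ_cont : ContinuousOn σ (Set.Ici 0)
  σ_inf : ∀ t : ℝ, 0 < t → 0 < sInf (σ '' Set.Icc 0 t)
  σ_sup : ∀ t : ℝ, 0 < t → BddAbove (σ '' Set.Icc 0 t)
  γ_inf : ∀ t : ℝ, 0 < t → 0 < sInf (γ '' Set.Icc 0 t)
  γ_sup : ∀ t : ℝ, 0 < t → BddAbove (γ '' Set.Icc 0 t)
  lam_inf : ∀ t : ℝ, 0 < t → 0 < sInf (lam '' Set.Icc 0 t)
  lam_sup : ∀ t : ℝ, 0 < t → BddAbove (lam '' Set.Icc 0 t)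

/-- The two-sided mixture `p f₊ 1_{x ≥ 0} + (1 - p) f₋ 1_{x < 0}`. -/
def jumpDensity (p : ℝ) (fp fm : ℝ → ℝ) (x : ℝ) : ℝ :=
  if 0 ≤ x then p * fp x else (1 - p) * fm x

/-- Conditions on the weight `p` and the one-sided densities `f₊` on `[0, ∞)` and `f₋` on
`(-∞, 0]`. In `fp_C1`, `fm_C1` the derivative at `0` is one-sided and is the limit of the
derivatives at points tending to `0`, because `ContDiffOn` includes its continuity there. -/
structure JumpDensityConditions (p : ℝ) (fp fm : ℝ → ℝ) : Prop where
  p_mem : p ∈ Set.Icc (0 : ℝ) 1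
  fp_nonneg : ∀ x, 0 ≤ x → 0 ≤ fp x
  fm_nonneg : ∀ x, x ≤ 0 → 0 ≤ fm x
  fp_bdd : BddAbove (fp '' Set.Ici 0)
  fm_bdd : BddAbove (fm '' Set.Iic 0)
  fp_integrable : IntegrableOn fp (Set.Ici 0)
  fm_integrable : IntegrableOn fm (Set.Iic 0)
  fp_integral : ∫ x in Set.Ici 0, fp x = 1
  fm_integral : ∫ x in Set.Iic 0, fm x = 1
  fp_zero_pos : 0 < fp 0
  fm_zero_pos : 0 < fm 0
  fp_lim : Tendsto fp (𝓝[>] 0) (𝓝 (fp 0))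
  fm_lim : Tendsto fm (𝓝[<] 0) (𝓝 (fm 0))
  fp_C1 : ∃ b : ℝ, 0 < b ∧ ContDiffOn ℝ 1 fp (Set.Ico 0 b)
  fm_C1 : ∃ a : ℝ, a < 0 ∧ ContDiffOn ℝ 1 fm (Set.Ioc a 0)

/-- The mass concentration at the origin, `C₀(f) = lim_{ε → 0+} (2ε)⁻¹ ∫_{-ε}^{ε} f(x) dx`.
The limit exists under `JumpDensityConditions`, see `tendsto_massAtZero`. -/
def massAtZero (f : ℝ → ℝ) : ℝ :=
  limUnder (𝓝[>] (0 : ℝ)) fun ε : ℝ => 1 / (2 * ε) * ∫ x in (-ε)..ε, f x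

/-- `ḡ_{t,h} = h⁻¹ ∫_t^{t+h} g(u) du`. -/
def avg (g : ℝ → ℝ) (t h : ℝ) : ℝ := 1 / h * ∫ u in t..(t + h), g u

/-- The averaged variance: the square of `σ̄_{t,h}`. -/
def avgVar (σ : ℝ → ℝ) (t h : ℝ) : ℝ := avg (fun u => σ u ^ 2) t h

/-- `σ̄_{t,h}`. -/
def avgVol (σ : ℝ → ℝ) (t h : ℝ) : ℝ := √(avgVar σ t h)

/-- `φ_{t,h}`, the Gaussian density with mean `h γ̄_{t,h}` and variance `h σ̄²_{t,h}`. -/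
def incrementDensity (γ σ : ℝ → ℝ) (t h : ℝ) : ℝ → ℝ :=
  gaussianPDFReal (h * avg γ t h) (h * avgVar σ t h).toNNReal

/-- Convolution on the real line with respect to Lebesgue measure. -/
def conv (f g : ℝ → ℝ) : ℝ → ℝ := convolution f g (ContinuousLinearMap.mul ℝ ℝ) volume

/-- `convPow f k` is the `(k + 1)`-fold convolution power `f^{*(k+1)}`. -/
def convPow (f : ℝ → ℝ) : ℕ → ℝ → ℝ
  | 0 => f
  | k + 1 => conv f (convPow f k)

/-- The term of index `k + 1` of the series
`∑_{k ≥ 1} (h λ̄)^k / k! * [φ_{t,h} * f^{*k}(B) + φ_{t,h} * f^{*k}(-B)]`. -/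
def jumpSeriesTerm (γ σ lam f : ℝ → ℝ) (t h B : ℝ) (k : ℕ) : ℝ :=
  (h * avg lam t h) ^ (k + 1) / ((k + 1).factorial : ℝ) *
    (conv (incrementDensity γ σ t h) (convPow f k) B +
      conv (incrementDensity γ σ t h) (convPow f k) (-B))

/-- The bracket under the square root in the fixed-point equation. -/
def fixedPointBracket (γ σ lam f : ℝ → ℝ) (t h B : ℝ) : ℝ :=
  Real.log (1 + Real.exp (-2 * B * avg γ t h / avgVar σ t h)) -
    Real.log (√(2 * Real.pi * h * avgVar σ t h) * ∑' k, jumpSeriesTerm γ σ lam f t h B k)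

/-- `√h s [3 log(1/h) - 2 log(√(2π) c s l)]^{1/2}`. -/
def secondOrderApprox (c s l h : ℝ) : ℝ :=
  √h * s * √(3 * Real.log (1 / h) - 2 * Real.log (√(2 * Real.pi) * c * s * l))

/-! ### The semimartingale model -/

variable {Ω : Type*} [MeasurableSpace Ω]

/-- `I t` is (a version of) the Wiener integral `∫_0^t σ dW` of the deterministic continuous
integrand `σ`, for every `t`: the limit in `L²(P)` of the integrals
`∑_i σ(i 2⁻ⁿ) (W_{(i+1) 2⁻ⁿ ∧ t} - W_{i 2⁻ⁿ ∧ t})` of step functions. -/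
def IsWienerIntegral (σ : ℝ → ℝ) (W I : ℝ≥0 → Ω → ℝ) (P : Measure Ω) : Prop :=
  ∀ t : ℝ≥0, Measurable (I t) ∧
    Tendsto (fun n : ℕ => eLpNorm (fun ω =>
      (∑ i ∈ Finset.range ⌈t * 2 ^ n⌉₊, σ ((i : ℝ) / 2 ^ n) *
        (W (min (((i : ℝ≥0) + 1) / 2 ^ n) t) ω - W (min ((i : ℝ≥0) / 2 ^ n) t) ω)) - I t ω) 2 P)
      atTop (𝓝 0)

/-- `N` is a non-homogeneous Poisson process with intensity function `lam`. -/
structure IsPoissonProcess (lam : ℝ → ℝ) (N : ℝ≥0 → Ω → ℕ) (P : Measure Ω) : Prop where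
  measurable : ∀ t, Measurable (N t)
  zero : ∀ᵐ ω ∂P, N 0 ω = 0
  mono : ∀ᵐ ω ∂P, Monotone fun t => N t ω
  right_cont : ∀ᵐ ω ∂P, ∀ t, ContinuousWithinAt (fun s => N s ω) (Set.Ici t) t
  indep : HasIndepIncrements (fun t ω => (N t ω : ℝ)) P
  law : ∀ s t : ℝ≥0, s ≤ t →
    HasLaw (fun ω => N t ω - N s ω) (poissonMeasure (∫ u in (s : ℝ)..t, lam u).toNNReal) P

/-- The continuous component `X^c_t = ∫_0^t γ du + ∫_0^t σ dW`, with `I` the Wiener integral. -/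
def contPart (γ : ℝ → ℝ) (I : ℝ≥0 → Ω → ℝ) (t : ℝ≥0) (ω : Ω) : ℝ :=
  (∫ u in (0 : ℝ)..t, γ u) + I t ω

/-- The jump component `J_t`, the sum of the first `N_t` jump sizes (indexed from `0`). -/
def jumpPart (N : ℝ≥0 → Ω → ℕ) (ζ : ℕ → Ω → ℝ) (t : ℝ≥0) (ω : Ω) : ℝ :=
  ∑ j ∈ Finset.range (N t ω), ζ j ω

/-- `X` is the jump diffusion `X_t = ∫_0^t γ du + ∫_0^t σ dW + ∑_{j ≤ N_t} ζ_j`, with `W` a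
Brownian motion, `N` a Poisson process with intensity `lam` and `ζ_j` i.i.d. with density `f`
independent of `N`; the continuous component is independent of the jump data. -/
structure IsJumpDiffusion (γ σ lam f : ℝ → ℝ) (W I : ℝ≥0 → Ω → ℝ) (N : ℝ≥0 → Ω → ℕ)
    (ζ : ℕ → Ω → ℝ) (X : ℝ≥0 → Ω → ℝ) (P : Measure Ω) : Prop where
  brownian : IsBrownianReal W P
  integral : IsWienerIntegral σ W I P
  poisson : IsPoissonProcess lam N P
  ζ_measurable : ∀ j, Measurable (ζ j)
  ζ_indep : iIndepFun ζ P
  ζ_law : ∀ j, HasLaw (ζ j) (volume.withDensity fun x => ENNReal.ofReal (f x)) P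
  N_indep_ζ : IndepFun (fun ω t => N t ω) (fun ω j => ζ j ω) P
  cont_indep_jump : IndepFun (fun ω t => contPart γ I t ω)
    (fun ω => ((fun t => N t ω, fun j => ζ j ω) : (ℝ≥0 → ℕ) × (ℕ → ℝ))) P
  eq : ∀ t ω, X t ω = contPart γ I t ω + jumpPart N ζ t ω

/-- The loss function `L_{t,h}(B)` (with unit weight):
`P(|X_{t+h} - X_t| > B, N_{t+h} - N_t = 0) + P(|X_{t+h} - X_t| ≤ B, N_{t+h} - N_t ≠ 0)`. -/
def loss (X : ℝ≥0 → Ω → ℝ) (N : ℝ≥0 → Ω → ℕ) (P : Measure Ω) (t h : ℝ≥0) (B : ℝ) : ℝ :=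
  P.real {ω | B < |X (t + h) ω - X t ω| ∧ N (t + h) ω = N t ω} +
    P.real {ω | |X (t + h) ω - X t ω| ≤ B ∧ N (t + h) ω ≠ N t ω}

/-- `B ≥ 0` is an optimal threshold: a global minimum point of `L_{t,h}` on `[0, ∞)`. -/
def IsOptimalThreshold (X : ℝ≥0 → Ω → ℝ) (N : ℝ≥0 → Ω → ℕ) (P : Measure Ω) (t h : ℝ≥0)
    (B : ℝ) : Prop :=
  0 ≤ B ∧ IsMinOn (loss X N P t h) (Set.Ici 0) B

/-! ### The limit defining `massAtZero` exists -/

theorem tendsto_massAtZero_aux {p : ℝ} {fp fm : ℝ → ℝ} (hf : JumpDensityConditions p fp fm) :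
    Tendsto (fun ε : ℝ => 1 / (2 * ε) * ∫ x in (-ε)..ε, jumpDensity p fp fm x) (𝓝[>] 0)
      (𝓝 ((p * fp 0 + (1 - p) * fm 0) / 2)) := by
  have hfp : Tendsto (fun ε : ℝ => ε⁻¹ * ∫ x in (0 : ℝ)..ε, fp x) (𝓝[>] 0) (𝓝 (fp 0)) := by
    have hd : HasDerivWithinAt (fun u => ∫ x in (0 : ℝ)..u, fp x) (fp 0) (Set.Ici 0) 0 :=
      intervalIntegral.integral_hasDerivWithinAt_right (t := Set.Ioi 0) (by simp)
        ⟨Set.Ici 0, mem_of_superset self_mem_nhdsWithin Set.Ioi_subset_Ici_self,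
          hf.fp_integrable.aestronglyMeasurable⟩ hf.fp_lim
    have h2 := (hasDerivWithinAt_iff_tendsto_slope' (s := Set.Ioi (0 : ℝ)) (by simp)).1
      (hd.mono Set.Ioi_subset_Ici_self)
    simpa [slope_fun_def] using h2
  have hfm : Tendsto (fun ε : ℝ => ε⁻¹ * ∫ x in (-ε)..0, fm x) (𝓝[>] 0) (𝓝 (fm 0)) := by
    have hd : HasDerivWithinAt (fun u => ∫ x in u..(0 : ℝ), fm x) (-fm 0) (Set.Iic 0) 0 :=
      intervalIntegral.integral_hasDerivWithinAt_left (t := Set.Iic 0) (by simp)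
        ⟨Set.Iic 0, self_mem_nhdsWithin, hf.fm_integrable.aestronglyMeasurable⟩
        (continuousWithinAt_Iio_iff_Iic.1 hf.fm_lim)
    have h2 := ((hasDerivWithinAt_iff_tendsto_slope' (s := Set.Iio (0 : ℝ)) (by simp)).1
      (hd.mono Set.Iio_subset_Iic_self)).neg
    have h3 : Tendsto (fun ε : ℝ => -ε) (𝓝[>] 0) (𝓝[<] 0) := by
      simpa using tendsto_neg_nhdsGT (a := (0 : ℝ))
    simpa [slope_fun_def, Function.comp_def] using h2.comp h3
  have hlim := ((hfp.const_mul p).add (hfm.const_mul (1 - p))).div_const 2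
  refine hlim.congr' ?_
  filter_upwards [self_mem_nhdsWithin] with ε hε
  have hε : 0 < ε := hε
  have e1 : Set.EqOn (fun x => jumpDensity p fp fm x) (fun x => p * fp x)
      (Set.uIoc 0 ε) := by
    intro x hx
    rw [Set.uIoc_of_le hε.le] at hx
    simp [jumpDensity, hx.1.le]
  have e2 : Set.EqOn (fun x => jumpDensity p fp fm x) (fun x => (1 - p) * fm x)
      (Set.Ioo (-ε) 0) := by
    intro x hx
    simp [jumpDensity, hx.2]
  have i1 : IntervalIntegrable (fun x => p * fp x) volume 0 ε := by
    rw [intervalIntegrable_iff_integrableOn_Ioc_of_le hε.le]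
    exact (hf.fp_integrable.mono_set fun x hx => hx.1.le).const_mul p
  have i2 : IntervalIntegrable (fun x => (1 - p) * fm x) volume (-ε) 0 := by
    rw [intervalIntegrable_iff_integrableOn_Ioc_of_le (by linarith)]
    exact (hf.fm_integrable.mono_set fun x hx => hx.2).const_mul (1 - p)
  have i2' : IntervalIntegrable (fun x => jumpDensity p fp fm x) volume (-ε) 0 := by
    rw [intervalIntegrable_iff_integrableOn_Ioo_of_le (by linarith)] at i2 ⊢
    exact i2.congr_fun e2.symm measurableSet_Ioo
  have j2 : ∫ x in (-ε)..0, jumpDensity p fp fm x = (1 - p) * ∫ x in (-ε)..0, fm x := by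
    rw [← intervalIntegral.integral_const_mul, intervalIntegral.integral_of_le (by linarith),
      intervalIntegral.integral_of_le (by linarith), integral_Ioc_eq_integral_Ioo,
      integral_Ioc_eq_integral_Ioo]
    exact setIntegral_congr_fun measurableSet_Ioo e2
  have j1 : ∫ x in (0 : ℝ)..ε, jumpDensity p fp fm x = p * ∫ x in (0 : ℝ)..ε, fp x := by
    rw [← intervalIntegral.integral_const_mul]
    exact intervalIntegral.integral_congr_ae (Eventually.of_forall fun x hx => e1 hx)
  rw [← intervalIntegral.integral_add_adjacent_intervals i2' (i1.congr e1.symm), j1, j2]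
  field_simp
  ring

theorem tendsto_massAtZero {p : ℝ} {fp fm : ℝ → ℝ} (hf : JumpDensityConditions p fp fm) :
    Tendsto (fun ε : ℝ => 1 / (2 * ε) * ∫ x in (-ε)..ε, jumpDensity p fp fm x) (𝓝[>] 0)
      (𝓝 (massAtZero (jumpDensity p fp fm))) :=
  tendsto_nhds_limUnder ⟨_, tendsto_massAtZero_aux hf⟩

theorem massAtZero_eq {p : ℝ} {fp fm : ℝ → ℝ} (hf : JumpDensityConditions p fp fm) :
    massAtZero (jumpDensity p fp fm) = (p * fp 0 + (1 - p) * fm 0) / 2 :=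
  (tendsto_massAtZero_aux hf).limUnder_eq

end OptimalThreshold

end

/-! Write `m`, `v`, `μ` for the integrals of `γ`, `σ²`, `lam` over `[t, t+h]`, `φ` for the Gaussian
density with mean `m` and variance `v`, and `F = ∑_{k≥1} μ^k/k! f^{*k}` (`jumpMixture`).
Conditioning on the Poisson increment gives `L(B) = e^{-μ} (1 - ∫_{-B}^B (φ - φ*F))` (`loss_eq`). Up
to a positive factor the derivative of `L` is thus the symmetrization of `φ*F` minus that of `φ`,
and a unique minimizer exists as soon as the ratio of the two symmetrizations crosses `1` exactly
once, upwards.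

The ratio is strictly increasing: after factoring out a Gaussian in `B`, it is an integral over jump
sizes `x`, with nonnegative weights, of `cosh((x+m)B/v) / cosh(mB/v)`. This quotient increases with
`B` when `|x+m| > m`, and can decrease only for `x` in `[-2m, 0]`, an interval of length `O(h)`. On
at least one side of the origin `f` is bounded below over a distance `√v`, of order `√h`, and for
small `h` that contribution wins (`evenSum_conv_mul_lt`). At `B = m` the ratio is below `1`, since
`φ` is at its peak while `φ*F = O(h)`. At `B = m + √(4v log(1/h))` it is above `1`, since `φ` has
dropped to `O(h^{3/2})` while the jump part is still of order `h`. Hence there is one crossing, and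
it lies between these points (`exists_threshold`).

At the crossing the logarithm of the equality of densities is the fixed-point equation. For the
expansion, the same equality first bounds the Gaussian tail at `B` by `O(h^{3/2})`. The jump side is
then `μ(a+b)` up to a small relative error, with `a`, `b` the one-sided limits of `f` at `0` and
`a+b` twice the mass concentration there. So `(B-m)²/v` is the radicand of the expansion up to
`o(h^α)` (`abs_sub_secondOrderApprox_le`). All error terms are explicit functions of `h` and of
bounds for the coefficients on `[0, T+1]`, which makes every statement uniform in `t`. Replacing
averages by spot values costs a perturbation of order `h` of the coefficients
(`abs_secondOrderApprox_sub_le`). -/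

noncomputable section

namespace OptimalThreshold

/-! ### Gaussian law of the increments of a Wiener integral. -/

section Wiener

variable {Ω : Type*} [MeasurableSpace Ω] {P : Measure Ω}

/-- A weighted sum of the increments of a Brownian motion along a monotone sequence is a centred
Gaussian variable. -/
theorem hasLaw_sum_increments {W : ℝ≥0 → Ω → ℝ} (hW : IsPreBrownianReal W P) {c : ℕ → ℝ≥0}
    (hc : Monotone c) (a : ℕ → ℝ) (n : ℕ) :
    HasLaw (fun ω => ∑ i ∈ Finset.range n, a i * (W (c (i + 1)) ω - W (c i) ω))
      (gaussianReal 0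
        (∑ i ∈ Finset.range n, .mk (a i ^ 2) (sq_nonneg _) * nndist (c (i + 1) : ℝ) (c i))) P := by
  have : IsProbabilityMeasure P := hW.isGaussianProcess.isProbabilityMeasure
  have hincr (i : ℕ) : HasLaw (fun ω => a i * (W (c (i + 1)) ω - W (c i) ω))
      (gaussianReal 0 (.mk (a i ^ 2) (sq_nonneg _) * nndist (c (i + 1) : ℝ) (c i))) P := by
    simpa using gaussianReal_const_mul (hW.hasLaw_sub (c (i + 1)) (c i)) (a i)
  have hind : iIndepFun (fun i ω => a i * (W (c (i + 1)) ω - W (c i) ω)) P :=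
    (hW.hasIndepIncrements.nat hc).comp (fun i x => a i * x) (fun i => by fun_prop)
  induction n with
  | zero =>
    simp only [Finset.range_zero, Finset.sum_empty, gaussianReal_zero_var]
    exact hasLaw_dirac_of_ae_eq (by simp)
  | succ n ih =>
    have hi := hind.indepFun_finsetSum_of_notMem₀ (fun i => (hincr i).aemeasurable)
      (s := Finset.range n) (i := n) (by simp)
    have e : (∑ j ∈ Finset.range n, fun ω => a j * (W (c (j + 1)) ω - W (c j) ω)) =
        fun ω => ∑ i ∈ Finset.range n, a i * (W (c (i + 1)) ω - W (c i) ω) := by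
      ext ω; simp
    rw [e] at hi
    refine ⟨?_, ?_⟩
    · simp only [Finset.sum_range_succ]
      exact ih.aemeasurable.add (hincr n).aemeasurable
    · have := gaussianReal_add_gaussianReal_of_indepFun hi ih.map_eq (hincr n).map_eq
      simp only [Finset.sum_range_succ]
      simpa [Pi.add_def] using this

/-- The left-endpoint Riemann sums of a continuous function along clamped dyadic grids converge to
its integral. -/
theorem tendsto_sum_clamp {g : ℝ → ℝ} {s u : ℝ≥0} (hsu : s ≤ u)
    (hg : ContinuousOn g (Set.Icc 0 (u : ℝ))) :
    Tendsto (fun n : ℕ => ∑ i ∈ Finset.range ⌈u * 2 ^ n⌉₊, g ((i : ℝ) / 2 ^ n) *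
      (((max s (min (((i : ℝ≥0) + 1) / 2 ^ n) u) : ℝ≥0) : ℝ) -
        (max s (min ((i : ℝ≥0) / 2 ^ n) u) : ℝ≥0))) atTop (𝓝 (∫ x in (s : ℝ)..u, g x)) := by
  rw [Metric.tendsto_atTop]
  intro ε hε
  have hunif := isCompact_Icc.uniformContinuousOn_of_continuous hg
  rw [Metric.uniformContinuousOn_iff] at hunif
  -- The cell errors add up to `ε / (u + 1) * (u - s)`; the `+ 1` covers `u = 0` and makes the final
  -- inequality strict.
  obtain ⟨δ, hδ, hgδ⟩ := hunif (ε / (u + 1)) (by positivity)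
  obtain ⟨n₀, hn₀⟩ := exists_pow_lt_of_lt_one hδ (by norm_num : (1 / 2 : ℝ) < 1)
  refine ⟨n₀, fun n hn => ?_⟩
  have hnδ : (1 : ℝ) / 2 ^ n < δ := by
    refine lt_of_le_of_lt ?_ hn₀
    rw [one_div_pow]
    exact one_div_le_one_div_of_le (by positivity) (pow_le_pow_right₀ (by norm_num) hn)
  set c : ℕ → ℝ≥0 := fun i => max s (min ((i : ℝ≥0) / 2 ^ n) u) with hc
  have hcm : Monotone c := fun i j hij => by simp only [hc]; gcongr
  have hcs (i : ℕ) : s ≤ c i := le_max_left _ _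
  have hcu (i : ℕ) : c i ≤ u := max_le hsu (min_le_right _ _)
  set m := ⌈u * 2 ^ n⌉₊ with hm
  have hc0 : c 0 = s := by simp [hc]
  have hcm' : c m = u := by
    have : u ≤ (m : ℝ≥0) / 2 ^ n := by
      rw [le_div_iff₀ (by positivity)]; exact Nat.le_ceil _
    simp [hc, min_eq_right this, hsu]
  have hint (i : ℕ) : IntervalIntegrable g volume (c i) (c (i + 1)) := by
    refine (hg.mono ?_).intervalIntegrable
    rw [Set.uIcc_of_le (by exact_mod_cast hcm i.le_succ)]
    exact Set.Icc_subset_Icc (c i).2 (by exact_mod_cast hcu _)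
  have hsum := intervalIntegral.sum_integral_adjacent_intervals (μ := volume) (f := g)
    (a := fun i => (c i : ℝ)) (n := m) (fun k _ => hint k)
  rw [hc0, hcm'] at hsum
  have hterm (i : ℕ) : |g ((i : ℝ) / 2 ^ n) * ((c (i + 1) : ℝ) - c i) -
      ∫ x in (c i : ℝ)..c (i + 1), g x| ≤ ε / (u + 1) * ((c (i + 1) : ℝ) - c i) := by
    have hle : (c i : ℝ) ≤ c (i + 1) := by exact_mod_cast hcm i.le_succ
    rcases hle.eq_or_lt with heq | hlt
    · simp [← heq]
    have e : g ((i : ℝ) / 2 ^ n) * ((c (i + 1) : ℝ) - c i) -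
        ∫ x in (c i : ℝ)..c (i + 1), g x =
        ∫ x in (c i : ℝ)..c (i + 1), (g ((i : ℝ) / 2 ^ n) - g x) := by
      rw [intervalIntegral.integral_sub (by simp) (hint i)]
      simp [mul_comm]
    rw [e, ← Real.norm_eq_abs, ← abs_of_nonneg (sub_nonneg.2 hle)]
    refine intervalIntegral.norm_integral_le_of_norm_le_const fun x hx => ?_
    rw [Set.uIoc_of_le hle] at hx
    have hlt' : c i < c (i + 1) := by exact_mod_cast hlt
    -- A nondegenerate clamped cell lies inside its dyadic cell: a grid point beyond `u`, or a right
    -- endpoint at most `s`, would collapse it. Hence `x` is within `2⁻ⁿ` of the evaluation point,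
    -- even if that point is below `s`.
    have h1 : (i : ℝ≥0) / 2 ^ n ≤ u := by
      by_contra! hcon
      have h2 : u < ((i + 1 : ℕ) : ℝ≥0) / 2 ^ n := hcon.trans_le (by push_cast; gcongr; simp)
      simp [hc, min_eq_right hcon.le] at hlt'
    have h2 : (i : ℝ≥0) / 2 ^ n ≤ c i := by simp [hc, min_eq_left h1]
    have h3 : c (i + 1) ≤ ((i : ℝ≥0) + 1) / 2 ^ n := by
      have : s < ((i : ℝ≥0) + 1) / 2 ^ n := by
        by_contra! hcon
        have h4 : ((i : ℝ≥0)) / 2 ^ n ≤ s := le_trans (by gcongr; simp) hcon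
        simp [hc, (min_le_left _ _).trans hcon, (min_le_left _ _).trans h4] at hlt'
      simp [hc, this.le]
    have h2' : (i : ℝ) / 2 ^ n ≤ c i := by exact_mod_cast h2
    have h3' : (c (i + 1) : ℝ) ≤ ((i : ℝ) + 1) / 2 ^ n := by exact_mod_cast h3
    have hu' : (c (i + 1) : ℝ) ≤ u := by exact_mod_cast hcu _
    have h0 : (0 : ℝ) ≤ (i : ℝ) / 2 ^ n := by positivity
    rw [Real.norm_eq_abs, ← Real.dist_eq]
    refine (hgδ _ ⟨h0, by exact_mod_cast h1⟩ x ⟨by linarith [hx.1], by linarith [hx.2]⟩ ?_).le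
    rw [Real.dist_eq, abs_sub_comm, abs_of_nonneg (by linarith [hx.1])]
    have : ((i : ℝ) + 1) / 2 ^ n = (i : ℝ) / 2 ^ n + 1 / 2 ^ n := by ring
    linarith [hx.2]
  have hcast (i : ℕ) : (max s (min (((i : ℝ≥0) + 1) / 2 ^ n) u) : ℝ≥0) = c (i + 1) := by
    simp [hc]
  simp only [hcast, ← hsum, Real.dist_eq]
  change |∑ i ∈ Finset.range m, g ((i : ℝ) / 2 ^ n) * ((c (i + 1) : ℝ) - c i) - _| < ε
  rw [← Finset.sum_sub_distrib]
  calc _ ≤ ∑ i ∈ Finset.range m, ε / (u + 1) * ((c (i + 1) : ℝ) - c i) :=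
        (Finset.abs_sum_le_sum_abs _ _).trans (Finset.sum_le_sum fun i _ => hterm i)
    _ = ε / (u + 1) * (u - s) := by
        rw [← Finset.mul_sum, Finset.sum_range_sub (fun i => (c i : ℝ)), hc0, hcm']
    _ < ε := by
        rw [div_mul_eq_mul_div, div_lt_iff₀ (by positivity)]
        have : (0 : ℝ) ≤ s := s.2
        nlinarith [hε]

/-- The increments of a Wiener integral are Gaussian. -/
theorem IsWienerIntegral.hasLaw_sub {σ : ℝ → ℝ} {W I : ℝ≥0 → Ω → ℝ} (hW : IsPreBrownianReal W P)
    (hI : IsWienerIntegral σ W I P) {s u : ℝ≥0} (hsu : s ≤ u)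
    (hσ : ContinuousOn σ (Set.Icc 0 (u : ℝ))) :
    HasLaw (fun ω => I u ω - I s ω)
      (gaussianReal 0 (∫ x in (s : ℝ)..u, σ x ^ 2).toNNReal) P := by
  have : IsProbabilityMeasure P := hW.isGaussianProcess.isProbabilityMeasure
  set S : ℝ≥0 → ℕ → Ω → ℝ := fun t n ω => ∑ i ∈ Finset.range ⌈t * 2 ^ n⌉₊, σ ((i : ℝ) / 2 ^ n) *
        (W (min (((i : ℝ≥0) + 1) / 2 ^ n) t) ω - W (min ((i : ℝ≥0) / 2 ^ n) t) ω) with hS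
  have hSm (t : ℝ≥0) (n : ℕ) : AEMeasurable (S t n) P := by
    refine Finset.aemeasurable_fun_sum _ fun i _ => ?_
    exact ((hW.aemeasurable _).sub (hW.aemeasurable _)).const_mul _
  have hconv (t : ℝ≥0) : Tendsto (fun n => eLpNorm (S t n - I t) 2 P) atTop (𝓝 0) := (hI t).2
  set c : ℕ → ℕ → ℝ≥0 := fun n i => max s (min ((i : ℝ≥0) / 2 ^ n) u) with hc
  have hcm (n : ℕ) : Monotone (c n) := fun i j hij => by simp only [hc]; gcongr
  have hSdiff (n : ℕ) : S u n - S s n = fun ω => ∑ i ∈ Finset.range ⌈u * 2 ^ n⌉₊,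
      σ ((i : ℝ) / 2 ^ n) * (W (c n (i + 1)) ω - W (c n i) ω) := by
    ext ω
    have h1 : S s n ω = ∑ i ∈ Finset.range ⌈u * 2 ^ n⌉₊, σ ((i : ℝ) / 2 ^ n) *
        (W (min (((i : ℝ≥0) + 1) / 2 ^ n) s) ω - W (min ((i : ℝ≥0) / 2 ^ n) s) ω) := by
      refine Finset.sum_subset (Finset.range_mono (Nat.ceil_mono (by gcongr))) fun i _ hi => ?_
      have h2 : s ≤ (i : ℝ≥0) / 2 ^ n := by
        rw [le_div_iff₀ (by positivity)]
        exact Nat.ceil_le.1 (by simpa using hi)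
      have h3 : s ≤ ((i : ℝ≥0) + 1) / 2 ^ n := h2.trans (by gcongr; simp)
      simp [min_eq_right h2, min_eq_right h3]
    -- Clamping the grid to `[s, u]` turns the difference of the two step sums into one sum over
    -- successive increments, to which `hasLaw_sum_increments` applies.
    have key (a : ℝ≥0) : W (min a u) ω - W (min a s) ω = W (max s (min a u)) ω - W s ω := by
      rcases le_total a s with h | h
      · simp [min_eq_left h, min_eq_left (h.trans hsu), max_eq_left h]
      · simp [min_eq_right h, max_eq_right (le_min h hsu)]
    rw [Pi.sub_apply, h1, hS, ← Finset.sum_sub_distrib]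
    refine Finset.sum_congr rfl fun i _ => ?_
    have k1 := key (((i : ℝ≥0) + 1) / 2 ^ n)
    have k2 := key ((i : ℝ≥0) / 2 ^ n)
    simp only [hc]
    push_cast
    linear_combination σ ((i : ℝ) / 2 ^ n) * (k1 - k2)
  set V : ℕ → ℝ≥0 := fun n => ∑ i ∈ Finset.range ⌈u * 2 ^ n⌉₊,
    .mk (σ ((i : ℝ) / 2 ^ n) ^ 2) (sq_nonneg _) * nndist (c n (i + 1) : ℝ) (c n i) with hV
  have hlaw (n : ℕ) : HasLaw (S u n - S s n) (gaussianReal 0 (V n)) P := by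
    rw [hSdiff]
    exact hasLaw_sum_increments hW (hcm n) (fun i => σ ((i : ℝ) / 2 ^ n)) _
  have hVlim : Tendsto (fun n => (V n : ℝ)) atTop (𝓝 (∫ x in (s : ℝ)..u, σ x ^ 2)) := by
    refine (tendsto_sum_clamp hsu (hσ.pow 2)).congr fun n => ?_
    simp only [hV, NNReal.coe_sum, NNReal.coe_mul, coe_nndist, Real.dist_eq]
    refine Finset.sum_congr rfl fun i _ => ?_
    have hle : (c n i : ℝ) ≤ c n (i + 1) := by exact_mod_cast hcm n i.le_succ
    rw [abs_of_nonneg (sub_nonneg.2 hle)]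
    simp [hc]
  have hmeas : TendstoInMeasure P (fun n => S u n - S s n) atTop (I u - I s) := by
    refine tendstoInMeasure_of_tendsto_eLpNorm (p := 2) (by simp)
      (fun n => ((hSm u n).sub (hSm s n)).aestronglyMeasurable)
      ((hI u).1.sub (hI s).1).aestronglyMeasurable ?_
    have h0 := (hconv u).add (hconv s)
    rw [add_zero] at h0
    refine tendsto_of_tendsto_of_tendsto_of_le_of_le tendsto_const_nhds h0
      (fun _ => zero_le) fun n => ?_
    have e : S u n - S s n - (I u - I s) = (S u n - I u) - (S s n - I s) := by ring
    simp only [e]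
    exact eLpNorm_sub_le ((hSm u n).sub (hI u).1.aemeasurable).aestronglyMeasurable
      ((hSm s n).sub (hI s).1.aemeasurable).aestronglyMeasurable (by norm_num)
  -- `L²` convergence has been weakened to convergence in distribution; the limit law is then read
  -- off from characteristic functions, where only the variances `V n` move.
  have hdist := hmeas.tendstoInDistribution (fun n => (hSm u n).sub (hSm s n))
  have hchar := ProbabilityMeasure.tendsto_iff_tendsto_charFun.1 hdist.tendsto
  refine ⟨((hI u).1.sub (hI s).1).aemeasurable, ?_⟩
  have hpm : IsProbabilityMeasure (P.map fun ω => I u ω - I s ω) :=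
    Measure.isProbabilityMeasure_map ((hI u).1.sub (hI s).1).aemeasurable
  refine Measure.ext_of_charFun (funext fun ξ => ?_)
  refine tendsto_nhds_unique (hchar ξ) ?_
  have hnn : 0 ≤ ∫ x in (s : ℝ)..u, σ x ^ 2 :=
    intervalIntegral.integral_nonneg (by exact_mod_cast hsu) fun _ _ => sq_nonneg _
  simp only [ProbabilityMeasure.coe_mk, (hlaw _).map_eq, charFun_gaussianReal,
    Real.coe_toNNReal _ hnn]
  refine (Complex.continuous_exp.tendsto _).comp ?_
  refine tendsto_const_nhds.sub ?_
  have := (Complex.continuous_ofReal.tendsto _).comp hVlim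
  exact (this.mul_const _).div_const _

end Wiener

/-! ### Bounded densities, their convolutions and the compound Poisson mixture. -/

section Densities

/-- A probability density on the line with values in `[0, M]`. -/
structure IsBoundedDensity (M : ℝ) (f : ℝ → ℝ) : Prop where
  nonneg : ∀ x, 0 ≤ f x
  le : ∀ x, f x ≤ M
  integrable : Integrable f
  integral_eq : ∫ x, f x = 1

/-- The law with density `f`. -/
def densityMeasure (f : ℝ → ℝ) : Measure ℝ := volume.withDensity fun x => ENNReal.ofReal (f x)

variable {M M' : ℝ} {f g : ℝ → ℝ}

theorem conv_apply (f g : ℝ → ℝ) (x : ℝ) : conv f g x = ∫ y, f y * g (x - y) := by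
  simp [conv, convolution]

theorem aestronglyMeasurable_comp_sub_left (hg : AEStronglyMeasurable g) (x : ℝ) :
    AEStronglyMeasurable (fun y => g (x - y)) :=
  hg.comp_quasiMeasurePreserving (Measure.measurePreserving_sub_left volume x).quasiMeasurePreserving

theorem integrable_mul_comp_sub (hf : Integrable f) (hg : AEStronglyMeasurable g)
    (hgM : ∀ x, |g x| ≤ M) (x : ℝ) : Integrable fun y => f y * g (x - y) := by
  simpa [mul_comm] using hf.bdd_mul (aestronglyMeasurable_comp_sub_left hg x)
    (ae_of_all _ fun y => hgM (x - y))

theorem conv_nonneg (hf : ∀ x, 0 ≤ f x) (hg : ∀ x, 0 ≤ g x) (x : ℝ) : 0 ≤ conv f g x := by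
  rw [conv_apply]
  exact integral_nonneg fun y => mul_nonneg (hf y) (hg _)

theorem IsBoundedDensity.abs_le (hf : IsBoundedDensity M f) (x : ℝ) : |f x| ≤ M := by
  rw [abs_of_nonneg (hf.nonneg x)]
  exact hf.le x

theorem IsBoundedDensity.bound_nonneg (hf : IsBoundedDensity M f) : 0 ≤ M :=
  (hf.nonneg 0).trans (hf.le 0)

/-- The convolution averages `g` against a probability density, so only the bound of `g` survives.
All powers `f^{*k}` therefore share the bound `M`, and smoothing by a narrow Gaussian does not spoil
it. -/
theorem IsBoundedDensity.conv (hf : IsBoundedDensity M f) (hg : IsBoundedDensity M' g) :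
    IsBoundedDensity M' (conv f g) where
  nonneg := conv_nonneg hf.nonneg hg.nonneg
  le x := by
    rw [conv_apply]
    calc ∫ y, f y * g (x - y) ≤ ∫ y, f y * M' :=
          integral_mono (integrable_mul_comp_sub hf.integrable hg.integrable.1 hg.abs_le x)
            (hf.integrable.mul_const _)
            fun y => mul_le_mul_of_nonneg_left (hg.le _) (hf.nonneg y)
      _ = M' := by rw [integral_mul_const, hf.integral_eq, one_mul]
  integrable := hf.integrable.integrable_convolution _ hg.integrable
  integral_eq := by
    unfold OptimalThreshold.conv
    rw [integral_convolution _ hf.integrable hg.integrable, hf.integral_eq, hg.integral_eq]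
    simp

theorem IsBoundedDensity.convPow (hf : IsBoundedDensity M f) (k : ℕ) :
    IsBoundedDensity M (convPow f k) := by
  induction k with
  | zero => exact hf
  | succ k ih => exact hf.conv ih

theorem IsBoundedDensity.isProbabilityMeasure (hf : IsBoundedDensity M f) :
    IsProbabilityMeasure (densityMeasure f) := by
  refine ⟨?_⟩
  rw [densityMeasure, withDensity_apply _ .univ, Measure.restrict_univ, ← ofReal_integral_eq_lintegral_ofReal hf.integrable (ae_of_all _ hf.nonneg), hf.integral_eq,
    ENNReal.ofReal_one]

theorem densityMeasure_conv (hf : IsBoundedDensity M f) (hg : IsBoundedDensity M' g) :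
    densityMeasure f ∗ densityMeasure g = densityMeasure (conv f g) := by
  unfold densityMeasure
  rw [conv_withDensity_eq_mlconvolution₀ hf.integrable.1.aemeasurable.ennreal_ofReal
    hg.integrable.1.aemeasurable.ennreal_ofReal]
  congr 1
  ext x
  rw [conv_apply, lconvolution_def, ofReal_integral_eq_lintegral_ofReal
    (integrable_mul_comp_sub hf.integrable hg.integrable.1 hg.abs_le x)
    (ae_of_all _ fun y => mul_nonneg (hf.nonneg y) (hg.nonneg _))]
  refine lintegral_congr fun y => ?_
  rw [ENNReal.ofReal_mul (hf.nonneg y), neg_add_eq_sub]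

theorem IsBoundedDensity.real_abs_le (hf : IsBoundedDensity M f) {B : ℝ} (hB : 0 ≤ B) :
    (densityMeasure f).real {x | |x| ≤ B} = ∫ x in -B..B, f x := by
  have e : {x : ℝ | |x| ≤ B} = Set.Icc (-B) B := by ext x; exact _root_.abs_le (G := ℝ)
  rw [e, intervalIntegral.integral_of_le (by linarith), ← integral_Icc_eq_integral_Ioc,
    measureReal_def, densityMeasure, withDensity_apply _ measurableSet_Icc,
    ← ofReal_integral_eq_lintegral_ofReal hf.integrable.integrableOn (ae_of_all _ hf.nonneg),
    ENNReal.toReal_ofReal (integral_nonneg hf.nonneg)]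

/-! ### The density of the jumps of a compound Poisson variable -/

/-- The weight `μ^{k+1} / (k+1)!`. -/
def poissonWeight (μ : ℝ) (k : ℕ) : ℝ := μ ^ (k + 1) / ((k + 1).factorial : ℝ)

theorem poissonWeight_nonneg {μ : ℝ} (hμ : 0 ≤ μ) (k : ℕ) : 0 ≤ poissonWeight μ k := by
  unfold poissonWeight; positivity

theorem hasSum_poissonWeight (μ : ℝ) : HasSum (poissonWeight μ) (Real.exp μ - 1) := by
  have h : HasSum (fun k : ℕ => μ ^ k / (k.factorial : ℝ)) (Real.exp μ) := by
    rw [Real.exp_eq_exp_ℝ]; exact NormedSpace.expSeries_div_hasSum_exp μ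
  have := (hasSum_nat_add_iff' 1).2 h
  rw [Finset.sum_range_one, pow_zero, Nat.factorial_zero, Nat.cast_one, div_one] at this
  exact this

/-- The unnormalized density `∑_{k ≥ 1} μ^k / k! f^{*k}`. -/
def jumpMixture (μ : ℝ) (f : ℝ → ℝ) (x : ℝ) : ℝ := ∑' k, poissonWeight μ k * convPow f k x

variable {μ : ℝ}

theorem IsBoundedDensity.summable_mixture (hf : IsBoundedDensity M f) (hμ : 0 ≤ μ) (x : ℝ) :
    Summable fun k => poissonWeight μ k * OptimalThreshold.convPow f k x :=
  .of_nonneg_of_le (fun k => mul_nonneg (poissonWeight_nonneg hμ k) ((hf.convPow k).nonneg x))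
    (fun k => mul_le_mul_of_nonneg_left ((hf.convPow k).le x) (poissonWeight_nonneg hμ k))
    ((hasSum_poissonWeight μ).summable.mul_right M)

theorem IsBoundedDensity.jumpMixture_nonneg (hf : IsBoundedDensity M f) (hμ : 0 ≤ μ) (x : ℝ) :
    0 ≤ jumpMixture μ f x :=
  tsum_nonneg fun k => mul_nonneg (poissonWeight_nonneg hμ k) ((hf.convPow k).nonneg x)

theorem IsBoundedDensity.jumpMixture_le (hf : IsBoundedDensity M f) (hμ : 0 ≤ μ) (x : ℝ) :
    jumpMixture μ f x ≤ (Real.exp μ - 1) * M := by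
  rw [← ((hasSum_poissonWeight μ).mul_right M).tsum_eq]
  exact (hf.summable_mixture hμ x).tsum_le_tsum
    (fun k => mul_le_mul_of_nonneg_left ((hf.convPow k).le x) (poissonWeight_nonneg hμ k))
    ((hasSum_poissonWeight μ).summable.mul_right M)

/-- What remains after removing the single-jump term comes from two or more jumps, with total weight
`e^μ - 1 - μ` and each power at most `M`. This is second order in `μ`, so one jump dominates. -/
theorem IsBoundedDensity.jumpMixture_sub_mem (hf : IsBoundedDensity M f) (hμ : 0 ≤ μ) (x : ℝ) :
    jumpMixture μ f x - μ * f x ∈ Set.Icc 0 ((Real.exp μ - 1 - μ) * M) := by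
  have hw : HasSum (fun k => poissonWeight μ (k + 1)) (Real.exp μ - 1 - μ) := by
    simpa [poissonWeight] using (hasSum_nat_add_iff' 1).2 (hasSum_poissonWeight μ)
  have e : jumpMixture μ f x - μ * f x =
      ∑' k, poissonWeight μ (k + 1) * OptimalThreshold.convPow f (k + 1) x := by
    rw [jumpMixture, (hf.summable_mixture hμ x).tsum_eq_zero_add]
    simp [poissonWeight, OptimalThreshold.convPow]
  rw [e, ← (hw.mul_right M).tsum_eq]
  refine ⟨tsum_nonneg fun k =>
    mul_nonneg (poissonWeight_nonneg hμ _) ((hf.convPow _).nonneg x), ?_⟩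
  exact ((summable_nat_add_iff 1).2 (hf.summable_mixture hμ x)).tsum_le_tsum
    (fun k => mul_le_mul_of_nonneg_left ((hf.convPow _).le x) (poissonWeight_nonneg hμ _))
    (hw.mul_right M).summable

/-- Measurability passes to the pointwise limit of partial sums; by Tonelli the total mass is the
sum of the weights. -/
theorem IsBoundedDensity.integrable_jumpMixture (hf : IsBoundedDensity M f) (hμ : 0 ≤ μ) :
    Integrable (jumpMixture μ f) := by
  have hm : AEStronglyMeasurable (jumpMixture μ f) :=
    aestronglyMeasurable_of_tendsto_ae atTop
      (f := fun n x => ∑ k ∈ Finset.range n, poissonWeight μ k * OptimalThreshold.convPow f k x)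
      (fun n => (integrable_finsetSum _ fun k _ =>
        (hf.convPow k).integrable.const_mul (poissonWeight μ k)).1)
      (ae_of_all _ fun x => (hf.summable_mixture hμ x).hasSum.tendsto_sum_nat)
  refine ⟨hm, ?_⟩
  have hint (k : ℕ) : ∫⁻ x, ENNReal.ofReal (poissonWeight μ k * OptimalThreshold.convPow f k x) =
      ENNReal.ofReal (poissonWeight μ k) := by
    rw [← ofReal_integral_eq_lintegral_ofReal ((hf.convPow k).integrable.const_mul _)
      (ae_of_all _ fun x => mul_nonneg (poissonWeight_nonneg hμ k) ((hf.convPow k).nonneg x)),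
      integral_const_mul, (hf.convPow k).integral_eq, mul_one]
  have e (x : ℝ) : ‖jumpMixture μ f x‖ₑ =
      ∑' k, ENNReal.ofReal (poissonWeight μ k * OptimalThreshold.convPow f k x) := by
    rw [Real.enorm_of_nonneg (hf.jumpMixture_nonneg hμ x), jumpMixture,
      ENNReal.ofReal_tsum_of_nonneg
        (fun k => mul_nonneg (poissonWeight_nonneg hμ k) ((hf.convPow k).nonneg x))
        (hf.summable_mixture hμ x)]
  simp only [HasFiniteIntegral, e]
  rw [lintegral_tsum fun k =>
    ((hf.convPow k).integrable.const_mul _).1.aemeasurable.ennreal_ofReal]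
  simp only [hint]
  rw [← ENNReal.ofReal_tsum_of_nonneg (poissonWeight_nonneg hμ) (hasSum_poissonWeight μ).summable]
  exact ENNReal.ofReal_lt_top

/-- Termwise integration is allowed because the `k`-th integrand has norm integral at most `M` times
the `k`-th weight. -/
theorem IsBoundedDensity.hasSum_conv (hf : IsBoundedDensity M f) (hμ : 0 ≤ μ)
    (hg : IsBoundedDensity M' g) (x : ℝ) :
    HasSum (fun k => poissonWeight μ k * OptimalThreshold.conv g (OptimalThreshold.convPow f k) x)
      (OptimalThreshold.conv g (jumpMixture μ f) x) := by
  have hint (k : ℕ) := integrable_mul_comp_sub hg.integrable (hf.convPow k).integrable.1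
    (hf.convPow k).abs_le x
  have h := hasSum_integral_of_summable_integral_norm
    (F := fun k y => poissonWeight μ k * (g y * OptimalThreshold.convPow f k (x - y)))
    (fun k => (hint k).const_mul _) ?_
  · simp only [integral_const_mul, ← conv_apply] at h
    have e : OptimalThreshold.conv g (jumpMixture μ f) x =
      ∫ y, ∑' k, poissonWeight μ k * (g y * OptimalThreshold.convPow f k (x - y)) := ?_
    · rw [e]; exact h
    rw [conv_apply]
    refine integral_congr_ae (ae_of_all _ fun y => ?_)
    simp only [jumpMixture]
    rw [← tsum_mul_left]
    exact tsum_congr fun k => by ring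
  · refine .of_nonneg_of_le (fun k => integral_nonneg fun _ => norm_nonneg _) (fun k => ?_)
      ((hasSum_poissonWeight μ).summable.mul_right M)
    simp_rw [Real.norm_of_nonneg (mul_nonneg (poissonWeight_nonneg hμ k)
      (mul_nonneg (hg.nonneg _) ((hf.convPow k).nonneg _)))]
    rw [integral_const_mul, ← conv_apply]
    exact mul_le_mul_of_nonneg_left ((hg.conv (hf.convPow k)).le x) (poissonWeight_nonneg hμ k)

theorem IsBoundedDensity.hasSum_integral_conv (hf : IsBoundedDensity M f) (hμ : 0 ≤ μ)
    (hg : IsBoundedDensity M' g) {B : ℝ} (hB : 0 ≤ B) :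
    HasSum (fun k => poissonWeight μ k *
        ∫ x in -B..B, OptimalThreshold.conv g (OptimalThreshold.convPow f k) x)
      (∫ x in -B..B, OptimalThreshold.conv g (jumpMixture μ f) x) := by
  have hle : -B ≤ B := by linarith
  simp only [intervalIntegral.integral_of_le hle]
  have hd (k : ℕ) := hg.conv (hf.convPow k)
  have h := hasSum_integral_of_summable_integral_norm (μ := volume.restrict (Set.Ioc (-B) B))
    (F := fun k y => poissonWeight μ k *
      OptimalThreshold.conv g (OptimalThreshold.convPow f k) y)
    (fun k => ((hd k).integrable.const_mul _).integrableOn) ?_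
  · simp only [integral_const_mul] at h
    rw [integral_congr_ae (ae_of_all _ fun y => (hf.hasSum_conv hμ hg y).tsum_eq)] at h
    exact h
  · refine .of_nonneg_of_le (fun k => integral_nonneg fun _ => norm_nonneg _) (fun k => ?_)
      (hasSum_poissonWeight μ).summable
    simp_rw [Real.norm_of_nonneg (mul_nonneg (poissonWeight_nonneg hμ k) ((hd k).nonneg _))]
    rw [integral_const_mul]
    refine mul_le_of_le_one_right (poissonWeight_nonneg hμ k) ?_
    rw [← (hd k).integral_eq]
    exact setIntegral_le_integral (hd k).integrable (ae_of_all _ (hd k).nonneg)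

end Densities

/-! ### The loss function as an integral of densities. -/

section Loss

variable {Ω : Type*} [MeasurableSpace Ω] {P : Measure Ω}

/-- If `G` is independent of `(A, S)` and `A` is independent of `S`, then `A` is independent of
`G + S`. -/
theorem indepFun_add_of_indepFun_prodMk [IsProbabilityMeasure P] {α : Type*} [MeasurableSpace α]
    {G S : Ω → ℝ} {A : Ω → α} (hG : Measurable G) (hS : Measurable S) (hA : Measurable A)
    (h : IndepFun G (fun ω => (A ω, S ω)) P) (hAS : IndepFun A S P) :
    IndepFun A (fun ω => G ω + S ω) P := by
  have hpG : IsProbabilityMeasure (P.map G) := Measure.isProbabilityMeasure_map hG.aemeasurable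
  have hpS : IsProbabilityMeasure (P.map S) := Measure.isProbabilityMeasure_map hS.aemeasurable
  have hpA : IsProbabilityMeasure (P.map A) := Measure.isProbabilityMeasure_map hA.aemeasurable
  have hGS : IndepFun G S P := h.comp measurable_id measurable_snd
  have l1 := h.map_prod_eq_prod_map_map hG.aemeasurable (hA.prodMk hS).aemeasurable
  rw [hAS.map_prod_eq_prod_map_map hA.aemeasurable hS.aemeasurable] at l1
  have l2 := hGS.map_prod_eq_prod_map_map hG.aemeasurable hS.aemeasurable
  rw [indepFun_iff_measure_inter_preimage_eq_mul]
  intro s t hs ht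
  have ht' : MeasurableSet {x : ℝ × ℝ | x.1 + x.2 ∈ t} := (measurable_fst.add measurable_snd) ht
  have hst : MeasurableSet {x : ℝ × (α × ℝ) | x.2.1 ∈ s ∧ x.1 + x.2.2 ∈ t} :=
    ((measurable_fst.comp measurable_snd) hs).inter
      ((measurable_fst.add (measurable_snd.comp measurable_snd)) ht)
  have e1 : P (A ⁻¹' s ∩ (fun ω => G ω + S ω) ⁻¹' t) =
      (P.map fun ω => (G ω, (A ω, S ω))) {x | x.2.1 ∈ s ∧ x.1 + x.2.2 ∈ t} := by
    rw [Measure.map_apply (hG.prodMk (hA.prodMk hS)) hst]; rfl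
  have e2 : P ((fun ω => G ω + S ω) ⁻¹' t) =
      (P.map fun ω => (G ω, S ω)) {x | x.1 + x.2 ∈ t} := by
    rw [Measure.map_apply (hG.prodMk hS) ht']; rfl
  -- Disintegrating over the value `g` of `G` leaves, for each `g`, a rectangle in `(A, S)`, whose
  -- measure factors.
  rw [e1, e2, l1, l2, Measure.prod_apply hst, Measure.prod_apply ht', ← Measure.map_apply hA hs,
    ← lintegral_const_mul _ (measurable_measure_prodMk_left ht')]
  refine lintegral_congr fun g => ?_
  rw [← Measure.prod_prod]
  rfl

variable {M : ℝ} {f : ℝ → ℝ}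

/-- The sum of `k + 1` consecutive jumps has density `f^{*(k+1)}`. -/
theorem hasLaw_sum_jumps [IsProbabilityMeasure P] (hf : IsBoundedDensity M f) {ζ : ℕ → Ω → ℝ}
    (hm : ∀ j, Measurable (ζ j)) (hind : iIndepFun ζ P)
    (hlaw : ∀ j, HasLaw (ζ j) (densityMeasure f) P) (m k : ℕ) :
    HasLaw (fun ω => ∑ j ∈ Finset.Ico m (m + k + 1), ζ j ω) (densityMeasure (convPow f k)) P := by
  induction k with
  | zero => simpa [convPow] using hlaw m
  | succ k ih =>
    have := hf.isProbabilityMeasure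
    have := (hf.convPow k).isProbabilityMeasure
    have hi := (hind.indepFun_finsetSum_of_notMem hm (s := Finset.Ico m (m + k + 1))
      (i := m + k + 1) (by simp)).symm
    have e : (∑ j ∈ Finset.Ico m (m + k + 1), ζ j) =
        fun ω => ∑ j ∈ Finset.Ico m (m + k + 1), ζ j ω := by ext; simp
    rw [e] at hi
    have h := hi.hasLaw_fun_add (hlaw _) ih
    rw [densityMeasure_conv hf (hf.convPow k)] at h
    refine h.congr (ae_of_all _ fun ω => ?_)
    simp only [← add_assoc]
    rw [Finset.sum_Ico_succ_top (show m ≤ m + k + 1 by omega), add_comm]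

theorem isBoundedDensity_gaussianPDFReal (m : ℝ) {v : ℝ≥0} (hv : v ≠ 0) :
    IsBoundedDensity (√(2 * Real.pi * v))⁻¹ (gaussianPDFReal m v) where
  nonneg := gaussianPDFReal_nonneg m v
  le x := by
    rw [gaussianPDFReal_def]
    refine mul_le_of_le_one_right (by positivity) (Real.exp_le_one_iff.2 ?_)
    rw [neg_div, neg_nonpos]
    positivity
  integrable := integrable_gaussianPDFReal m v
  integral_eq := integral_gaussianPDFReal_eq_one m hv

theorem gaussianReal_eq_densityMeasure (m : ℝ) {v : ℝ≥0} (hv : v ≠ 0) :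
    gaussianReal m v = densityMeasure (gaussianPDFReal m v) := gaussianReal_of_var_ne_zero m hv

/-- The loss in terms of the densities of the increments. -/
theorem loss_eq [IsProbabilityMeasure P] {γ σ lam : ℝ → ℝ} {W I : ℝ≥0 → Ω → ℝ}
    {N : ℝ≥0 → Ω → ℕ} {ζ : ℕ → Ω → ℝ} {X : ℝ≥0 → Ω → ℝ} (hf : IsBoundedDensity M f)
    (hX : IsJumpDiffusion γ σ lam f W I N ζ X P) {t h : ℝ≥0} {m v μ : ℝ} (hv : 0 < v)
    (hσ : ContinuousOn σ (Set.Icc 0 ((t + h : ℝ≥0) : ℝ)))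
    (hγ : IntervalIntegrable γ volume 0 t) (hγ' : IntervalIntegrable γ volume t (t + h))
    (hm : ∫ u in (t : ℝ)..(t + h), γ u = m) (hv' : ∫ u in (t : ℝ)..(t + h), σ u ^ 2 = v)
    (hμ : ∫ u in (t : ℝ)..(t + h), lam u = μ) (hμ0 : 0 ≤ μ) {B : ℝ} (hB : 0 ≤ B) :
    loss X N P t h B = Real.exp (-μ) * (1 - (∫ x in -B..B, gaussianPDFReal m v.toNNReal x) +
      ∫ x in -B..B, conv (gaussianPDFReal m v.toNNReal) (jumpMixture μ f) x) := by
  have hvn : v.toNNReal ≠ 0 := by simpa using hv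
  have hφ := isBoundedDensity_gaussianPDFReal m hvn
  set φ := gaussianPDFReal m v.toNNReal with hφdef
  set G : Ω → ℝ := fun ω => contPart γ I (t + h) ω - contPart γ I t ω with hG
  set A : Ω → ℕ × ℕ := fun ω => (N t ω, N (t + h) ω) with hA
  have hIm (s : ℝ≥0) : Measurable (I s) := (hX.integral s).1
  have hGm : Measurable G := ((hIm _).const_add _).sub ((hIm _).const_add _)
  have hAm : Measurable A := (hX.poisson.measurable t).prodMk (hX.poisson.measurable (t + h))
  have hGlaw : HasLaw G (densityMeasure φ) P := by
    have h1 := hX.integral.hasLaw_sub hX.brownian.toIsPreBrownianReal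
      (le_self_add : t ≤ t + h) hσ
    rw [NNReal.coe_add, hv'] at h1
    have h2 := gaussianReal_const_add h1 m
    rw [zero_add, gaussianReal_eq_densityMeasure _ hvn] at h2
    refine h2.congr (ae_of_all _ fun ω => ?_)
    simp only [hG, contPart, NNReal.coe_add]
    rw [← intervalIntegral.integral_add_adjacent_intervals hγ hγ', hm]
    ring
  have hGind : IndepFun G (fun ω => ((fun t => N t ω, fun j => ζ j ω) : (ℝ≥0 → ℕ) × (ℕ → ℝ))) P :=
    hX.cont_indep_jump.comp (φ := fun x : ℝ≥0 → ℝ => x (t + h) - x t) (by fun_prop) measurable_id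
  -- The sum of the jumps occurring in the window has random index bounds. With the bounds frozen it
  -- becomes a functional `S` of `ζ` alone, and `G + S` is independent of the pair of counts. The
  -- no-jump event uses `S = 0`.
  have hAind (S : (ℕ → ℝ) → ℝ) (hS : Measurable S) :
      IndepFun A (fun ω => G ω + S fun j => ζ j ω) P := by
    have hpair : Measurable fun x : ℝ≥0 → ℕ => (x t, x (t + h)) := by fun_prop
    refine indepFun_add_of_indepFun_prodMk hGm (hS.comp (measurable_pi_lambda _ hX.ζ_measurable))
      hAm ?_ ?_
    · exact hGind.comp measurable_id
        ((hpair.comp measurable_fst).prodMk (hS.comp measurable_snd))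
    · exact hX.N_indep_ζ.comp hpair hS
  have hdlaw (n : ℕ) : P {ω | N (t + h) ω - N t ω = n} =
      ENNReal.ofReal (Real.exp (-μ) * μ ^ n / (n.factorial : ℝ)) := by
    have h1 := hX.poisson.law t (t + h) le_self_add
    rw [NNReal.coe_add, hμ] at h1
    rw [h1.measure_eq (p := fun k => k = n) (by measurability)]
    simp [poissonMeasure_singleton, Real.coe_toNNReal _ hμ0]
  -- Subtraction of counts is truncated in `ℕ`; monotonicity makes a zero difference mean equal
  -- counts and lets the jump sum be written over `Finset.Ico`.
  have hmono : ∀ᵐ ω ∂P, N t ω ≤ N (t + h) ω := by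
    filter_upwards [hX.poisson.mono] with ω hω using hω le_self_add
  have hballm : MeasurableSet {x : ℝ | |x| ≤ B} := measurableSet_le (by fun_prop) (by fun_prop)
  have hballm' : MeasurableSet {x : ℝ | B < |x|} := measurableSet_lt (by fun_prop) (by fun_prop)
  have hno : P.real {ω | B < |X (t + h) ω - X t ω| ∧ N (t + h) ω = N t ω} =
      Real.exp (-μ) * (1 - ∫ x in -B..B, φ x) := by
    have e : {ω | B < |X (t + h) ω - X t ω| ∧ N (t + h) ω = N t ω} =
        A ⁻¹' {x | x.2 = x.1} ∩ (fun ω => G ω + 0) ⁻¹' {x | B < |x|} := by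
      ext ω
      simp only [Set.mem_ofPred_eq, Set.mem_inter_iff, Set.mem_preimage, hA, hX.eq, jumpPart, hG]
      refine and_comm.trans (and_congr_right fun h0 => ?_)
      rw [h0, add_sub_add_right_eq_sub, add_zero]
    have hp := hφ.isProbabilityMeasure
    have h0 : P (A ⁻¹' {x | x.2 = x.1}) = ENNReal.ofReal (Real.exp (-μ)) := by
      have := hdlaw 0
      simp only [pow_zero, mul_one, Nat.factorial_zero, Nat.cast_one, div_one] at this
      rw [← this]
      refine measure_congr ?_
      filter_upwards [hmono] with ω hω
      refine propext ?_
      change N (t + h) ω = N t ω ↔ N (t + h) ω - N t ω = 0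
      omega
    rw [e, measureReal_def, (hAind (fun _ => 0) measurable_const).measure_inter_preimage_eq_mul
      _ _ (by measurability) hballm', ENNReal.toReal_mul, h0,
      ENNReal.toReal_ofReal (Real.exp_nonneg _)]
    congr 1
    have h1 : P ((fun ω => G ω + 0) ⁻¹' {x | B < |x|}) = densityMeasure φ {x | |x| ≤ B}ᶜ := by
      have h2 := hGlaw.measure_eq (p := fun x => B < |x|) hballm'
      simp only [add_zero]
      refine h2.trans ?_
      congr 1
      ext x; simp
    rw [h1, ← measureReal_def, probReal_compl_eq_one_sub hballm, hφ.real_abs_le hB]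
  have hyes : P {ω | |X (t + h) ω - X t ω| ≤ B ∧ N (t + h) ω ≠ N t ω} =
      ∑' k, ENNReal.ofReal (Real.exp (-μ) * (poissonWeight μ k *
        ∫ x in -B..B, conv φ (convPow f k) x)) := by
    -- Partition by the count `j` before the window and the number `k + 1` of jumps inside it; on
    -- each piece the index bounds are deterministic.
    set E : ℕ → ℕ → Set Ω := fun k j => A ⁻¹' {(j, j + k + 1)} ∩
      (fun ω => G ω + ∑ i ∈ Finset.Ico j (j + k + 1), ζ i ω) ⁻¹' {x | |x| ≤ B} with hE
    have hSm (k j : ℕ) : Measurable fun x : ℕ → ℝ => ∑ i ∈ Finset.Ico j (j + k + 1), x i := by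
      fun_prop
    have hEm (k j : ℕ) : MeasurableSet (E k j) :=
      (hAm (measurableSet_singleton _)).inter
        ((hGm.add ((hSm k j).comp (measurable_pi_lambda _ hX.ζ_measurable))) hballm)
    have hEeq (k j : ℕ) : P (E k j) = P (A ⁻¹' {(j, j + k + 1)}) *
        ENNReal.ofReal (∫ x in -B..B, conv φ (convPow f k) x) := by
      rw [hE]
      simp only
      rw [(hAind _ (hSm k j)).measure_inter_preimage_eq_mul _ _
        (measurableSet_singleton _) hballm]
      congr 1
      have hp1 := hφ.isProbabilityMeasure
      have hp2 := (hf.convPow k).isProbabilityMeasure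
      have hi : IndepFun G (fun ω => ∑ i ∈ Finset.Ico j (j + k + 1), ζ i ω) P :=
        hGind.comp measurable_id ((hSm k j).comp measurable_snd)
      have hl := hi.hasLaw_fun_add hGlaw
        (hasLaw_sum_jumps hf hX.ζ_measurable hX.ζ_indep hX.ζ_law j k)
      rw [densityMeasure_conv hφ (hf.convPow k)] at hl
      have h2 := hl.measure_eq (p := fun x => |x| ≤ B) hballm
      refine h2.trans ?_
      have hp3 := (hφ.conv (hf.convPow k)).isProbabilityMeasure
      rw [← (hφ.conv (hf.convPow k)).real_abs_le hB, measureReal_def,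
        ENNReal.ofReal_toReal (measure_ne_top _ _)]
    have hdisj : Pairwise (Function.onFun Disjoint fun x : ℕ × ℕ => E x.1 x.2) := by
      intro x y hxy
      refine Set.disjoint_left.2 fun ω hx hy => hxy ?_
      have h1 : (N t ω, N (t + h) ω) = (x.2, x.2 + x.1 + 1) := hx.1
      have h2 : (N t ω, N (t + h) ω) = (y.2, y.2 + y.1 + 1) := hy.1
      rw [h1, Prod.mk.injEq] at h2
      ext <;> omega
    have hU : {ω | |X (t + h) ω - X t ω| ≤ B ∧ N (t + h) ω ≠ N t ω} =ᵐ[P]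
        ⋃ x : ℕ × ℕ, E x.1 x.2 := by
      filter_upwards [hmono] with ω hω
      refine propext ?_
      change (|X (t + h) ω - X t ω| ≤ B ∧ N (t + h) ω ≠ N t ω) ↔ ω ∈ ⋃ x : ℕ × ℕ, E x.1 x.2
      have hd : X (t + h) ω - X t ω = G ω + ∑ i ∈ Finset.Ico (N t ω) (N (t + h) ω), ζ i ω := by
        rw [Finset.sum_Ico_eq_sub _ hω, hX.eq, hX.eq]
        simp only [hG, jumpPart]
        ring
      rw [hd, Set.mem_iUnion]
      constructor
      · rintro ⟨h1, h2⟩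
        have e1 : N t ω + (N (t + h) ω - N t ω - 1) + 1 = N (t + h) ω := by omega
        refine ⟨(N (t + h) ω - N t ω - 1, N t ω), ?_, ?_⟩
        · change (N t ω, N (t + h) ω) = (N t ω, N t ω + (N (t + h) ω - N t ω - 1) + 1)
          rw [e1]
        · simp only [Set.mem_preimage, Set.mem_ofPred_eq]
          rw [e1]
          exact h1
      · rintro ⟨⟨k, j⟩, h1, h2⟩
        have h3 : (N t ω, N (t + h) ω) = (j, j + k + 1) := h1
        rw [Prod.mk.injEq] at h3
        rw [h3.1, h3.2]
        exact ⟨h2, by omega⟩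
    rw [measure_congr hU, measure_iUnion hdisj fun x => hEm x.1 x.2,
      ENNReal.tsum_prod (f := fun k j => P (E k j))]
    refine tsum_congr fun k => ?_
    simp only [hEeq]
    -- The density factor does not depend on `j`, so summing over `j` reassembles the event of
    -- exactly `k + 1` jumps, which has the Poisson weight.
    rw [ENNReal.tsum_mul_right, ← mul_assoc, ENNReal.ofReal_mul (by
      have := poissonWeight_nonneg hμ0 k
      positivity)]
    congr 1
    have h1 := hdlaw (k + 1)
    rw [mul_div_assoc] at h1
    rw [poissonWeight, ← h1, ← measure_iUnion]
    · refine measure_congr ?_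
      filter_upwards [hmono] with ω hω
      refine propext ?_
      change ω ∈ ⋃ i, A ⁻¹' {(i, i + k + 1)} ↔ N (t + h) ω - N t ω = k + 1
      rw [Set.mem_iUnion]
      constructor
      · rintro ⟨i, hi⟩
        have h3 : (N t ω, N (t + h) ω) = (i, i + k + 1) := hi
        rw [Prod.mk.injEq] at h3
        omega
      · intro hi
        refine ⟨N t ω, ?_⟩
        change (N t ω, N (t + h) ω) = (N t ω, N t ω + k + 1)
        rw [Prod.mk.injEq]
        omega
    · intro x y hxy
      refine Set.disjoint_left.2 fun ω hx hy => hxy ?_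
      have h1 : (N t ω, N (t + h) ω) = (x, x + k + 1) := hx
      have h2 : (N t ω, N (t + h) ω) = (y, y + k + 1) := hy
      rw [h1, Prod.mk.injEq] at h2
      exact h2.1
    · exact fun i => hAm (measurableSet_singleton _)
  have hs := (hf.hasSum_integral_conv hμ0 hφ hB).mul_left (Real.exp (-μ))
  have hnn (k : ℕ) : 0 ≤ Real.exp (-μ) * (poissonWeight μ k *
      ∫ x in -B..B, conv φ (convPow f k) x) :=
    mul_nonneg (Real.exp_nonneg _) (mul_nonneg (poissonWeight_nonneg hμ0 k)
      (intervalIntegral.integral_nonneg (by linarith)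
        fun x _ => (hφ.conv (hf.convPow k)).nonneg x))
  rw [loss, hno, measureReal_def, hyes, ← ENNReal.ofReal_tsum_of_nonneg hnn hs.summable,
    ENNReal.toReal_ofReal (tsum_nonneg hnn), hs.tsum_eq]
  ring

end Loss

/-! ### Sign change of the derivative and monotonicity of the density ratio. -/

section Threshold

/-- The symmetrization `x ↦ g x + g (-x)`. -/
def evenSum (g : ℝ → ℝ) (x : ℝ) : ℝ := g x + g (-x)

/-- If `q x + q (-x)` changes sign from `+` to `-` at `b`, then `b` is the strict minimum point on
`[0, ∞)` of `B ↦ c (1 - ∫_{-B}^B q)`. -/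
theorem lt_of_sign_change {q L : ℝ → ℝ} (hq : Continuous q) {c b : ℝ} (hc : 0 < c) (hb : 0 ≤ b)
    (hL : ∀ B, 0 ≤ B → L B = c * (1 - ∫ x in -B..B, q x))
    (hpos : ∀ x, 0 ≤ x → x < b → 0 < evenSum q x) (hneg : ∀ x, b < x → evenSum q x < 0)
    {B : ℝ} (hB : 0 ≤ B) (hne : B ≠ b) : L b < L B := by
  have hi (x y : ℝ) : IntervalIntegrable q volume x y := hq.intervalIntegrable x y
  have hsplit (x : ℝ) : ∫ y in -x..x, q y = ∫ y in (0 : ℝ)..x, evenSum q y := by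
    have h1 : ∫ y in (0 : ℝ)..x, evenSum q y =
        (∫ y in (0 : ℝ)..x, q y) + ∫ y in (0 : ℝ)..x, q (-y) :=
      intervalIntegral.integral_add (hi 0 x) ((hq.comp continuous_neg).intervalIntegrable 0 x)
    rw [← intervalIntegral.integral_add_adjacent_intervals (hi (-x) 0) (hi 0 x), h1,
      intervalIntegral.integral_comp_neg, neg_zero, add_comm]
  have he : Continuous (evenSum q) := hq.add (hq.comp continuous_neg)
  have hi' (x y : ℝ) : IntervalIntegrable (evenSum q) volume x y := he.intervalIntegrable x y
  rw [hL b hb, hL B hB, hsplit, hsplit]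
  refine mul_lt_mul_of_pos_left (sub_lt_sub_left ?_ _) hc
  rcases lt_or_gt_of_ne hne with h | h
  · have h1 := intervalIntegral.intervalIntegral_pos_of_pos_on (hi' B b)
      (fun x hx => hpos x (hB.trans hx.1.le) hx.2) h
    have := intervalIntegral.integral_add_adjacent_intervals (hi' 0 B) (hi' B b)
    linarith
  · have h1 := intervalIntegral.intervalIntegral_pos_of_pos_on (hi' b B).neg
      (fun x hx => neg_pos.2 (hneg x hx.1)) h
    simp only [Pi.neg_apply, intervalIntegral.integral_neg] at h1
    have := intervalIntegral.integral_add_adjacent_intervals (hi' 0 b) (hi' b B)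
    linarith

/-- The numerator of the increment of `B ↦ cosh (a B) / cosh (m B)`. -/
def coshKernel (m s d a : ℝ) : ℝ :=
  Real.sinh ((a + m) * s) * Real.sinh ((a - m) * d) +
    Real.sinh ((a - m) * s) * Real.sinh ((a + m) * d)

/-- Half-sum and half-difference coordinates turn the difference of `cosh` products into `sinh`
products, whose signs depend only on those of `a + m` and `a - m`. -/
theorem coshKernel_eq (m s d a : ℝ) :
    Real.cosh (a * (s + d)) * Real.cosh (m * (s - d)) -
      Real.cosh (a * (s - d)) * Real.cosh (m * (s + d)) = coshKernel m s d a := by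
  unfold coshKernel
  simp only [mul_add, mul_sub, add_mul, sub_mul, Real.cosh_add, Real.cosh_sub, Real.sinh_add,
    Real.sinh_sub]
  ring

theorem coshKernel_neg (m s d a : ℝ) : coshKernel m s d (-a) = coshKernel m s d a := by
  unfold coshKernel
  rw [show (-a + m) * s = -((a - m) * s) by ring, show (-a - m) * d = -((a + m) * d) by ring,
    show (-a - m) * s = -((a + m) * s) by ring, show (-a + m) * d = -((a - m) * d) by ring]
  simp only [Real.sinh_neg]
  ring

variable {m s d a : ℝ}

theorem coshKernel_nonneg (hm : 0 ≤ m) (hs : 0 ≤ s) (hd : 0 ≤ d) (ha : m ≤ |a|) :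
    0 ≤ coshKernel m s d a := by
  wlog h0 : 0 ≤ a generalizing a
  · rw [← coshKernel_neg]
    exact this (by rwa [abs_neg]) (by linarith)
  rw [abs_of_nonneg h0] at ha
  have h1 : 0 ≤ a + m := by linarith
  have h2 : 0 ≤ a - m := by linarith
  unfold coshKernel
  have := Real.sinh_nonneg_iff.2 (mul_nonneg h1 hs)
  have := Real.sinh_nonneg_iff.2 (mul_nonneg h1 hd)
  have := Real.sinh_nonneg_iff.2 (mul_nonneg h2 hs)
  have := Real.sinh_nonneg_iff.2 (mul_nonneg h2 hd)
  positivity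

/-- For `a ≥ 3m` both `a + m` and `a - m` are at least `2m`, and the second product is nonnegative.
The value `3m` is chosen to give the same quantity as in `neg_le_coshKernel`, so that gain and loss
compare independently of `s` and `d`. -/
theorem le_coshKernel (hm : 0 ≤ m) (hs : 0 ≤ s) (hd : 0 ≤ d) (ha : 3 * m ≤ |a|) :
    Real.sinh (2 * m * s) * Real.sinh (2 * m * d) ≤ coshKernel m s d a := by
  wlog h0 : 0 ≤ a generalizing a
  · rw [← coshKernel_neg]
    exact this (by rwa [abs_neg]) (by linarith)
  rw [abs_of_nonneg h0] at ha
  have h1 : Real.sinh (2 * m * s) ≤ Real.sinh ((a + m) * s) :=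
    Real.sinh_le_sinh.2 (mul_le_mul_of_nonneg_right (by linarith) hs)
  have h2 : Real.sinh (2 * m * d) ≤ Real.sinh ((a - m) * d) :=
    Real.sinh_le_sinh.2 (mul_le_mul_of_nonneg_right (by linarith) hd)
  have h3 := Real.sinh_nonneg_iff.2 (mul_nonneg (show 0 ≤ a - m by linarith) hs)
  have h4 := Real.sinh_nonneg_iff.2 (mul_nonneg (show 0 ≤ a + m by linarith) hd)
  have h5 := Real.sinh_nonneg_iff.2 (mul_nonneg (show 0 ≤ 2 * m by linarith) hs)
  have h6 := Real.sinh_nonneg_iff.2 (mul_nonneg (show 0 ≤ 2 * m by linarith) hd)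
  unfold coshKernel
  have := mul_le_mul h1 h2 h6 (h5.trans h1)
  nlinarith [mul_nonneg h3 h4]

/-- Here `m + a` and `m - a` both lie in `[0, 2m]`, which bounds each of the two products. -/
theorem neg_le_coshKernel (hs : 0 ≤ s) (hd : 0 ≤ d) (ha : |a| ≤ m) :
    -(2 * (Real.sinh (2 * m * s) * Real.sinh (2 * m * d))) ≤ coshKernel m s d a := by
  obtain ⟨ha1, ha2⟩ := _root_.abs_le.1 ha
  have key (x y : ℝ) (hx : 0 ≤ x) (hy : 0 ≤ y) (hx' : x ≤ 2 * m) (hy' : y ≤ 2 * m) :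
      Real.sinh (x * s) * Real.sinh (y * d) ≤ Real.sinh (2 * m * s) * Real.sinh (2 * m * d) :=
    mul_le_mul (Real.sinh_le_sinh.2 (mul_le_mul_of_nonneg_right hx' hs))
      (Real.sinh_le_sinh.2 (mul_le_mul_of_nonneg_right hy' hd))
      (Real.sinh_nonneg_iff.2 (mul_nonneg hy hd))
      (Real.sinh_nonneg_iff.2 (mul_nonneg (hx.trans hx') hs))
  have k1 := key (m + a) (m - a) (by linarith) (by linarith) (by linarith) (by linarith)
  have k2 := key (m - a) (m + a) (by linarith) (by linarith) (by linarith) (by linarith)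
  have e : coshKernel m s d a = -(Real.sinh ((m + a) * s) * Real.sinh ((m - a) * d)) -
      Real.sinh ((m - a) * s) * Real.sinh ((m + a) * d) := by
    unfold coshKernel
    rw [show (a - m) * d = -((m - a) * d) by ring, show (a - m) * s = -((m - a) * s) by ring,
      add_comm a m]
    simp only [Real.sinh_neg]
    ring
  rw [e]
  linarith

/-! ### Gaussian densities -/

variable {v : ℝ}

theorem gaussianPDFReal_toNNReal (hv : 0 ≤ v) (m x : ℝ) : gaussianPDFReal m v.toNNReal x =
    (√(2 * Real.pi * v))⁻¹ * Real.exp (-(x - m) ^ 2 / (2 * v)) := by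
  rw [gaussianPDFReal_def, Real.coe_toNNReal _ hv]

/-- Factoring out the value at `B` produces the term `1 + e^{-2Bm/v}` of the fixed-point equation.
-/
theorem evenSum_gaussianPDFReal (hv : 0 < v) (m B : ℝ) :
    evenSum (gaussianPDFReal m v.toNNReal) B = (√(2 * Real.pi * v))⁻¹ *
      Real.exp (-(B - m) ^ 2 / (2 * v)) * (1 + Real.exp (-2 * B * m / v)) := by
  simp only [evenSum, gaussianPDFReal_toNNReal hv.le]
  rw [show -(-B - m) ^ 2 / (2 * v) = -(B - m) ^ 2 / (2 * v) + -2 * B * m / v by field_simp; ring,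
    Real.exp_add]
  ring

/-- The symmetrized Gaussian density at `B`, centred at `x`, in terms of `cosh`. -/
theorem gaussianPDFReal_sub_add (hv : 0 < v) (m B x : ℝ) :
    gaussianPDFReal m v.toNNReal (B - x) + gaussianPDFReal m v.toNNReal (-B - x) =
      2 * (√(2 * Real.pi * v))⁻¹ * Real.exp (-B ^ 2 / (2 * v)) *
        (Real.exp (-(x + m) ^ 2 / (2 * v)) * Real.cosh ((x + m) * (B / v))) := by
  simp only [gaussianPDFReal_toNNReal hv.le, Real.cosh_eq]
  rw [show -(B - x - m) ^ 2 / (2 * v) =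
      -B ^ 2 / (2 * v) + -(x + m) ^ 2 / (2 * v) + (x + m) * (B / v) by field_simp; ring,
    show -(-B - x - m) ^ 2 / (2 * v) =
      -B ^ 2 / (2 * v) + -(x + m) ^ 2 / (2 * v) + -((x + m) * (B / v)) by field_simp; ring]
  simp only [Real.exp_add]
  ring

theorem continuous_gaussianPDFReal (m : ℝ) (v : ℝ≥0) : Continuous (gaussianPDFReal m v) := by
  rw [gaussianPDFReal_def]
  fun_prop

variable {F : ℝ → ℝ} {C : ℝ}

theorem conv_gaussianPDFReal_eq (m : ℝ) (v : ℝ≥0) (F : ℝ → ℝ) (x : ℝ) :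
    conv (gaussianPDFReal m v) F x = ∫ y, F y * gaussianPDFReal m v (x - y) := by
  unfold conv
  rw [convolution_mul_swap]
  simp only [mul_comm]

theorem integrable_mul_gaussianPDFReal (hF : Integrable F) (m : ℝ) {v : ℝ≥0} (hv : v ≠ 0)
    (x : ℝ) : Integrable fun y => F y * gaussianPDFReal m v (x - y) :=
  integrable_mul_comp_sub hF (integrable_gaussianPDFReal m v).1
    (isBoundedDensity_gaussianPDFReal m hv).abs_le x

theorem continuous_conv_gaussianPDFReal (hF : Integrable F) (m : ℝ) {v : ℝ≥0} (hv : v ≠ 0) :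
    Continuous (conv (gaussianPDFReal m v) F) := by
  have e : conv (gaussianPDFReal m v) F =
      convolution F (gaussianPDFReal m v) (ContinuousLinearMap.mul ℝ ℝ) volume := by
    ext x
    rw [conv_gaussianPDFReal_eq]
    simp [convolution]
  rw [e]
  refine BddAbove.continuous_convolution_right_of_integrable _ ?_ hF (continuous_gaussianPDFReal m v)
  refine ⟨(√(2 * Real.pi * v))⁻¹, ?_⟩
  rintro _ ⟨x, rfl⟩
  exact (isBoundedDensity_gaussianPDFReal m hv).abs_le x

/-- The symmetrized ratio `(φ * F) / φ` is strictly increasing on `[0, ∞)`. -/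
theorem evenSum_conv_mul_lt {c : ℝ} (hm : 0 < m) (hv : 0 < v) (hF : Integrable F)
    (hF0 : ∀ x, 0 ≤ F x) (hFC : ∀ x, F x ≤ C) (hmv : 8 * m ≤ √v)
    (hlow : (∀ x ∈ Set.Icc (4 * m) √v, c ≤ F x) ∨ (∀ x ∈ Set.Icc (-√v) (-(4 * m)), c ≤ F x))
    (hc : 0 < c) (hCc : 8 * C * m < c * Real.exp (-2) * √v) {B B' : ℝ} (hB : 0 ≤ B) (hBB : B < B') :
    evenSum (conv (gaussianPDFReal m v.toNNReal) F) B *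
        evenSum (gaussianPDFReal m v.toNNReal) B' <
      evenSum (conv (gaussianPDFReal m v.toNNReal) F) B' *
        evenSum (gaussianPDFReal m v.toNNReal) B := by
  have hvn : v.toNNReal ≠ 0 := by simpa using hv
  set φ := gaussianPDFReal m v.toNNReal with hφ
  set s := (B' + B) / (2 * v) with hs
  set d := (B' - B) / (2 * v) with hd
  have hs0 : 0 < s := div_pos (by linarith) (by positivity)
  have hd0 : 0 < d := div_pos (by linarith) (by positivity)
  have hsd : B' / v = s + d := by rw [hs, hd]; field_simp; ring
  have hsd' : B / v = s - d := by rw [hs, hd]; field_simp; ring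
  set SD := Real.sinh (2 * m * s) * Real.sinh (2 * m * d) with hSD
  have hSD0 : 0 < SD :=
    mul_pos (Real.sinh_pos_iff.2 (by positivity)) (Real.sinh_pos_iff.2 (by positivity))
  have hint (b : ℝ) : Integrable fun y => F y * (φ (b - y) + φ (-b - y)) := by
    simp only [mul_add]
    exact (integrable_mul_gaussianPDFReal hF m hvn b).add
      (integrable_mul_gaussianPDFReal hF m hvn (-b))
  have hconv (b : ℝ) : evenSum (conv φ F) b = ∫ y, F y * (φ (b - y) + φ (-b - y)) := by
    simp only [evenSum, conv_gaussianPDFReal_eq, hφ, mul_add]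
    rw [integral_add (integrable_mul_gaussianPDFReal hF m hvn b)
      (integrable_mul_gaussianPDFReal hF m hvn (-b))]
  have hu (b : ℝ) : evenSum φ b = 2 * (√(2 * Real.pi * v))⁻¹ * Real.exp (-b ^ 2 / (2 * v)) *
        (Real.exp (-m ^ 2 / (2 * v)) * Real.cosh (m * (b / v))) := by
    have := gaussianPDFReal_sub_add hv m b 0
    simpa [evenSum, hφ] using this
  set κ := 2 * (√(2 * Real.pi * v))⁻¹ * Real.exp (-B ^ 2 / (2 * v)) *
    (2 * (√(2 * Real.pi * v))⁻¹ * Real.exp (-B' ^ 2 / (2 * v))) * Real.exp (-m ^ 2 / (2 * v))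
    with hκ
  have hκ0 : 0 < κ := by positivity
  -- The cross difference is an integral over `y` with all `B`-dependent Gaussian factors in the
  -- constant `κ`; its sign at `y` is that of the `cosh` kernel at `y + m`.
  have hpt (y : ℝ) : F y * (φ (B' - y) + φ (-B' - y)) * evenSum φ B -
      F y * (φ (B - y) + φ (-B - y)) * evenSum φ B' =
      κ * (F y * (Real.exp (-(y + m) ^ 2 / (2 * v)) * coshKernel m s d (y + m))) := by
    rw [gaussianPDFReal_sub_add hv, gaussianPDFReal_sub_add hv, hu, hu, ← coshKernel_eq, hsd, hsd']
    ring
  have hexp1 (y : ℝ) : Real.exp (-(y + m) ^ 2 / (2 * v)) ≤ 1 := by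
    rw [Real.exp_le_one_iff, neg_div, neg_nonpos]; positivity
  have hsv : √v ^ 2 = v := Real.sq_sqrt hv.le
  have hsv0 : 0 < √v := Real.sqrt_pos.2 hv
  have hC0 : 0 ≤ C := (hF0 0).trans (hFC 0)
  obtain ⟨S, hSm, hSvol, hSlow, hSabs⟩ : ∃ S : Set ℝ, MeasurableSet S ∧
      volume S = ENNReal.ofReal (√v - 4 * m) ∧ (∀ x ∈ S, c ≤ F x) ∧
      ∀ x ∈ S, 4 * m ≤ |x| ∧ |x| ≤ √v := by
    rcases hlow with h | h
    · refine ⟨_, measurableSet_Icc, by simp, h, fun x hx => ?_⟩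
      rw [abs_of_nonneg (by linarith [hx.1])]
      exact hx
    · refine ⟨_, measurableSet_Icc, by simp; ring_nf, h, fun x hx => ?_⟩
      rw [abs_of_nonpos (by linarith [hx.2])]
      exact ⟨by linarith [hx.2], by linarith [hx.1]⟩
  -- Three regions: a definite gain on `S`, a controlled loss on `[-2m, 0]`, which is exactly `|y +
  -- m| ≤ m`, and nonnegativity elsewhere.
  have hlb (y : ℝ) : S.indicator (fun _ => SD * (c * Real.exp (-2))) y -
      (Set.Icc (-(2 * m)) 0).indicator (fun _ => SD * (2 * C)) y ≤
      F y * (Real.exp (-(y + m) ^ 2 / (2 * v)) * coshKernel m s d (y + m)) := by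
    have hnn := mul_nonneg (hF0 y) (Real.exp_nonneg (-(y + m) ^ 2 / (2 * v)))
    rw [← mul_assoc (F y)]
    by_cases hyS : y ∈ S
    · have hy := hSabs y hyS
      have hyn : y ∉ Set.Icc (-(2 * m)) 0 := by
        intro hy'
        rw [abs_of_nonpos hy'.2] at hy
        linarith [hy'.1, hy.1]
      rw [Set.indicator_of_mem hyS, Set.indicator_of_notMem hyn, sub_zero]
      have habs : 3 * m ≤ |y + m| := by
        have := abs_sub_abs_le_abs_sub y (-m)
        rw [abs_neg, abs_of_pos hm, sub_neg_eq_add] at this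
        linarith [hy.1]
      have habs' : |y + m| ≤ 2 * √v := by
        have := abs_add_le y m
        rw [abs_of_pos hm] at this
        linarith [hy.2]
      -- `|y + m| ≤ 2√v` makes the Gaussian exponent at least `-2`.
      have he : Real.exp (-2) ≤ Real.exp (-(y + m) ^ 2 / (2 * v)) := by
        rw [Real.exp_le_exp, le_div_iff₀ (by positivity)]
        have := pow_le_pow_left₀ (abs_nonneg _) habs' 2
        rw [sq_abs, mul_pow, hsv] at this
        linarith
      have hk := le_coshKernel hm.le hs0.le hd0.le habs
      calc SD * (c * Real.exp (-2)) = c * Real.exp (-2) * SD := by ring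
        _ ≤ _ := mul_le_mul (mul_le_mul (hSlow y hyS) he (Real.exp_nonneg _) (hF0 y)) hk hSD0.le hnn
    · rw [Set.indicator_of_notMem hyS]
      by_cases hy : y ∈ Set.Icc (-(2 * m)) 0
      · rw [Set.indicator_of_mem hy, zero_sub]
        have hk := neg_le_coshKernel hs0.le hd0.le (m := m) (a := y + m)
          (_root_.abs_le.2 ⟨by linarith [hy.1], by linarith [hy.2]⟩)
        have hle : F y * Real.exp (-(y + m) ^ 2 / (2 * v)) ≤ C :=
          (mul_le_of_le_one_right (hF0 y) (hexp1 y)).trans (hFC y)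
        nlinarith [mul_le_mul_of_nonneg_left hk hnn, mul_le_mul_of_nonneg_right hle hSD0.le]
      · rw [Set.indicator_of_notMem hy, sub_zero]
        refine mul_nonneg hnn (coshKernel_nonneg hm.le hs0.le hd0.le ?_)
        by_contra! hcon
        obtain ⟨h1, h2⟩ := abs_lt.1 hcon
        exact hy ⟨by linarith, by linarith⟩
  have hi1 : Integrable (S.indicator fun _ : ℝ => SD * (c * Real.exp (-2))) :=
    (integrable_indicator_iff hSm).2 (integrableOn_const (by rw [hSvol]; exact ENNReal.ofReal_ne_top))
  have hi2 : Integrable ((Set.Icc (-(2 * m)) 0).indicator fun _ : ℝ => SD * (2 * C)) :=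
    (integrable_indicator_iff measurableSet_Icc).2 (integrableOn_const measure_Icc_lt_top.ne)
  have hi3 : Integrable fun y => F y * (φ (B' - y) + φ (-B' - y)) * evenSum φ B -
      F y * (φ (B - y) + φ (-B - y)) * evenSum φ B' :=
    ((hint B').mul_const _).sub ((hint B).mul_const _)
  have hpos : 0 < ∫ y, (F y * (φ (B' - y) + φ (-B' - y)) * evenSum φ B -
      F y * (φ (B - y) + φ (-B - y)) * evenSum φ B') := by
    refine lt_of_lt_of_le ?_ (integral_mono ((hi1.sub hi2).const_mul κ) hi3 fun y => ?_)
    · rw [integral_const_mul]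
      refine mul_pos hκ0 ?_
      rw [integral_sub' hi1 hi2, integral_indicator hSm, integral_indicator measurableSet_Icc]
      simp only [setIntegral_const, measureReal_def, hSvol, Real.volume_Icc, smul_eq_mul]
      rw [ENNReal.toReal_ofReal (by linarith), ENNReal.toReal_ofReal (by linarith)]
      -- Gain: a set of length at least `√v / 2`, because `8m ≤ √v`. Loss: length `2m` times `2C`.
      -- The hypothesis `hCc` is exactly the comparison of the two.
      have h1 : √v / 2 * (c * Real.exp (-2)) ≤ (√v - 4 * m) * (c * Real.exp (-2)) :=
        mul_le_mul_of_nonneg_right (by linarith) (by positivity)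
      have h2 : 0 < (√v - 4 * m) * (c * Real.exp (-2)) - 4 * m * C := by nlinarith
      nlinarith [mul_pos hSD0 h2]
    · simp only [hpt]
      exact mul_le_mul_of_nonneg_left (hlb y) hκ0.le
  rw [integral_sub ((hint B').mul_const _) ((hint B).mul_const _), integral_mul_const,
    integral_mul_const, ← hconv, ← hconv] at hpos
  linarith

/-- A strictly increasing ratio of continuous functions which is below `1` at `a` and above `1` at
`b` crosses `1` exactly once. -/
theorem exists_crossing {g u : ℝ → ℝ} (hg : Continuous g) (hu : Continuous u) {a b : ℝ}
    (ha : 0 ≤ a) (hab : a ≤ b) (hu0 : ∀ x, 0 < u x)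
    (hmono : ∀ x y, 0 ≤ x → x < y → g x * u y < g y * u x) (hga : g a < u a) (hgb : u b < g b) :
    ∃ c ∈ Set.Ioo a b, g c = u c ∧ (∀ x, 0 ≤ x → x < c → g x < u x) ∧
      ∀ x, c < x → u x < g x := by
  obtain ⟨c, hc, hc0⟩ : ∃ c ∈ Set.Ioo a b, g c - u c = 0 :=
    intermediate_value_Ioo hab (hg.sub hu).continuousOn ⟨sub_neg.2 hga, sub_pos.2 hgb⟩
  have hcc : g c = u c := sub_eq_zero.1 hc0
  refine ⟨c, hc, hcc, fun x hx hxc => ?_, fun x hx => ?_⟩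
  · have := hmono x c hx hxc
    rw [hcc, mul_comm (u c)] at this
    exact lt_of_mul_lt_mul_right this (hu0 c).le
  · have := hmono c x (ha.trans hc.1.le) hx
    rw [hcc, mul_comm] at this
    exact lt_of_mul_lt_mul_right this (hu0 c).le

end Threshold

/-! ### Quantitative estimates and existence of the crossing for a small time step. -/

section Estimates

/-- A bounded density with one-sided limits `a` (right) and `b` (left) at the origin, Lipschitz
there from each side. -/
structure IsJumpProfile (M K a b : ℝ) (f : ℝ → ℝ) : Prop extends IsBoundedDensity M f where
  lip_nonneg : 0 ≤ K
  right : ∀ x, 0 ≤ x → |f x - a| ≤ K * x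
  left : ∀ x, x < 0 → |f x - b| ≤ K * -x
  right_mem : a ∈ Set.Icc 0 M
  left_mem : b ∈ Set.Icc 0 M
  add_pos : 0 < a + b

variable {M K a b : ℝ} {f : ℝ → ℝ} {m v μ : ℝ}

/-- Recentring at the nearer of `±B` lowers the squared distance by at least `(B - m)²` when `|y| ≥
B`. Integrating the right side gives a Gaussian tail bound with no error-function estimate. -/
theorem gaussianPDFReal_le_of_le_abs (hm : 0 ≤ m) (hv : 0 < v) {B y : ℝ} (hmB : m ≤ B)
    (hy : B ≤ |y|) : gaussianPDFReal m v.toNNReal y ≤ Real.exp (-(B - m) ^ 2 / (2 * v)) *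
      (gaussianPDFReal B v.toNNReal y + gaussianPDFReal (-B) v.toNNReal y) := by
  have key (c : ℝ) (hc : (y - c) ^ 2 + (B - m) ^ 2 ≤ (y - m) ^ 2) :
      gaussianPDFReal m v.toNNReal y ≤ Real.exp (-(B - m) ^ 2 / (2 * v)) *
        gaussianPDFReal c v.toNNReal y := by
    rw [gaussianPDFReal_toNNReal hv.le, gaussianPDFReal_toNNReal hv.le, mul_left_comm,
      ← Real.exp_add, ← add_div]
    refine mul_le_mul_of_nonneg_left (Real.exp_le_exp.2 ?_) (by positivity)
    exact div_le_div_of_nonneg_right (by linarith) (by positivity)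
  have he := Real.exp_nonneg (-(B - m) ^ 2 / (2 * v))
  have h1 := mul_nonneg he (gaussianPDFReal_nonneg B v.toNNReal y)
  have h2 := mul_nonneg he (gaussianPDFReal_nonneg (-B) v.toNNReal y)
  rw [mul_add]
  rcases le_abs'.1 hy with h | h
  · have := key (-B) (by nlinarith)
    linarith
  · have := key B (by nlinarith)
    linarith

/-- For `|y| < B` the points `B - y` and `-B - y` lie on opposite sides of `0`, so each is compared
with its own one-sided limit, at distances summing to `2B`. For `|y| ≥ B` the crude bound `2M` meets
the Gaussian tail. -/
theorem abs_evenSum_conv_sub_le (hf : IsJumpProfile M K a b f) (hm : 0 ≤ m) (hv : 0 < v) {B : ℝ}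
    (hmB : m ≤ B) : |evenSum (conv (gaussianPDFReal m v.toNNReal) f) B - (a + b)| ≤
      2 * K * B + 4 * M * Real.exp (-(B - m) ^ 2 / (2 * v)) := by
  have hvn : v.toNNReal ≠ 0 := by simpa using hv
  set φ := gaussianPDFReal m v.toNNReal with hφ
  have hd (c : ℝ) := isBoundedDensity_gaussianPDFReal c hvn
  have hi (x : ℝ) : Integrable fun y => φ y * f (x - y) :=
    integrable_mul_comp_sub (hd m).integrable hf.integrable.1 hf.toIsBoundedDensity.abs_le x
  have e : evenSum (conv φ f) B - (a + b) =
      ∫ y, (φ y * f (B - y) + φ y * f (-B - y) - φ y * (a + b)) := by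
    have hi2 : Integrable fun y => φ y * f (B - y) + φ y * f (-B - y) := (hi B).add (hi (-B))
    have hi3 : Integrable fun y => φ y * (a + b) := (hd m).integrable.mul_const _
    rw [integral_sub hi2 hi3, integral_add (hi B) (hi (-B)), integral_mul_const, (hd m).integral_eq, one_mul, evenSum,
      conv_apply, conv_apply]
  set η := Real.exp (-(B - m) ^ 2 / (2 * v)) with hη
  have hη0 : 0 ≤ η := Real.exp_nonneg _
  have hg1 : Integrable fun y => φ y * (2 * K * B) := (hd m).integrable.mul_const _
  have hg2 : Integrable fun y => 2 * M * η *
      (gaussianPDFReal B v.toNNReal y + gaussianPDFReal (-B) v.toNNReal y) :=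
    ((hd B).integrable.add (hd (-B)).integrable).const_mul _
  have hM := hf.toIsBoundedDensity.bound_nonneg
  have hbound : ∀ y, ‖φ y * f (B - y) + φ y * f (-B - y) - φ y * (a + b)‖ ≤
      φ y * (2 * K * B) + 2 * M * η *
        (gaussianPDFReal B v.toNNReal y + gaussianPDFReal (-B) v.toNNReal y) := by
    intro y
    have hφ0 : 0 ≤ φ y := (hd m).nonneg y
    have hsum : 0 ≤ gaussianPDFReal B v.toNNReal y + gaussianPDFReal (-B) v.toNNReal y :=
      add_nonneg ((hd B).nonneg y) ((hd (-B)).nonneg y)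
    rw [show φ y * f (B - y) + φ y * f (-B - y) - φ y * (a + b) =
      φ y * ((f (B - y) - a) + (f (-B - y) - b)) by ring, norm_mul, Real.norm_of_nonneg hφ0,
      Real.norm_eq_abs]
    rcases lt_or_ge |y| B with h | h
    · obtain ⟨h1, h2⟩ := abs_lt.1 h
      have h3 := hf.right (B - y) (by linarith)
      have h4 := hf.left (-B - y) (by linarith)
      have h5 : |f (B - y) - a + (f (-B - y) - b)| ≤ 2 * K * B :=
        (abs_add_le _ _).trans (by linarith)
      have h6 := mul_le_mul_of_nonneg_left h5 hφ0
      have h7 : 0 ≤ 2 * M * η *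
        (gaussianPDFReal B v.toNNReal y + gaussianPDFReal (-B) v.toNNReal y) := by positivity
      linarith
    · have h1 : |f (B - y) - a + (f (-B - y) - b)| ≤ 2 * M := by
        have := hf.nonneg (B - y)
        have := hf.le (B - y)
        have := hf.nonneg (-B - y)
        have := hf.le (-B - y)
        have := hf.right_mem
        have := hf.left_mem
        simp only [Set.mem_Icc] at *
        exact _root_.abs_le.2 ⟨by linarith, by linarith⟩
      have h2 := gaussianPDFReal_le_of_le_abs hm hv hmB h
      have h3 := mul_le_mul h2 h1 (abs_nonneg _) (by positivity)
      have h4 : 0 ≤ φ y * (2 * K * B) :=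
        mul_nonneg hφ0 (mul_nonneg (mul_nonneg (by norm_num) hf.lip_nonneg) (hm.trans hmB))
      linarith
  rw [e, ← Real.norm_eq_abs]
  refine (norm_integral_le_of_norm_le (hg1.add hg2) (ae_of_all _ hbound)).trans (le_of_eq ?_)
  rw [integral_add' hg1 hg2, integral_mul_const,
    integral_const_mul, integral_add (hd B).integrable (hd (-B)).integrable, (hd m).integral_eq,
    (hd B).integral_eq, (hd (-B)).integral_eq]
  ring

theorem conv_jumpMixture_sub_mem (hf : IsBoundedDensity M f) (hμ : 0 ≤ μ) {M' : ℝ} {g : ℝ → ℝ}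
    (hg : IsBoundedDensity M' g) (x : ℝ) :
    conv g (jumpMixture μ f) x - μ * conv g f x ∈ Set.Icc 0 ((Real.exp μ - 1 - μ) * M) := by
  have hi1 : Integrable fun y => g y * jumpMixture μ f (x - y) :=
    integrable_mul_comp_sub hg.integrable (hf.integrable_jumpMixture hμ).1
      (fun x => by rw [abs_of_nonneg (hf.jumpMixture_nonneg hμ x)]; exact hf.jumpMixture_le hμ x) x
  have hi2 : Integrable fun y => g y * f (x - y) :=
    integrable_mul_comp_sub hg.integrable hf.integrable.1 hf.abs_le x
  have e : conv g (jumpMixture μ f) x - μ * conv g f x =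
      ∫ y, g y * (jumpMixture μ f (x - y) - μ * f (x - y)) := by
    rw [conv_apply, conv_apply, ← integral_const_mul, ← integral_sub hi1 (hi2.const_mul μ)]
    exact integral_congr_ae (ae_of_all _ fun y => by ring)
  have hi3 : Integrable fun y => g y * (jumpMixture μ f (x - y) - μ * f (x - y)) :=
    (hi1.sub (hi2.const_mul μ)).congr (ae_of_all _ fun y => by
      simp only [Pi.sub_apply]; ring)
  rw [e]
  have hmem (y : ℝ) := hf.jumpMixture_sub_mem hμ (x - y)
  refine ⟨integral_nonneg fun y => mul_nonneg (hg.nonneg y) (hmem y).1, ?_⟩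
  calc _ ≤ ∫ y, g y * ((Real.exp μ - 1 - μ) * M) :=
        integral_mono hi3 (hg.integrable.mul_const _)
          fun y => mul_le_mul_of_nonneg_left (hmem y).2 (hg.nonneg y)
    _ = _ := by rw [integral_mul_const, hg.integral_eq, one_mul]

theorem exp_sub_one_sub_le {μ : ℝ} (h0 : 0 ≤ μ) (h1 : μ ≤ 1) : Real.exp μ - 1 - μ ≤ μ ^ 2 := by
  have := Real.abs_exp_sub_one_sub_id_le (x := μ) (by rwa [abs_of_nonneg h0])
  exact (le_abs_self _).trans this

theorem abs_evenSum_conv_jumpMixture_sub_le (hf : IsJumpProfile M K a b f) (hm : 0 ≤ m)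
    (hv : 0 < v) (hμ : 0 ≤ μ) (hμ1 : μ ≤ 1) {B : ℝ} (hmB : m ≤ B) :
    |evenSum (conv (gaussianPDFReal m v.toNNReal) (jumpMixture μ f)) B - μ * (a + b)| ≤
      μ * (2 * K * B + 4 * M * Real.exp (-(B - m) ^ 2 / (2 * v)) + 2 * M * μ) := by
  have hvn : v.toNNReal ≠ 0 := by simpa using hv
  have hd := isBoundedDensity_gaussianPDFReal m hvn
  have hM := hf.toIsBoundedDensity.bound_nonneg
  have h1 := conv_jumpMixture_sub_mem hf.toIsBoundedDensity hμ hd B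
  have h2 := conv_jumpMixture_sub_mem hf.toIsBoundedDensity hμ hd (-B)
  have h3 := mul_le_mul_of_nonneg_left (abs_evenSum_conv_sub_le hf hm hv hmB) hμ
  have h4 := mul_le_mul_of_nonneg_right (exp_sub_one_sub_le hμ hμ1) hM
  rw [← abs_of_nonneg hμ, ← abs_mul, abs_of_nonneg hμ] at h3
  have h5 := _root_.abs_le.1 h3
  simp only [evenSum, Set.mem_Icc] at *
  exact _root_.abs_le.2 ⟨by nlinarith, by nlinarith⟩

theorem evenSum_conv_jumpMixture_le (hf : IsBoundedDensity M f) (hμ : 0 ≤ μ) (hμ1 : μ ≤ 1)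
    (hv : 0 < v) (B : ℝ) :
    evenSum (conv (gaussianPDFReal m v.toNNReal) (jumpMixture μ f)) B ≤ 4 * M * μ := by
  have hvn : v.toNNReal ≠ 0 := by simpa using hv
  have hd := isBoundedDensity_gaussianPDFReal m hvn
  have hM := hf.bound_nonneg
  have key (x : ℝ) : conv (gaussianPDFReal m v.toNNReal) (jumpMixture μ f) x ≤ 2 * M * μ := by
    have h1 := (conv_jumpMixture_sub_mem hf hμ hd x).2
    have h2 := mul_le_mul_of_nonneg_left ((hd.conv hf).le x) hμ
    have h3 := mul_le_mul_of_nonneg_right (exp_sub_one_sub_le hμ hμ1) hM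
    have h4 : μ ^ 2 * M ≤ μ * M := mul_le_mul_of_nonneg_right (by nlinarith) hM
    linarith
  have := key B
  have := key (-B)
  unfold evenSum
  linarith

/-- Since `p` may be `0` or `1`, only one of the two limits need be positive; on that side the
Lipschitz bound keeps `f` above half its limit. -/
theorem IsJumpProfile.exists_lower_bound (hf : IsJumpProfile M K a b f) :
    ∃ c δ : ℝ, 0 < c ∧ 0 < δ ∧
      ((∀ x ∈ Set.Ioc 0 δ, c ≤ f x) ∨ (∀ x ∈ Set.Ico (-δ) 0, c ≤ f x)) := by
  have hK := hf.lip_nonneg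
  have key (d x : ℝ) (hd : 0 < d) (hx : x ≤ d / (2 * (K + 1))) : K * x ≤ d / 2 := by
    rw [le_div_iff₀ (by positivity)] at hx
    rcases le_total x 0 with h | h
    · nlinarith
    · nlinarith
  rcases hf.right_mem.1.eq_or_lt with h | h
  · have hb : 0 < b := by have := hf.add_pos; linarith
    refine ⟨b / 2, b / (2 * (K + 1)), by positivity, by positivity, Or.inr fun x hx => ?_⟩
    have h1 := (_root_.abs_le.1 (hf.left x hx.2)).1
    have h2 := key b (-x) hb (by linarith [hx.1])
    linarith
  · refine ⟨a / 2, a / (2 * (K + 1)), by positivity, by positivity, Or.inl fun x hx => ?_⟩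
    have h1 := (_root_.abs_le.1 (hf.right x hx.1.le)).1
    have h2 := key a x h hx.2
    linarith

/-- An upper bound for the optimal threshold, of order `√(h log (1/h))`. -/
def thresholdBound (Γ S h : ℝ) : ℝ := h * Γ + √(4 * (h * S) * Real.log (1 / h))

/-- The ranges of the averaged coefficients over a short time step `h`. -/
structure IsRegime (Γ s S l₀ Λ h g w l : ℝ) : Prop where
  h_pos : 0 < h
  h_lt_one : h < 1
  g_pos : 0 < g
  g_le : g ≤ Γ
  s_pos : 0 < s
  s_le : s ≤ w
  le_S : w ≤ S
  l₀_pos : 0 < l₀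
  l₀_le : l₀ ≤ l
  le_Λ : l ≤ Λ
  mul_le_one : h * Λ ≤ 1

variable {h g w l Γ s S l₀ Λ : ℝ}

namespace IsRegime

theorem w_pos (hr : IsRegime Γ s S l₀ Λ h g w l) : 0 < w := hr.s_pos.trans_le hr.s_le

theorem l_pos (hr : IsRegime Γ s S l₀ Λ h g w l) : 0 < l := hr.l₀_pos.trans_le hr.l₀_le

theorem mean_pos (hr : IsRegime Γ s S l₀ Λ h g w l) : 0 < h * g := mul_pos hr.h_pos hr.g_pos

theorem var_pos (hr : IsRegime Γ s S l₀ Λ h g w l) : 0 < h * w := mul_pos hr.h_pos hr.w_pos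

theorem rate_pos (hr : IsRegime Γ s S l₀ Λ h g w l) : 0 < h * l := mul_pos hr.h_pos hr.l_pos

theorem mean_le (hr : IsRegime Γ s S l₀ Λ h g w l) : h * g ≤ h * Γ :=
  mul_le_mul_of_nonneg_left hr.g_le hr.h_pos.le

theorem var_le (hr : IsRegime Γ s S l₀ Λ h g w l) : h * w ≤ h * S :=
  mul_le_mul_of_nonneg_left hr.le_S hr.h_pos.le

theorem le_var (hr : IsRegime Γ s S l₀ Λ h g w l) : h * s ≤ h * w :=
  mul_le_mul_of_nonneg_left hr.s_le hr.h_pos.le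

theorem rate_le (hr : IsRegime Γ s S l₀ Λ h g w l) : h * l ≤ h * Λ :=
  mul_le_mul_of_nonneg_left hr.le_Λ hr.h_pos.le

theorem rate_le_one (hr : IsRegime Γ s S l₀ Λ h g w l) : h * l ≤ 1 := hr.rate_le.trans hr.mul_le_one

theorem log_pos (hr : IsRegime Γ s S l₀ Λ h g w l) : 0 < Real.log (1 / h) :=
  Real.log_pos (by rw [lt_div_iff₀ hr.h_pos]; linarith [hr.h_lt_one])

theorem sqrt_two_pi_var_le (hr : IsRegime Γ s S l₀ Λ h g w l) :
    √(2 * Real.pi * (h * w)) ≤ √(2 * Real.pi * (h * S)) :=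
  Real.sqrt_le_sqrt (mul_le_mul_of_nonneg_left hr.var_le (by positivity))

/-- Both bounds on the mixture near `0` are proportional to the rate `h l`, which cancels. What
remains compares the mean, of order `h`, with the standard deviation, of order `√h`. -/
theorem evenSum_conv_mul_lt {c δ : ℝ} (hr : IsRegime Γ s S l₀ Λ h g w l)
    (hf : IsJumpProfile M K a b f) (hc : 0 < c)
    (hlow : (∀ x ∈ Set.Ioc 0 δ, c ≤ f x) ∨ (∀ x ∈ Set.Ico (-δ) 0, c ≤ f x))
    (h2 : 8 * √h * Γ ≤ √s) (h3 : √(h * S) ≤ δ)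
    (h4 : 16 * M * (√h * Γ) < c * Real.exp (-2) * √s) {x y : ℝ} (hx : 0 ≤ x) (hxy : x < y) :
    evenSum (conv (gaussianPDFReal (h * g) (h * w).toNNReal) (jumpMixture (h * l) f)) x *
        evenSum (gaussianPDFReal (h * g) (h * w).toNNReal) y <
      evenSum (conv (gaussianPDFReal (h * g) (h * w).toNNReal) (jumpMixture (h * l) f)) y *
        evenSum (gaussianPDFReal (h * g) (h * w).toNNReal) x := by
  have hm0 := hr.mean_pos
  have hv0 := hr.var_pos
  have hμ0 := hr.rate_pos
  have hM := hf.toIsBoundedDensity.bound_nonneg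
  have hh2 : √h * √h = h := Real.mul_self_sqrt hr.h_pos.le
  have hrh : 0 < √h := Real.sqrt_pos.2 hr.h_pos
  have hsv : √h * √s ≤ √(h * w) := by
    rw [← Real.sqrt_mul hr.h_pos.le]
    exact Real.sqrt_le_sqrt hr.le_var
  have hvδ : √(h * w) ≤ δ := (Real.sqrt_le_sqrt hr.var_le).trans h3
  have hFμ (x : ℝ) : h * l * f x ≤ jumpMixture (h * l) f x :=
    sub_nonneg.1 (hf.toIsBoundedDensity.jumpMixture_sub_mem hμ0.le x).1
  have hFC (x : ℝ) : jumpMixture (h * l) f x ≤ 2 * (h * l) * M := by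
    refine (hf.toIsBoundedDensity.jumpMixture_le hμ0.le x).trans
      (mul_le_mul_of_nonneg_right ?_ hM)
    have := exp_sub_one_sub_le hμ0.le hr.rate_le_one
    nlinarith [hr.rate_le_one]
  have hmΓ := hr.mean_le
  refine OptimalThreshold.evenSum_conv_mul_lt (c := h * l * c) hm0 hv0
    (hf.toIsBoundedDensity.integrable_jumpMixture hμ0.le)
    (hf.toIsBoundedDensity.jumpMixture_nonneg hμ0.le) hFC ?_ ?_ (mul_pos hμ0 hc) ?_ hx hxy
  · have := mul_le_mul_of_nonneg_left h2 hrh.le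
    have e : √h * (8 * √h * Γ) = 8 * (h * Γ) := by linear_combination 8 * Γ * hh2
    linarith
  · rcases hlow with hlow | hlow
    · refine Or.inl fun x hx => (mul_le_mul_of_nonneg_left (hlow x ?_) hμ0.le).trans (hFμ x)
      exact ⟨by linarith [hx.1], hx.2.trans hvδ⟩
    · refine Or.inr fun x hx => (mul_le_mul_of_nonneg_left (hlow x ?_) hμ0.le).trans (hFμ x)
      exact ⟨by linarith [hx.1], by linarith [hx.2]⟩
  · have i1 := mul_lt_mul_of_pos_left h4 hrh
    have e : √h * (16 * M * (√h * Γ)) = 16 * M * (h * Γ) := by linear_combination 16 * M * Γ * hh2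
    have i2 := mul_le_mul_of_nonneg_left hsv (show 0 ≤ c * Real.exp (-2) by positivity)
    have i3 := mul_le_mul_of_nonneg_left hmΓ (show 0 ≤ 16 * M by positivity)
    have i4 : 16 * M * (h * g) < c * Real.exp (-2) * √(h * w) := by linarith
    have i5 := mul_lt_mul_of_pos_left i4 hμ0
    calc 8 * (2 * (h * l) * M) * (h * g) = h * l * (16 * M * (h * g)) := by ring
      _ < h * l * (c * Real.exp (-2) * √(h * w)) := i5
      _ = _ := by ring

/-- At its mean the Gaussian density is of order `h^{-1/2}`, whereas the jump part is `O(h)`. -/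
theorem evenSum_conv_lt_at_mean (hr : IsRegime Γ s S l₀ Λ h g w l) (hf : IsBoundedDensity M f)
    (h5 : 4 * M * (h * Λ) * √(2 * Real.pi * (h * S)) < 1) :
    evenSum (conv (gaussianPDFReal (h * g) (h * w).toNNReal) (jumpMixture (h * l) f)) (h * g) <
      evenSum (gaussianPDFReal (h * g) (h * w).toNNReal) (h * g) := by
  have hv0 := hr.var_pos
  have hM := hf.bound_nonneg
  have hsq0 : 0 < √(2 * Real.pi * (h * w)) := by positivity
  refine (evenSum_conv_jumpMixture_le hf hr.rate_pos.le hr.rate_le_one hv0 _).trans_lt ?_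
  have i0 : 4 * M * (h * l) ≤ 4 * M * (h * Λ) :=
    mul_le_mul_of_nonneg_left hr.rate_le (by positivity)
  have i00 : 0 ≤ 4 * M * (h * l) := mul_nonneg (by positivity) hr.rate_pos.le
  have i1 : 4 * M * (h * l) * √(2 * Real.pi * (h * w)) < 1 :=
    lt_of_le_of_lt (mul_le_mul i0 hr.sqrt_two_pi_var_le hsq0.le (i00.trans i0)) h5
  have i2 : 4 * M * (h * l) < (√(2 * Real.pi * (h * w)))⁻¹ := by
    rw [← one_div, lt_div_iff₀ hsq0]; exact i1
  rw [evenSum_gaussianPDFReal hv0, sub_self, zero_pow two_ne_zero, neg_zero, zero_div,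
    Real.exp_zero, mul_one]
  refine i2.trans (lt_mul_of_one_lt_right (by positivity) ?_)
  linarith [Real.exp_pos (-2 * (h * g) * (h * g) / (h * w))]

theorem exists_lt_evenSum_conv (hr : IsRegime Γ s S l₀ Λ h g w l) (hf : IsJumpProfile M K a b f)
    (h6 : 2 * K * thresholdBound Γ S h + 4 * M * h ^ 2 ≤ (a + b) / 2)
    (h7 : 2 * √h < √(2 * Real.pi * s) * (l₀ * ((a + b) / 2))) :
    ∃ B, h * g ≤ B ∧ B ≤ thresholdBound Γ S h ∧
      evenSum (gaussianPDFReal (h * g) (h * w).toNNReal) B <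
        evenSum (conv (gaussianPDFReal (h * g) (h * w).toNNReal) (jumpMixture (h * l) f)) B := by
  have hh := hr.h_pos
  have hm0 := hr.mean_pos
  have hv0 := hr.var_pos
  have hμ0 := hr.rate_pos
  have hd := isBoundedDensity_gaussianPDFReal (h * g)
    (show (h * w).toNNReal ≠ 0 by simpa using hv0)
  have hrh : 0 < √h := Real.sqrt_pos.2 hh
  have hab := hf.add_pos
  have hsq0 : 0 < √(2 * Real.pi * (h * w)) := by positivity
  have hL0 := hr.log_pos
  -- The factor `4` makes the Gaussian exponential equal to `h²`. The critical value is `3`, where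
  -- Gaussian and jump parts are both of order `h`.
  set B := h * g + √(4 * (h * w) * Real.log (1 / h)) with hB
  have hBle : B ≤ thresholdBound Γ S h := by
    refine add_le_add hr.mean_le (Real.sqrt_le_sqrt ?_)
    exact mul_le_mul_of_nonneg_right (mul_le_mul_of_nonneg_left hr.var_le (by norm_num)) hL0.le
  have hmB : h * g ≤ B := le_add_of_nonneg_right (Real.sqrt_nonneg _)
  have hexp : Real.exp (-(B - h * g) ^ 2 / (2 * (h * w))) = h ^ 2 := by
    have e : -(B - h * g) ^ 2 / (2 * (h * w)) = Real.log h + Real.log h := by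
      rw [hB, add_sub_cancel_left, Real.sq_sqrt (by positivity), one_div, Real.log_inv]
      rw [div_eq_iff (by positivity)]
      ring
    rw [e, Real.exp_add, Real.exp_log hh, sq]
  refine ⟨B, hmB, hBle, ?_⟩
  have j1 : h * l * ((a + b) / 2) ≤
      evenSum (conv (gaussianPDFReal (h * g) (h * w).toNNReal) (jumpMixture (h * l) f)) B := by
    have k1 := (conv_jumpMixture_sub_mem hf.toIsBoundedDensity hμ0.le hd B).1
    have k2 := (conv_jumpMixture_sub_mem hf.toIsBoundedDensity hμ0.le hd (-B)).1
    have k3 := (_root_.abs_le.1 (abs_evenSum_conv_sub_le hf hm0.le hv0 hmB)).1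
    rw [hexp] at k3
    have k4 := mul_le_mul_of_nonneg_left hBle
      (mul_nonneg (by norm_num : (0 : ℝ) ≤ 2) hf.lip_nonneg)
    have k5 : (a + b) / 2 ≤ evenSum (conv (gaussianPDFReal (h * g) (h * w).toNNReal) f) B := by
      linarith
    have k6 := mul_le_mul_of_nonneg_left k5 hμ0.le
    simp only [evenSum] at k6 ⊢
    linarith
  have j2 : evenSum (gaussianPDFReal (h * g) (h * w).toNNReal) B ≤
      (√(2 * Real.pi * (h * w)))⁻¹ * (2 * h ^ 2) := by
    rw [evenSum_gaussianPDFReal hv0, hexp, mul_assoc]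
    refine mul_le_mul_of_nonneg_left ?_ (by positivity)
    have : Real.exp (-2 * B * (h * g) / (h * w)) ≤ 1 := by
      rw [Real.exp_le_one_iff, div_nonpos_iff]
      right
      have := mul_nonneg (hm0.le.trans hmB) hm0.le
      exact ⟨by linarith, hv0.le⟩
    calc _ ≤ h ^ 2 * (1 + 1) := mul_le_mul_of_nonneg_left (by linarith) (sq_nonneg h)
      _ = _ := by ring
  refine j2.trans_lt (lt_of_lt_of_le ?_ j1)
  rw [inv_mul_lt_iff₀ hsq0]
  have j3 : √h * √(2 * Real.pi * s) ≤ √(2 * Real.pi * (h * w)) := by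
    rw [← Real.sqrt_mul hh.le]
    refine Real.sqrt_le_sqrt ?_
    have := mul_le_mul_of_nonneg_left hr.le_var (show 0 ≤ 2 * Real.pi by positivity)
    linarith
  have j4 : h * (l₀ * ((a + b) / 2)) ≤ h * l * ((a + b) / 2) := by
    rw [← mul_assoc]
    exact mul_le_mul_of_nonneg_right (mul_le_mul_of_nonneg_left hr.l₀_le hh.le) (by positivity)
  have hl₀ := hr.l₀_pos
  calc 2 * h ^ 2 = √h * h * (2 * √h) := by
        linear_combination (-2 * h) * Real.mul_self_sqrt hh.le
    _ < √h * h * (√(2 * Real.pi * s) * (l₀ * ((a + b) / 2))) :=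
        mul_lt_mul_of_pos_left h7 (mul_pos hrh hh)
    _ = √h * √(2 * Real.pi * s) * (h * (l₀ * ((a + b) / 2))) := by ring
    _ ≤ _ := mul_le_mul j3 j4 (by positivity) (by positivity)

/-- For small `h` the ratio of the two densities crosses `1` exactly once on `[0, ∞)`. -/
theorem exists_threshold {c δ : ℝ} (hr : IsRegime Γ s S l₀ Λ h g w l)
    (hf : IsJumpProfile M K a b f) (hc : 0 < c)
    (hlow : (∀ x ∈ Set.Ioc 0 δ, c ≤ f x) ∨ (∀ x ∈ Set.Ico (-δ) 0, c ≤ f x))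
    (h2 : 8 * √h * Γ ≤ √s) (h3 : √(h * S) ≤ δ)
    (h4 : 16 * M * (√h * Γ) < c * Real.exp (-2) * √s)
    (h5 : 4 * M * (h * Λ) * √(2 * Real.pi * (h * S)) < 1)
    (h6 : 2 * K * thresholdBound Γ S h + 4 * M * h ^ 2 ≤ (a + b) / 2)
    (h7 : 2 * √h < √(2 * Real.pi * s) * (l₀ * ((a + b) / 2))) :
    ∃ B ∈ Set.Ioo (h * g) (thresholdBound Γ S h),
      evenSum (conv (gaussianPDFReal (h * g) (h * w).toNNReal) (jumpMixture (h * l) f)) B =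
        evenSum (gaussianPDFReal (h * g) (h * w).toNNReal) B ∧
      (∀ x, 0 ≤ x → x < B →
        evenSum (conv (gaussianPDFReal (h * g) (h * w).toNNReal) (jumpMixture (h * l) f)) x <
        evenSum (gaussianPDFReal (h * g) (h * w).toNNReal) x) ∧
      ∀ x, B < x → evenSum (gaussianPDFReal (h * g) (h * w).toNNReal) x <
        evenSum (conv (gaussianPDFReal (h * g) (h * w).toNNReal) (jumpMixture (h * l) f)) x := by
  have hvn : (h * w).toNNReal ≠ 0 := by simpa using hr.var_pos
  have hc1 := continuous_conv_gaussianPDFReal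
    (hf.toIsBoundedDensity.integrable_jumpMixture hr.rate_pos.le) (h * g) hvn
  have hc2 := continuous_gaussianPDFReal (h * g) (h * w).toNNReal
  obtain ⟨B₀, h8, h9, h10⟩ := hr.exists_lt_evenSum_conv hf h6 h7
  obtain ⟨B, hB, h11⟩ := exists_crossing (hc1.add (hc1.comp continuous_neg))
    (hc2.add (hc2.comp continuous_neg)) hr.mean_pos.le h8
    (fun x => add_pos (gaussianPDFReal_pos _ _ _ hvn) (gaussianPDFReal_pos _ _ _ hvn))
    (fun x y hx hxy => hr.evenSum_conv_mul_lt hf hc hlow h2 h3 h4 hx hxy)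
    (hr.evenSum_conv_lt_at_mean hf.toIsBoundedDensity h5) h10
  exact ⟨B, ⟨hB.1, hB.2.trans_le h9⟩, h11⟩

end IsRegime

end Estimates

/-! ### Error bounds for the second-order approximation. -/

section Asymptotics

variable {m v G B : ℝ}

/-- The first-order condition in logarithmic form. -/
theorem log_sub_log_of_eq_evenSum (hv : 0 < v)
    (hG : G = evenSum (gaussianPDFReal m v.toNNReal) B) :
    Real.log (1 + Real.exp (-2 * B * m / v)) - Real.log (√(2 * Real.pi * v) * G) =
      (B - m) ^ 2 / (2 * v) := by
  have h0 : 0 < √(2 * Real.pi * v) := by positivity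
  have h1 : 0 < 1 + Real.exp (-2 * B * m / v) := by positivity
  rw [hG, evenSum_gaussianPDFReal hv, ← mul_assoc, ← mul_assoc, mul_inv_cancel₀ h0.ne', one_mul,
    Real.log_mul (Real.exp_ne_zero _) h1.ne', Real.log_exp]
  ring

theorem abs_sqrt_sub_sqrt_le {x y : ℝ} (hx : 0 ≤ x) (hy : 1 ≤ y) : |√x - √y| ≤ |x - y| := by
  have h1 : 1 ≤ √y := by rwa [Real.one_le_sqrt]
  have h2 := Real.sqrt_nonneg x
  have e : x - y = (√x - √y) * (√x + √y) := by
    linear_combination (-1 : ℝ) * Real.mul_self_sqrt hx +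
      Real.mul_self_sqrt (zero_le_one.trans hy)
  rw [e, abs_mul, abs_of_nonneg (show 0 ≤ √x + √y by linarith)]
  exact le_mul_of_one_le_right (abs_nonneg _) (by linarith)

theorem abs_log_le_two_mul {x : ℝ} (hx : |x - 1| ≤ 1 / 2) : |Real.log x| ≤ 2 * |x - 1| := by
  have h0 := (_root_.abs_le.1 hx).1
  have hx0 : 0 < x := by linarith
  have h1 := Real.log_le_sub_one_of_pos hx0
  have h2 := Real.one_sub_inv_le_log_of_pos hx0
  have h3 : -(2 * |x - 1|) ≤ 1 - x⁻¹ := by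
    have : 1 - x⁻¹ = (x - 1) / x := by field_simp
    rw [this, le_div_iff₀ hx0]
    rcases abs_cases (x - 1) with h | h <;> rw [h.1] <;> nlinarith
  exact _root_.abs_le.2 ⟨by linarith, by linarith [le_abs_self (x - 1), abs_nonneg (x - 1)]⟩

theorem abs_log_one_add_exp_neg_sub_le {z : ℝ} (hz : 0 ≤ z) :
    |Real.log (1 + Real.exp (-z)) - Real.log 2| ≤ z := by
  have h1 : Real.exp (-z) ≤ 1 := Real.exp_le_one_iff.2 (by linarith)
  have h2 := Real.log_le_log (by positivity) (show 1 + Real.exp (-z) ≤ 2 by linarith)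
  have h3 := Real.log_le_log (by positivity)
    (show 2 * Real.exp (-z) ≤ 1 + Real.exp (-z) by linarith)
  rw [Real.log_mul two_ne_zero (Real.exp_ne_zero _), Real.log_exp] at h3
  exact _root_.abs_le.2 ⟨by linarith, by linarith⟩

/-- An upper bound for `P(|G| ≥ B)` at the optimal threshold. -/
def tailBound (M S Λ h : ℝ) : ℝ := 4 * M * (h * Λ) * √(2 * Real.pi * (h * S))

/-- An upper bound for the error in the approximation of the symmetrized jump density by its value
at the origin. -/
def densityError (M K Γ S Λ h : ℝ) : ℝ :=
  2 * K * thresholdBound Γ S h + 4 * M * tailBound M S Λ h + 2 * M * (h * Λ)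

/-- An upper bound for the error of the second-order approximation, with `c` the sum of the
one-sided limits of the density. -/
def thresholdError (M K c Γ s S Λ h : ℝ) : ℝ :=
  h * Γ + √(h * S) * (4 * thresholdBound Γ S h * Γ / s + 4 * densityError M K Γ S Λ h / c)

variable {M K a b : ℝ} {f : ℝ → ℝ} {h g w l Γ s S l₀ Λ : ℝ}

/-- The radicand of the second-order approximation. -/
def radicand (c s l h : ℝ) : ℝ := 3 * Real.log (1 / h) - 2 * Real.log (√(2 * Real.pi) * c * s * l)

theorem one_le_radicand {c w l : ℝ} (hc : 0 < c) (hw : 0 < w) (hl : 0 < l) (hwS : w ≤ S)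
    (hlΛ : l ≤ Λ) (hA : 1 + 2 * Real.log (√(2 * Real.pi) * c * √S * Λ) ≤ 3 * Real.log (1 / h)) :
    1 ≤ radicand c √w l h := by
  have : Real.log (√(2 * Real.pi) * c * √w * l) ≤ Real.log (√(2 * Real.pi) * c * √S * Λ) := by
    refine Real.log_le_log (by positivity) ?_
    have := Real.sqrt_le_sqrt hwS
    have := hl.trans_le hlΛ
    gcongr
  unfold radicand
  linarith

/-- The crossing equation is used twice: first to bound the Gaussian tail at `B`, which gives the
jump density its leading value, and then in logarithmic form to identify `(B - m)²/v` with the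
radicand. As the radicand is at least `1`, taking square roots does not enlarge the error. -/
theorem IsRegime.abs_sub_secondOrderApprox_le (hr : IsRegime Γ s S l₀ Λ h g w l)
    (hf : IsJumpProfile M K a b f) (hB : B ∈ Set.Ioo (h * g) (thresholdBound Γ S h))
    (hst : evenSum (conv (gaussianPDFReal (h * g) (h * w).toNNReal) (jumpMixture (h * l) f)) B =
        evenSum (gaussianPDFReal (h * g) (h * w).toNNReal) B)
    (hε : densityError M K Γ S Λ h ≤ (a + b) / 2)
    (hA : 1 + 2 * Real.log (√(2 * Real.pi) * ((a + b) / 2) * √S * Λ) ≤ 3 * Real.log (1 / h)) :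
    |B - secondOrderApprox ((a + b) / 2) √w l h| ≤ thresholdError M K (a + b) Γ s S Λ h := by
  have hh := hr.h_pos
  have hw := hr.w_pos
  have hl := hr.l_pos
  have hg := hr.g_pos
  have hm0 := hr.mean_pos
  have hv0 := hr.var_pos
  have hμ0 := hr.rate_pos
  have hM := hf.toIsBoundedDensity.bound_nonneg
  have hK := hf.lip_nonneg
  have hab := hf.add_pos
  have hB0 : 0 < B := hm0.trans hB.1
  set G := evenSum (conv (gaussianPDFReal (h * g) (h * w).toNNReal) (jumpMixture (h * l) f)) B
    with hG
  have hsq0 : 0 < √(2 * Real.pi * (h * w)) := by positivity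
  have hG4 : G ≤ 4 * M * (h * l) :=
    evenSum_conv_jumpMixture_le hf.toIsBoundedDensity hμ0.le hr.rate_le_one hv0 B
  set η := Real.exp (-(B - h * g) ^ 2 / (2 * (h * w))) with hη
  -- No lower bound on `B` is needed: the crossing equation bounds `η` by `√(2πv) G`, and `G =
  -- O(h)`.
  have hηq : η ≤ tailBound M S Λ h := by
    have h1 : η ≤ √(2 * Real.pi * (h * w)) * G := by
      rw [hst, evenSum_gaussianPDFReal hv0, ← mul_assoc, ← mul_assoc, mul_inv_cancel₀ hsq0.ne',
        one_mul]
      refine le_mul_of_one_le_right (Real.exp_nonneg _) ?_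
      linarith [Real.exp_pos (-2 * B * (h * g) / (h * w))]
    refine h1.trans ?_
    rw [tailBound, mul_comm]
    have h2 : 4 * M * (h * l) ≤ 4 * M * (h * Λ) :=
      mul_le_mul_of_nonneg_left hr.rate_le (by positivity)
    have h3 : 0 ≤ 4 * M * (h * Λ) := (mul_nonneg (by positivity) hμ0.le).trans h2
    exact mul_le_mul (hG4.trans h2) hr.sqrt_two_pi_var_le hsq0.le h3
  have hGμ : |G - h * l * (a + b)| ≤ h * l * densityError M K Γ S Λ h := by
    refine (abs_evenSum_conv_jumpMixture_sub_le hf hm0.le hv0 hμ0.le hr.rate_le_one hB.1.le).trans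
      (mul_le_mul_of_nonneg_left ?_ hμ0.le)
    unfold densityError
    have h1 := mul_le_mul_of_nonneg_left hB.2.le (show 0 ≤ 2 * K by positivity)
    have h2 := mul_le_mul_of_nonneg_left hηq (show 0 ≤ 4 * M by positivity)
    have h3 := mul_le_mul_of_nonneg_left hr.rate_le (show 0 ≤ 2 * M by positivity)
    linarith
  set ρ := G / (h * l * (a + b)) with hρ
  have hden : 0 < h * l * (a + b) := mul_pos hμ0 hab
  have hρ1 : |ρ - 1| ≤ densityError M K Γ S Λ h / (a + b) := by
    have e : ρ - 1 = (G - h * l * (a + b)) / (h * l * (a + b)) := by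
      rw [hρ, sub_div, div_self hden.ne']
    rw [e, abs_div, abs_of_pos hden, div_le_div_iff₀ hden hab]
    calc _ ≤ h * l * densityError M K Γ S Λ h * (a + b) := mul_le_mul_of_nonneg_right hGμ hab.le
      _ = _ := by ring
  have hρ2 : |ρ - 1| ≤ 1 / 2 := hρ1.trans (by rw [div_le_iff₀ hab]; linarith)
  have hρ0 : 0 < ρ := by linarith [(_root_.abs_le.1 hρ2).1]
  have hlogρ := abs_log_le_two_mul hρ2
  have hstat := log_sub_log_of_eq_evenSum hv0 hst
  set z := 2 * B * (h * g) / (h * w) with hz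
  have hz0 : 0 ≤ z := by positivity
  have hzle : z ≤ 2 * thresholdBound Γ S h * Γ / s := by
    have e : z = 2 * B * g / w := by rw [hz]; field_simp
    rw [e]
    have hs := hr.s_pos
    have h1 := hB.2.le
    have h2 := hr.g_le
    have h3 := hr.s_le
    have h4 := hB0.trans hB.2
    have hΓ : 0 < Γ := hg.trans_le hr.g_le
    gcongr
  have hzlog := abs_log_one_add_exp_neg_sub_le hz0
  rw [show -2 * B * (h * g) / (h * w) = -z by rw [hz]; ring] at hstat
  set c := (a + b) / 2 with hc
  have hc0 : 0 < c := by positivity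
  -- The coefficient `3/2` comes from `√h` in the Gaussian normalization times `h` in the jump rate.
  -- The `log 2` comes from `a + b = 2c` and cancels against the limit of `log (1 + e^{-z})`.
  have hlogG : Real.log (√(2 * Real.pi * (h * w)) * G) =
      Real.log (√(2 * Real.pi) * c * √w * l) + Real.log 2 - 3 / 2 * Real.log (1 / h) +
        Real.log ρ := by
    have e : √(2 * Real.pi * (h * w)) * G = √(2 * Real.pi) * c * √w * l * 2 * (√h * h) * ρ := by
      have hG' : G = h * l * (a + b) * ρ := by rw [hρ]; field_simp
      rw [hG', Real.sqrt_mul (by positivity), Real.sqrt_mul hh.le, hc]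
      ring
    have hX : 0 < √(2 * Real.pi) * c * √w * l := by positivity
    rw [e, Real.log_mul (by positivity) hρ0.ne', Real.log_mul (by positivity) (by positivity),
      Real.log_mul hX.ne' two_ne_zero, Real.log_mul (by positivity) hh.ne', Real.log_sqrt hh.le,
      one_div, Real.log_inv]
    ring
  set Q := (B - h * g) ^ 2 / (h * w) with hQ
  have hQ0 : 0 ≤ Q := by positivity
  have hQA : |Q - radicand c √w l h| ≤
      4 * thresholdBound Γ S h * Γ / s + 4 * densityError M K Γ S Λ h / (a + b) := by
    have e : Q - radicand c √w l h =
        2 * (Real.log (1 + Real.exp (-z)) - Real.log 2) - 2 * Real.log ρ := by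
      have e1 : Q = 2 * ((B - h * g) ^ 2 / (2 * (h * w))) := by rw [hQ]; field_simp
      rw [e1, ← hstat, hlogG, radicand]
      ring
    rw [e]
    refine (abs_sub _ _).trans ?_
    rw [abs_mul, abs_mul, abs_of_pos (zero_lt_two' ℝ)]
    have e2 : 4 * thresholdBound Γ S h * Γ / s = 2 * (2 * thresholdBound Γ S h * Γ / s) := by ring
    have e3 : 4 * densityError M K Γ S Λ h / (a + b) =
        4 * (densityError M K Γ S Λ h / (a + b)) := by ring
    rw [e2, e3]
    linarith
  have hA1 := one_le_radicand hc0 hw hl hr.le_S hr.le_Λ hA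
  have hsqrt := (abs_sqrt_sub_sqrt_le hQ0 hA1).trans hQA
  have hBeq : B = h * g + √(h * w) * √Q := by
    have : √(h * w) * √Q = B - h * g := by
      rw [← Real.sqrt_mul hv0.le, hQ, mul_div_cancel₀ _ hv0.ne',
        Real.sqrt_sq (by linarith [hB.1])]
    rw [this]; ring
  have happ : secondOrderApprox c √w l h = √(h * w) * √(radicand c √w l h) := by
    rw [secondOrderApprox, radicand, Real.sqrt_mul hh.le]
  have e : B - secondOrderApprox c √w l h =
      h * g + √(h * w) * (√Q - √(radicand c √w l h)) := by
    rw [happ]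
    linear_combination hBeq
  rw [e]
  refine (abs_add_le _ _).trans (add_le_add ?_ ?_)
  · rw [abs_of_pos hm0]
    exact hr.mean_le
  · rw [abs_mul, abs_of_nonneg (Real.sqrt_nonneg _)]
    exact mul_le_mul (Real.sqrt_le_sqrt hr.var_le) hsqrt (abs_nonneg _) (Real.sqrt_nonneg _)

theorem abs_log_sub_log_le {x y c : ℝ} (hc : 0 < c) (hx : c ≤ x) (hy : c ≤ y) :
    |Real.log x - Real.log y| ≤ |x - y| / c := by
  wlog hxy : y ≤ x generalizing x y
  · rw [abs_sub_comm, abs_sub_comm x y]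
    exact this hy hx (le_of_not_ge hxy)
  have hy0 := hc.trans_le hy
  have hx0 := hc.trans_le hx
  rw [abs_of_nonneg (sub_nonneg.2 (Real.log_le_log hy0 hxy)), abs_of_nonneg (sub_nonneg.2 hxy),
    ← Real.log_div hx0.ne' hy0.ne']
  refine (Real.log_le_sub_one_of_pos (by positivity)).trans ?_
  rw [show x / y - 1 = (x - y) / y by field_simp]
  exact div_le_div_of_nonneg_left (sub_nonneg.2 hxy) hc hy

/-- An upper bound for the change of the second-order approximation under a perturbation of size
`D h` of the coefficients. -/
def spotError (c s S l₀ D h : ℝ) : ℝ :=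
  √h * (D * h / √s * (3 * Real.log (1 / h) - 2 * Real.log (√(2 * Real.pi) * c * √s * l₀)) +
    √S * (D * h / s + 2 * (D * h / l₀)))

/-- Stability of the second-order approximation in the coefficients. -/
theorem abs_secondOrderApprox_sub_le {c D w₁ w₂ l₁ l₂ : ℝ} (hc : 0 < c) (hs : 0 < s)
    (hl₀ : 0 < l₀) (hw₁ : w₁ ∈ Set.Icc s S) (hw₂ : w₂ ∈ Set.Icc s S) (hl₁ : l₁ ∈ Set.Icc l₀ Λ)
    (hl₂ : l₂ ∈ Set.Icc l₀ Λ) (hw : |w₁ - w₂| ≤ D * h) (hl : |l₁ - l₂| ≤ D * h)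
    (hA : 1 + 2 * Real.log (√(2 * Real.pi) * c * √S * Λ) ≤ 3 * Real.log (1 / h)) :
    |secondOrderApprox c √w₁ l₁ h - secondOrderApprox c √w₂ l₂ h| ≤ spotError c s S l₀ D h := by
  have hw₁0 := hs.trans_le hw₁.1
  have hw₂0 := hs.trans_le hw₂.1
  have hl₁0 := hl₀.trans_le hl₁.1
  have hl₂0 := hl₀.trans_le hl₂.1
  have hrs : 0 < √s := Real.sqrt_pos.2 hs
  have hA₁ := one_le_radicand hc hw₁0 hl₁0 hw₁.2 hl₁.2 hA
  have hA₂ := one_le_radicand hc hw₂0 hl₂0 hw₂.2 hl₂.2 hA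
  have hDh : 0 ≤ D * h := (abs_nonneg _).trans hw
  have hsqrt : |√w₁ - √w₂| ≤ D * h / √s := by
    rw [le_div_iff₀ hrs]
    refine le_trans ?_ hw
    have e : w₁ - w₂ = (√w₁ - √w₂) * (√w₁ + √w₂) := by
      linear_combination (-1 : ℝ) * Real.mul_self_sqrt hw₁0.le + Real.mul_self_sqrt hw₂0.le
    have h1 := Real.sqrt_le_sqrt hw₁.1
    have h2 := Real.sqrt_nonneg w₂
    rw [e, abs_mul, abs_of_nonneg (show 0 ≤ √w₁ + √w₂ by linarith)]
    exact mul_le_mul_of_nonneg_left (by linarith) (abs_nonneg _)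
  -- Bounding `√r` by `r ≥ 1` is wasteful but harmless: it is multiplied by `D h`, and `h log (1/h)`
  -- is small enough.
  have hupper : √(radicand c √w₁ l₁ h) ≤
      3 * Real.log (1 / h) - 2 * Real.log (√(2 * Real.pi) * c * √s * l₀) := by
    have h1 : √(radicand c √w₁ l₁ h) ≤ radicand c √w₁ l₁ h := by
      rw [Real.sqrt_le_left (by linarith)]
      nlinarith
    refine h1.trans ?_
    unfold radicand
    have : Real.log (√(2 * Real.pi) * c * √s * l₀) ≤ Real.log (√(2 * Real.pi) * c * √w₁ * l₁) := by
      refine Real.log_le_log (by positivity) ?_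
      have := Real.sqrt_le_sqrt hw₁.1
      have := hl₁.1
      gcongr
    linarith
  have hdiff : |√(radicand c √w₁ l₁ h) - √(radicand c √w₂ l₂ h)| ≤
      D * h / s + 2 * (D * h / l₀) := by
    refine (abs_sqrt_sub_sqrt_le (by linarith) hA₂).trans ?_
    have e : radicand c √w₁ l₁ h - radicand c √w₂ l₂ h =
        -(Real.log w₁ - Real.log w₂) - 2 * (Real.log l₁ - Real.log l₂) := by
      have hX : √(2 * Real.pi) * c ≠ 0 := by positivity
      have hq₁ : √w₁ ≠ 0 := by positivity
      have hq₂ : √w₂ ≠ 0 := by positivity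
      unfold radicand
      rw [Real.log_mul (mul_ne_zero hX hq₁) hl₁0.ne', Real.log_mul (mul_ne_zero hX hq₂) hl₂0.ne',
        Real.log_mul hX hq₁, Real.log_mul hX hq₂, Real.log_sqrt hw₁0.le, Real.log_sqrt hw₂0.le]
      ring
    rw [e]
    refine (abs_sub _ _).trans (add_le_add ?_ ?_)
    · rw [abs_neg]
      exact (abs_log_sub_log_le hs hw₁.1 hw₂.1).trans (div_le_div_of_nonneg_right hw hs.le)
    · rw [abs_mul, abs_of_pos (zero_lt_two' ℝ)]
      exact mul_le_mul_of_nonneg_left ((abs_log_sub_log_le hl₀ hl₁.1 hl₂.1).trans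
        (div_le_div_of_nonneg_right hl hl₀.le)) zero_le_two
  have e : secondOrderApprox c √w₁ l₁ h - secondOrderApprox c √w₂ l₂ h =
      √h * ((√w₁ - √w₂) * √(radicand c √w₁ l₁ h) +
        √w₂ * (√(radicand c √w₁ l₁ h) - √(radicand c √w₂ l₂ h))) := by
    simp only [secondOrderApprox, radicand]
    ring
  rw [e, abs_mul, abs_of_nonneg (Real.sqrt_nonneg h)]
  refine mul_le_mul_of_nonneg_left ((abs_add_le _ _).trans (add_le_add ?_ ?_))
    (Real.sqrt_nonneg h)
  · rw [abs_mul, abs_of_nonneg (Real.sqrt_nonneg _)]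
    exact mul_le_mul hsqrt hupper (Real.sqrt_nonneg _) (div_nonneg hDh hrs.le)
  · rw [abs_mul, abs_of_nonneg (Real.sqrt_nonneg _)]
    exact mul_le_mul (Real.sqrt_le_sqrt hw₂.2) hdiff (abs_nonneg _) (Real.sqrt_nonneg _)

end Asymptotics

/-! ### Orders of magnitude of the error functions as the step tends to zero. -/

section Limits

open Asymptotics

variable {M K a b c δ Γ s S l₀ Λ D α β : ℝ}

theorem isLittleO_rpow_nhdsGT (hαβ : α < β) :
    (fun h : ℝ => h ^ β) =o[𝓝[>] 0] fun h => h ^ α := by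
  have h0 : Tendsto (fun h : ℝ => h ^ (β - α)) (𝓝[>] 0) (𝓝 0) := by
    have h1 : ContinuousAt (fun h : ℝ => h ^ (β - α)) 0 :=
      Real.continuousAt_rpow_const _ _ (Or.inr (by linarith))
    have h2 := h1.tendsto.mono_left (nhdsWithin_le_nhds (s := Set.Ioi (0 : ℝ)))
    rwa [Real.zero_rpow (by linarith)] at h2
  refine (isLittleO_iff_tendsto' ?_).2 (h0.congr' ?_)
  · filter_upwards [self_mem_nhdsWithin] with h hh h1
    exact absurd h1 (Real.rpow_pos_of_pos hh α).ne'
  · filter_upwards [self_mem_nhdsWithin] with h hh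
    rw [Real.rpow_sub hh]

theorem isLittleO_id_rpow (hα : α < 1) : (fun h : ℝ => h) =o[𝓝[>] 0] fun h => h ^ α := by
  simpa using isLittleO_rpow_nhdsGT hα

/-- Dividing the root by `h^α` leaves the root of a multiple of `h^{1-2α} log (1/h)`; this is where
`α < 1/2` enters. -/
theorem isLittleO_thresholdBound (Γ S : ℝ) (hα : α < 1 / 2) :
    thresholdBound Γ S =o[𝓝[>] 0] fun h => h ^ α := by
  have h1 : (fun h : ℝ => √(4 * (h * S) * Real.log (1 / h))) =o[𝓝[>] 0] fun h => h ^ α := by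
    have h2 := (tendsto_log_mul_rpow_nhdsGT_zero (r := 1 - 2 * α) (by linarith)).const_mul (-(4 * S))
    rw [mul_zero] at h2
    have h3 := (Real.continuous_sqrt.tendsto 0).comp h2
    rw [Real.sqrt_zero] at h3
    refine (isLittleO_iff_tendsto' ?_).2 (h3.congr' ?_)
    · filter_upwards [self_mem_nhdsWithin] with h hh h4
      exact absurd h4 (Real.rpow_pos_of_pos hh α).ne'
    · filter_upwards [self_mem_nhdsWithin] with h hh
      have hh : 0 < h := hh
      have e : h ^ α = √(h ^ (2 * α)) := by
        rw [Real.sqrt_eq_rpow, ← Real.rpow_mul hh.le]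
        ring_nf
      have hp : 0 < h ^ (2 * α) := Real.rpow_pos_of_pos hh _
      rw [e, ← Real.sqrt_div' _ hp.le, Function.comp_apply, Real.rpow_sub hh, Real.rpow_one,
        one_div, Real.log_inv]
      congr 1
      field_simp
  have h2 : (fun h : ℝ => h * Γ) =o[𝓝[>] 0] fun h => h ^ α := by
    simpa only [mul_comm _ Γ] using (isLittleO_id_rpow (show α < 1 by linarith)).const_mul_left Γ
  exact h2.add h1

theorem tendsto_thresholdBound (Γ S : ℝ) :
    Tendsto (thresholdBound Γ S) (𝓝[>] 0) (𝓝 0) := by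
  have h := isLittleO_thresholdBound (α := 0) Γ S (by norm_num)
  simpa using h

theorem tendsto_nhdsGT_of_continuous {g : ℝ → ℝ} (hg : Continuous g) {x : ℝ} (hx : g 0 = x) :
    Tendsto g (𝓝[>] 0) (𝓝 x) := by
  rw [← hx]
  exact hg.continuousAt.tendsto.mono_left nhdsWithin_le_nhds

theorem isLittleO_tailBound (M S Λ : ℝ) (hα : α < 1 / 2) :
    tailBound M S Λ =o[𝓝[>] 0] fun h => h ^ α := by
  have h1 : Tendsto (fun h : ℝ => 4 * M * Λ * √(2 * Real.pi * (h * S))) (𝓝[>] 0) (𝓝 0) :=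
    tendsto_nhdsGT_of_continuous (by fun_prop) (by simp)
  have h2 := (isLittleO_id_rpow (show α < 1 by linarith)).mul_isBigO (h1.isBigO_one ℝ)
  simp only [mul_one] at h2
  refine h2.congr_left fun h => ?_
  unfold tailBound
  ring

theorem isLittleO_densityError (M K Γ S Λ : ℝ) (hα : α < 1 / 2) :
    densityError M K Γ S Λ =o[𝓝[>] 0] fun h => h ^ α := by
  have h1 := (isLittleO_thresholdBound Γ S hα).const_mul_left (2 * K)
  have h2 := (isLittleO_tailBound M S Λ hα).const_mul_left (4 * M)
  have h3 := (isLittleO_id_rpow (show α < 1 by linarith)).const_mul_left (2 * M * Λ)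
  refine ((h1.add h2).add h3).congr_left fun h => ?_
  unfold densityError
  ring

theorem tendsto_densityError (M K Γ S Λ : ℝ) :
    Tendsto (densityError M K Γ S Λ) (𝓝[>] 0) (𝓝 0) := by
  simpa using isLittleO_densityError (α := 0) M K Γ S Λ (by norm_num)

theorem sqrt_mul_rpow_eventuallyEq (α : ℝ) :
    (fun h : ℝ => √h * h ^ α) =ᶠ[𝓝[>] 0] fun h => h ^ (1 / 2 + α) := by
  filter_upwards [self_mem_nhdsWithin] with h hh
  rw [Real.rpow_add hh, Real.sqrt_eq_rpow]

/-- The prefactor `√h` supplies the power `1/2` and the bracket is `o(h^α)`; the drift term `hΓ` is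
negligible because `1/2 + α < 1`. -/
theorem isLittleO_thresholdError (M K c Γ s S Λ : ℝ) (hα : α < 1 / 2) :
    thresholdError M K c Γ s S Λ =o[𝓝[>] 0] fun h => h ^ (1 / 2 + α) := by
  have h1 := (isLittleO_thresholdBound Γ S hα).const_mul_left (√S * (4 * Γ / s))
  have h2 := (isLittleO_densityError M K Γ S Λ hα).const_mul_left (√S * (4 / c))
  have h3 := (isBigO_refl (fun h : ℝ => √h) (𝓝[>] 0)).mul_isLittleO (h1.add h2)
  have h4 := h3.congr' EventuallyEq.rfl (sqrt_mul_rpow_eventuallyEq α)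
  have h5 := (isLittleO_id_rpow (show 1 / 2 + α < 1 by linarith)).const_mul_left Γ
  refine (h5.add h4).congr' ?_ EventuallyEq.rfl
  filter_upwards [self_mem_nhdsWithin] with h hh
  have hh : 0 < h := hh
  rw [thresholdError, Real.sqrt_mul hh.le]
  ring

theorem isLittleO_spotError (c s S l₀ D : ℝ) (hα : α < 1 / 2) :
    spotError c s S l₀ D =o[𝓝[>] 0] fun h => h ^ (1 / 2 + α) := by
  have h1 : (fun h : ℝ => h * Real.log h) =o[𝓝[>] 0] fun h => h ^ α := by
    have h2 := (isLittleO_log_rpow_nhdsGT_zero (r := α - 1) (by linarith))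
    have h3 := (isBigO_refl (fun h : ℝ => h) (𝓝[>] 0)).mul_isLittleO h2
    refine h3.congr' EventuallyEq.rfl ?_
    filter_upwards [self_mem_nhdsWithin] with h hh
    have hh : 0 < h := hh
    rw [Real.rpow_sub hh, Real.rpow_one]
    field_simp
  have h2 := isLittleO_id_rpow (show α < 1 by linarith)
  have h3 := (h1.const_mul_left (-(3 * D / √s))).add (h2.const_mul_left
    (√S * (D / s + 2 * (D / l₀)) -
      D / √s * (2 * Real.log (√(2 * Real.pi) * c * √s * l₀))))
  have h4 := ((isBigO_refl (fun h : ℝ => √h) (𝓝[>] 0)).mul_isLittleO h3).congr' EventuallyEq.rfl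
    (sqrt_mul_rpow_eventuallyEq α)
  refine h4.congr_left fun h => ?_
  rw [spotError, one_div, Real.log_inv]
  ring

/-- The smallness conditions on the time step. -/
structure IsSmallStep (M K a b c δ Γ s S l₀ Λ h : ℝ) : Prop where
  pos : 0 < h
  lt_one : h < 1
  mul_le_one : h * Λ ≤ 1
  drift_le : 8 * √h * Γ ≤ √s
  vol_le : √(h * S) ≤ δ
  drift_lt : 16 * M * (√h * Γ) < c * Real.exp (-2) * √s
  tail_lt : tailBound M S Λ h < 1
  bound_le : 2 * K * thresholdBound Γ S h + 4 * M * h ^ 2 ≤ (a + b) / 2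
  sqrt_lt : 2 * √h < √(2 * Real.pi * s) * (l₀ * ((a + b) / 2))
  error_le : densityError M K Γ S Λ h ≤ (a + b) / 2
  log_le : 1 + 2 * Real.log (√(2 * Real.pi) * ((a + b) / 2) * √S * Λ) ≤ 3 * Real.log (1 / h)

theorem eventually_isSmallStep (M K Γ Λ : ℝ) (hab : 0 < a + b) (hc : 0 < c) (hδ : 0 < δ)
    (hs : 0 < s) (hl₀ : 0 < l₀) :
    ∀ᶠ h in 𝓝[>] (0 : ℝ), IsSmallStep M K a b c δ Γ s S l₀ Λ h := by
  have t1 : Tendsto (fun h : ℝ => h) (𝓝[>] 0) (𝓝 0) :=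
    tendsto_nhdsGT_of_continuous (by fun_prop) (by simp)
  have t2 : Tendsto (fun h : ℝ => h * Λ) (𝓝[>] 0) (𝓝 0) :=
    tendsto_nhdsGT_of_continuous (by fun_prop) (by simp)
  have t3 : Tendsto (fun h : ℝ => 8 * √h * Γ) (𝓝[>] 0) (𝓝 0) :=
    tendsto_nhdsGT_of_continuous (by fun_prop) (by simp)
  have t4 : Tendsto (fun h : ℝ => √(h * S)) (𝓝[>] 0) (𝓝 0) :=
    tendsto_nhdsGT_of_continuous (by fun_prop) (by simp)
  have t5 : Tendsto (fun h : ℝ => 16 * M * (√h * Γ)) (𝓝[>] 0) (𝓝 0) :=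
    tendsto_nhdsGT_of_continuous (by fun_prop) (by simp)
  have t6 : Tendsto (fun h : ℝ => tailBound M S Λ h) (𝓝[>] 0) (𝓝 0) :=
    tendsto_nhdsGT_of_continuous (by unfold tailBound; fun_prop) (by simp [tailBound])
  have t7 : Tendsto (fun h : ℝ => 2 * K * thresholdBound Γ S h + 4 * M * h ^ 2) (𝓝[>] 0) (𝓝 0) := by
    have := ((tendsto_thresholdBound Γ S).const_mul (2 * K)).add ((t1.pow 2).const_mul (4 * M))
    simpa using this
  have t8 : Tendsto (fun h : ℝ => 2 * √h) (𝓝[>] 0) (𝓝 0) :=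
    tendsto_nhdsGT_of_continuous (by fun_prop) (by simp)
  have t9 : Tendsto (fun h : ℝ => 3 * Real.log (1 / h)) (𝓝[>] 0) atTop := by
    refine Tendsto.const_mul_atTop (by norm_num) ?_
    simp only [one_div]
    exact Real.tendsto_log_atTop.comp tendsto_inv_nhdsGT_zero
  filter_upwards [self_mem_nhdsWithin, t1.eventually_lt_const one_pos,
    t2.eventually_le_const one_pos, t3.eventually_le_const (Real.sqrt_pos.2 hs),
    t4.eventually_le_const hδ, t5.eventually_lt_const (show 0 < c * Real.exp (-2) * √s by positivity),
    t6.eventually_lt_const one_pos, t7.eventually_le_const (half_pos hab),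
    t8.eventually_lt_const (show 0 < √(2 * Real.pi * s) * (l₀ * ((a + b) / 2)) by positivity),
    (tendsto_densityError M K Γ S Λ).eventually_le_const (half_pos hab),
    t9.eventually_ge_atTop (1 + 2 * Real.log (√(2 * Real.pi) * ((a + b) / 2) * √S * Λ))]
    with h c0 c1 c2 c3 c4 c5 c6 c7 c8 c9 c10
  exact ⟨c0, c1, c2, c3, c4, c5, c6, c7, c8, c9, c10⟩

end Limits

/-! ### Consequences of the standing hypotheses. -/

section Data

/-! ### Averaged coefficients -/

theorem exists_bounds {g : ℝ → ℝ} {τ : ℝ} (hinf : 0 < sInf (g '' Set.Icc 0 τ))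
    (hsup : BddAbove (g '' Set.Icc 0 τ)) :
    ∃ a A : ℝ, 0 < a ∧ ∀ u ∈ Set.Icc 0 τ, g u ∈ Set.Icc a A := by
  have hb : BddBelow (g '' Set.Icc 0 τ) := by
    -- By convention `sInf` is `0` on a set that is not bounded below, so a positive infimum already
    -- yields a lower bound.
    by_contra h
    rw [Real.sInf_of_not_bddBelow h] at hinf
    exact lt_irrefl _ hinf
  obtain ⟨A, hA⟩ := hsup
  exact ⟨_, A, hinf, fun u hu =>
    ⟨csInf_le hb (Set.mem_image_of_mem g hu), hA (Set.mem_image_of_mem g hu)⟩⟩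

theorem intervalIntegrable_of_bounds {g : ℝ → ℝ} {τ a A x y : ℝ}
    (hg : AEStronglyMeasurable g (volume.restrict (Set.Ici 0)))
    (hb : ∀ u ∈ Set.Icc 0 τ, g u ∈ Set.Icc a A) (hx : 0 ≤ x) (hxy : x ≤ y) (hy : y ≤ τ) :
    IntervalIntegrable g volume x y := by
  rw [intervalIntegrable_iff_integrableOn_Ioc_of_le hxy]
  have hm : AEStronglyMeasurable g (volume.restrict (Set.Ioc x y)) :=
    hg.mono_set fun u hu => hx.trans hu.1.le
  refine Integrable.mono' (integrable_const (max |a| |A|)) hm ?_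
  refine (ae_restrict_iff' measurableSet_Ioc).2 (ae_of_all _ fun u hu => ?_)
  obtain ⟨h1, h2⟩ := hb u ⟨hx.trans hu.1.le, hu.2.trans hy⟩
  rw [Real.norm_eq_abs]
  exact abs_le_max_abs_abs h1 h2

theorem mul_avg {g : ℝ → ℝ} {t h : ℝ} (hh : 0 < h) : h * avg g t h = ∫ u in t..(t + h), g u := by
  unfold avg
  field_simp

theorem avg_mem_Icc {g : ℝ → ℝ} {t h a A : ℝ} (hh : 0 < h)
    (hi : IntervalIntegrable g volume t (t + h))
    (hb : ∀ u ∈ Set.Icc t (t + h), g u ∈ Set.Icc a A) : avg g t h ∈ Set.Icc a A := by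
  have hle : t ≤ t + h := by linarith
  have h1 := intervalIntegral.integral_mono_on (f := fun _ => a) hle (by simp) hi
    fun u hu => (hb u hu).1
  have h2 := intervalIntegral.integral_mono_on (g := fun _ => A) hle hi (by simp)
    fun u hu => (hb u hu).2
  rw [intervalIntegral.integral_const, add_sub_cancel_left, smul_eq_mul, ← mul_avg hh] at h1 h2
  exact ⟨le_of_mul_le_mul_left h1 hh, le_of_mul_le_mul_left h2 hh⟩

theorem abs_avg_sub_le {g : ℝ → ℝ} {t h D : ℝ} (hh : 0 < h)
    (hi : IntervalIntegrable g volume t (t + h))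
    (hL : ∀ u ∈ Set.Icc t (t + h), |g u - g t| ≤ D * h) : |avg g t h - g t| ≤ D * h := by
  have := avg_mem_Icc hh hi (a := g t - D * h) (A := g t + D * h) fun u hu => by
    have := _root_.abs_le.1 (hL u hu)
    exact ⟨by linarith, by linarith⟩
  exact _root_.abs_le.2 ⟨by linarith [this.1], by linarith [this.2]⟩

theorem exists_lipschitz_bound {g : ℝ → ℝ} {x y τ : ℝ} (hx : 0 < x) (hy : y < τ)
    (hg : ContDiffOn ℝ 1 g (Set.Ioo 0 τ)) :
    ∃ D, 0 ≤ D ∧ ∀ u ∈ Set.Icc x y, ∀ v ∈ Set.Icc x y, |g u - g v| ≤ D * |u - v| := by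
  have hl : LocallyLipschitzOn (Set.Icc x y) g :=
    (hg.mono fun u hu => ⟨hx.trans_le hu.1, hu.2.trans_lt hy⟩).locallyLipschitzOn (convex_Icc x y)
  obtain ⟨D, hD⟩ := hl.exists_lipschitzOnWith_of_compact isCompact_Icc
  refine ⟨D, D.2, fun u hu v hv => ?_⟩
  simpa [Real.dist_eq] using hD.dist_le_mul u hu v hv

/-! ### The jump density -/

/-- A bounded function with bounded difference quotient at the origin is globally Lipschitz at the
origin. -/
theorem exists_lipschitz_at_zero {g : ℝ → ℝ} {s : Set ℝ} {M : ℝ}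
    (hM : ∀ x ∈ s, |g x - g 0| ≤ M) (hM0 : 0 ≤ M)
    (hg : (fun x => g x - g 0) =O[𝓝[s] 0] fun x => x) :
    ∃ K, 0 ≤ K ∧ ∀ x ∈ s, |g x - g 0| ≤ K * |x| := by
  obtain ⟨C, hC⟩ := hg.bound
  obtain ⟨ε, hε, hball⟩ := Metric.mem_nhdsWithin_iff.1 hC
  refine ⟨max C (M / ε), le_max_of_le_right (by positivity), fun x hx => ?_⟩
  rcases lt_or_ge |x| ε with h | h
  · have h1 : ‖g x - g 0‖ ≤ C * ‖x‖ := hball ⟨by simpa [Real.dist_eq] using h, hx⟩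
    exact h1.trans (mul_le_mul_of_nonneg_right (le_max_left _ _) (abs_nonneg _))
  · calc |g x - g 0| ≤ M := hM x hx
      _ = M / ε * ε := by field_simp
      _ ≤ max C (M / ε) * |x| :=
        mul_le_mul (le_max_right _ _) h hε.le (le_max_of_le_right (by positivity))

theorem abs_mul_sub_le {q x y K : ℝ} (hq : q ∈ Set.Icc (0 : ℝ) 1) (h : |x - y| ≤ K) :
    |q * x - q * y| ≤ K := by
  rw [← mul_sub, abs_mul, abs_of_nonneg hq.1]
  exact (mul_le_of_le_one_left (abs_nonneg _) hq.2).trans h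

/-- The `C¹` conditions enter only through one-sided differentiability at `0`; boundedness makes the
resulting Lipschitz estimate global on each half-line. The limits have positive sum because `p` and
`1 - p` do not both vanish. -/
theorem JumpDensityConditions.exists_isJumpProfile {p : ℝ} {fp fm : ℝ → ℝ}
    (hf : JumpDensityConditions p fp fm) :
    ∃ M K, IsJumpProfile M K (p * fp 0) ((1 - p) * fm 0) (jumpDensity p fp fm) := by
  obtain ⟨Mp, hMp⟩ := hf.fp_bdd
  obtain ⟨Mm, hMm⟩ := hf.fm_bdd
  have hp := hf.p_mem
  have hq : 1 - p ∈ Set.Icc (0 : ℝ) 1 := ⟨by linarith [hp.2], by linarith [hp.1]⟩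
  have bp (x : ℝ) (hx : 0 ≤ x) : fp x ∈ Set.Icc 0 Mp :=
    ⟨hf.fp_nonneg x hx, hMp (Set.mem_image_of_mem fp hx)⟩
  have bm (x : ℝ) (hx : x ≤ 0) : fm x ∈ Set.Icc 0 Mm :=
    ⟨hf.fm_nonneg x hx, hMm (Set.mem_image_of_mem fm hx)⟩
  have hMp0 : 0 ≤ Mp := (bp 0 le_rfl).1.trans (bp 0 le_rfl).2
  have hMm0 : 0 ≤ Mm := (bm 0 le_rfl).1.trans (bm 0 le_rfl).2
  obtain ⟨Kp, hKp0, hKp⟩ : ∃ K, 0 ≤ K ∧ ∀ x ∈ Set.Ici (0 : ℝ), |fp x - fp 0| ≤ K * |x| := by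
    refine exists_lipschitz_at_zero (M := Mp) (fun x hx => ?_) hMp0 ?_
    · have h1 := bp x hx
      have h2 := bp 0 le_rfl
      exact _root_.abs_le.2 ⟨by linarith [h1.1, h2.2], by linarith [h1.2, h2.1]⟩
    · obtain ⟨b, hb, hC⟩ := hf.fp_C1
      have h1 := ((hC.differentiableOn one_ne_zero) 0 ⟨le_rfl, hb⟩).isBigO_sub
      rw [nhdsWithin_Ico_eq_nhdsGE hb] at h1
      simpa using h1
  obtain ⟨Km, hKm0, hKm⟩ : ∃ K, 0 ≤ K ∧ ∀ x ∈ Set.Iic (0 : ℝ), |fm x - fm 0| ≤ K * |x| := by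
    refine exists_lipschitz_at_zero (M := Mm) (fun x hx => ?_) hMm0 ?_
    · have h1 := bm x hx
      have h2 := bm 0 le_rfl
      exact _root_.abs_le.2 ⟨by linarith [h1.1, h2.2], by linarith [h1.2, h2.1]⟩
    · obtain ⟨b, hb, hC⟩ := hf.fm_C1
      have h1 := ((hC.differentiableOn one_ne_zero) 0 ⟨hb, le_rfl⟩).isBigO_sub
      rw [nhdsWithin_Ioc_eq_nhdsLE hb] at h1
      simpa using h1
  have hpos (x : ℝ) (hx : 0 ≤ x) : jumpDensity p fp fm x = p * fp x := by simp [jumpDensity, hx]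
  have hneg (x : ℝ) (hx : x < 0) : jumpDensity p fp fm x = (1 - p) * fm x := by
    simp [jumpDensity, hx.not_ge]
  have mp (x : ℝ) (hx : 0 ≤ x) : p * fp x ∈ Set.Icc 0 (max Mp Mm) :=
    ⟨mul_nonneg hp.1 (bp x hx).1, (mul_le_of_le_one_left (bp x hx).1 hp.2).trans
      ((bp x hx).2.trans (le_max_left _ _))⟩
  have mm (x : ℝ) (hx : x ≤ 0) : (1 - p) * fm x ∈ Set.Icc 0 (max Mp Mm) :=
    ⟨mul_nonneg hq.1 (bm x hx).1, (mul_le_of_le_one_left (bm x hx).1 hq.2).trans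
      ((bm x hx).2.trans (le_max_right _ _))⟩
  have hmem (x : ℝ) : jumpDensity p fp fm x ∈ Set.Icc 0 (max Mp Mm) := by
    rcases le_or_gt 0 x with hx | hx
    · rw [hpos x hx]; exact mp x hx
    · rw [hneg x hx]; exact mm x hx.le
  have ip : IntegrableOn (jumpDensity p fp fm) (Set.Ici 0) :=
    IntegrableOn.congr_fun (hf.fp_integrable.const_mul p) (fun x hx => (hpos x hx).symm)
      measurableSet_Ici
  have im : IntegrableOn (jumpDensity p fp fm) (Set.Iio 0) :=
    IntegrableOn.congr_fun
      ((hf.fm_integrable.mono_set Set.Iio_subset_Iic_self).const_mul (1 - p)) (fun x hx => (hneg x hx).symm) measurableSet_Iio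
  have hi : Integrable (jumpDensity p fp fm) := by
    rw [← integrableOn_univ, ← Set.Iio_union_Ici (a := (0 : ℝ))]
    exact im.union ip
  refine ⟨max Mp Mm, max Kp Km, ⟨⟨fun x => (hmem x).1, fun x => (hmem x).2, hi, ?_⟩,
    le_max_of_le_left hKp0, fun x hx => ?_, fun x hx => ?_, mp 0 le_rfl, mm 0 le_rfl, ?_⟩⟩
  · rw [← integral_add_compl measurableSet_Ici hi, Set.compl_Ici,
      setIntegral_congr_fun measurableSet_Ici (fun x hx => hpos x hx),
      setIntegral_congr_fun measurableSet_Iio (fun x hx => hneg x hx), integral_const_mul,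
      integral_const_mul, ← integral_Iic_eq_integral_Iio, hf.fp_integral, hf.fm_integral]
    ring
  · rw [hpos x hx]
    refine abs_mul_sub_le hp ((hKp x hx).trans ?_)
    rw [abs_of_nonneg hx]
    exact mul_le_mul_of_nonneg_right (le_max_left _ _) hx
  · rw [hneg x hx]
    refine abs_mul_sub_le hq ((hKm x hx.le).trans ?_)
    rw [abs_of_neg hx]
    exact mul_le_mul_of_nonneg_right (le_max_right _ _) (by linarith)
  · have h1 := hf.fp_zero_pos
    have h2 := hf.fm_zero_pos
    rcases hp.1.eq_or_lt with h | h
    · rw [← h]; simpa using h2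
    · exact add_pos_of_pos_of_nonneg (mul_pos h h1) (mul_nonneg hq.1 h2.le)

/-- The step-dependent quantities at time `t`, for coefficients bounded on `[0, τ]`. -/
theorem isRegime_avg {γ σ lam : ℝ → ℝ} {τ γ₀ Γ s S l₀ Λ t h : ℝ}
    (hcoef : CoefficientConditions γ σ lam) (hγ₀ : 0 < γ₀) (hs : 0 < s) (hl₀ : 0 < l₀)
    (hγ : ∀ u ∈ Set.Icc 0 τ, γ u ∈ Set.Icc γ₀ Γ)
    (hσ : ∀ u ∈ Set.Icc 0 τ, σ u ^ 2 ∈ Set.Icc s S)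
    (hlam : ∀ u ∈ Set.Icc 0 τ, lam u ∈ Set.Icc l₀ Λ)
    (ht : 0 ≤ t) (hh : 0 < h) (hh1 : h < 1) (hth : t + h ≤ τ) (hΛ : h * Λ ≤ 1) :
    IsRegime Γ s S l₀ Λ h (avg γ t h) (avgVar σ t h) (avg lam t h) := by
  have hle : t ≤ t + h := by linarith
  have hsub (u : ℝ) (hu : u ∈ Set.Icc t (t + h)) : u ∈ Set.Icc 0 τ :=
    ⟨ht.trans hu.1, hu.2.trans hth⟩
  have hσm : AEStronglyMeasurable (fun u => σ u ^ 2) (volume.restrict (Set.Ici 0)) :=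
    (hcoef.σ_cont.pow 2).aestronglyMeasurable measurableSet_Ici
  have h1 := avg_mem_Icc hh (intervalIntegrable_of_bounds hcoef.γ_meas hγ ht hle hth)
    fun u hu => hγ u (hsub u hu)
  have h2 := avg_mem_Icc hh (intervalIntegrable_of_bounds hσm hσ ht hle hth)
    fun u hu => hσ u (hsub u hu)
  have h3 := avg_mem_Icc hh (intervalIntegrable_of_bounds hcoef.lam_meas hlam ht hle hth)
    fun u hu => hlam u (hsub u hu)
  exact ⟨hh, hh1, hγ₀.trans_le h1.1, h1.2, hs, h2.1, h2.2, hl₀, h3.1, h3.2, hΛ⟩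

end Data

/-! ### Unique minimizer, fixed-point equation and uniform convergence. -/

section Characterization

variable {M K a b c δ Γ s S l₀ Λ : ℝ} {f γ σ lam : ℝ → ℝ}

theorem IsSmallStep.exists_threshold {h g w l : ℝ} (hs : IsSmallStep M K a b c δ Γ s S l₀ Λ h)
    (hr : IsRegime Γ s S l₀ Λ h g w l) (hf : IsJumpProfile M K a b f) (hc : 0 < c)
    (hlow : (∀ x ∈ Set.Ioc 0 δ, c ≤ f x) ∨ (∀ x ∈ Set.Ico (-δ) 0, c ≤ f x)) :
    ∃ B ∈ Set.Ioo (h * g) (thresholdBound Γ S h),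
      evenSum (conv (gaussianPDFReal (h * g) (h * w).toNNReal) (jumpMixture (h * l) f)) B =
        evenSum (gaussianPDFReal (h * g) (h * w).toNNReal) B ∧
      (∀ x, 0 ≤ x → x < B →
        evenSum (conv (gaussianPDFReal (h * g) (h * w).toNNReal) (jumpMixture (h * l) f)) x <
        evenSum (gaussianPDFReal (h * g) (h * w).toNNReal) x) ∧
      ∀ x, B < x → evenSum (gaussianPDFReal (h * g) (h * w).toNNReal) x <
        evenSum (conv (gaussianPDFReal (h * g) (h * w).toNNReal) (jumpMixture (h * l) f)) x :=
  hr.exists_threshold hf hc hlow hs.drift_le hs.vol_le hs.drift_lt hs.tail_lt hs.bound_le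
    hs.sqrt_lt

/-- The loss has exactly one minimum point, at the crossing of the two densities. -/
theorem exists_isOptimalThreshold_iff {Ω : Type*} [MeasurableSpace Ω] {P : Measure Ω}
    [IsProbabilityMeasure P] {W I : ℝ≥0 → Ω → ℝ} {N : ℝ≥0 → Ω → ℕ} {ζ : ℕ → Ω → ℝ}
    {X : ℝ≥0 → Ω → ℝ} (hX : IsJumpDiffusion γ σ lam f W I N ζ X P) {t h : ℝ≥0}
    (hs : IsSmallStep M K a b c δ Γ s S l₀ Λ h)
    (hr : IsRegime Γ s S l₀ Λ h (avg γ t h) (avgVar σ t h) (avg lam t h))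
    (hf : IsJumpProfile M K a b f) (hc : 0 < c)
    (hlow : (∀ x ∈ Set.Ioc 0 δ, c ≤ f x) ∨ (∀ x ∈ Set.Ico (-δ) 0, c ≤ f x))
    (hσ : ContinuousOn σ (Set.Ici 0)) (hγ : IntervalIntegrable γ volume 0 t)
    (hγ' : IntervalIntegrable γ volume t (t + h)) :
    ∃ B ∈ Set.Ioo (h * avg γ t h) (thresholdBound Γ S h),
      evenSum (conv (incrementDensity γ σ t h) (jumpMixture (h * avg lam t h) f)) B =
        evenSum (incrementDensity γ σ t h) B ∧
      ∀ B', IsOptimalThreshold X N P t h B' ↔ B' = B := by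
  obtain ⟨B, hB, hst, hpos, hneg⟩ := hs.exists_threshold hr hf hc hlow
  refine ⟨B, hB, hst, ?_⟩
  have hB0 : 0 ≤ B := hr.mean_pos.le.trans hB.1.le
  have hvn : (h * avgVar σ t h).toNNReal ≠ 0 := by simpa using hr.var_pos
  have hφc := continuous_gaussianPDFReal (h * avg γ t h) (h * avgVar σ t h).toNNReal
  have hFc := continuous_conv_gaussianPDFReal
    (hf.toIsBoundedDensity.integrable_jumpMixture hr.rate_pos.le) (h * avg γ t h) hvn
  set φ := gaussianPDFReal (h * avg γ t h) (h * avgVar σ t h).toNNReal with hφ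
  set F := conv φ (jumpMixture (h * avg lam t h) f) with hF
  have hL (x : ℝ) (hx : 0 ≤ x) : loss X N P t h x =
      Real.exp (-(h * avg lam t h)) * (1 - ∫ y in -x..x, (φ y - F y)) := by
    rw [loss_eq hf.toIsBoundedDensity hX hr.var_pos (hσ.mono Set.Icc_subset_Ici_self) hγ hγ'
      (mul_avg hr.h_pos).symm (mul_avg hr.h_pos).symm (mul_avg hr.h_pos).symm hr.rate_pos.le hx,
      intervalIntegral.integral_sub (hφc.intervalIntegrable _ _) (hFc.intervalIntegrable _ _)]
    ring
  have hev (x : ℝ) : evenSum (φ - F) x = evenSum φ x - evenSum F x := by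
    simp only [evenSum, Pi.sub_apply]
    ring
  have hlt (x : ℝ) (hx : 0 ≤ x) (hne : x ≠ B) : loss X N P t h B < loss X N P t h x :=
    lt_of_sign_change (hφc.sub hFc) (Real.exp_pos _) hB0 hL
      (fun y hy hyB => by rw [hev]; exact sub_pos.2 (hpos y hy hyB))
      (fun y hyB => by rw [hev]; exact sub_neg.2 (hneg y hyB)) hx hne
  intro B'
  constructor
  · rintro ⟨h0, hmin⟩
    by_contra hne
    exact absurd (hmin hB0) (not_le.2 (hlt B' h0 hne))
  · rintro rfl
    refine ⟨hB0, fun x hx => ?_⟩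
    rcases eq_or_ne x B' with rfl | hne
    · exact le_refl (loss X N P t h x)
    · exact (hlt x hx hne).le

theorem hasSum_jumpSeriesTerm {t h : ℝ} (hf : IsBoundedDensity M f)
    (hv : 0 < h * avgVar σ t h) (hμ : 0 ≤ h * avg lam t h) (B : ℝ) :
    HasSum (jumpSeriesTerm γ σ lam f t h B)
      (evenSum (conv (incrementDensity γ σ t h) (jumpMixture (h * avg lam t h) f)) B) := by
  have hd := isBoundedDensity_gaussianPDFReal (h * avg γ t h)
    (show (h * avgVar σ t h).toNNReal ≠ 0 by simpa using hv)
  have e : jumpSeriesTerm γ σ lam f t h B = fun k =>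
      poissonWeight (h * avg lam t h) k * conv (incrementDensity γ σ t h) (convPow f k) B +
        poissonWeight (h * avg lam t h) k * conv (incrementDensity γ σ t h) (convPow f k) (-B) :=
    funext fun k => mul_add _ _ _
  rw [e]
  exact (hf.hasSum_conv hμ hd B).add (hf.hasSum_conv hμ hd (-B))

/-- The fixed-point equation satisfied by the crossing of the two densities. -/
theorem fixedPoint_of_eq_evenSum {t h B : ℝ} (hf : IsBoundedDensity M f) (hh : 0 < h)
    (hw : 0 < avgVar σ t h) (hμ : 0 ≤ h * avg lam t h) (hB : h * avg γ t h ≤ B)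
    (hst : evenSum (conv (incrementDensity γ σ t h) (jumpMixture (h * avg lam t h) f)) B =
        evenSum (incrementDensity γ σ t h) B) :
    Summable (jumpSeriesTerm γ σ lam f t h B) ∧ 0 < ∑' k, jumpSeriesTerm γ σ lam f t h B k ∧
      0 ≤ fixedPointBracket γ σ lam f t h B ∧
      B = h * avg γ t h + √(2 * h * avgVar σ t h) * √(fixedPointBracket γ σ lam f t h B) := by
  have hv : 0 < h * avgVar σ t h := mul_pos hh hw
  have hvn : (h * avgVar σ t h).toNNReal ≠ 0 := by simpa using hv
  have hsum := hasSum_jumpSeriesTerm (γ := γ) hf hv hμ B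
  have hbr : fixedPointBracket γ σ lam f t h B =
      (B - h * avg γ t h) ^ 2 / (2 * (h * avgVar σ t h)) := by
    rw [← log_sub_log_of_eq_evenSum hv hst, fixedPointBracket, hsum.tsum_eq,
      show -2 * B * (h * avg γ t h) / (h * avgVar σ t h) = -2 * B * avg γ t h / avgVar σ t h by
        field_simp, ← mul_assoc (2 * Real.pi)]
  refine ⟨hsum.summable, ?_, ?_, ?_⟩
  · rw [hsum.tsum_eq, hst]
    exact add_pos (gaussianPDFReal_pos _ _ _ hvn) (gaussianPDFReal_pos _ _ _ hvn)
  · rw [hbr]; positivity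
  -- The threshold being at least the mean selects the positive root.
  · rw [hbr, ← Real.sqrt_mul (by positivity), mul_assoc 2 h,
      mul_div_cancel₀ _ (by positivity : 2 * (h * avgVar σ t h) ≠ 0),
      Real.sqrt_sq (sub_nonneg.2 hB)]
    ring

theorem tendsto_coe_nhdsGT_zero : Tendsto ((↑) : ℝ≥0 → ℝ) (𝓝[>] 0) (𝓝[>] 0) := by
  refine tendsto_nhdsWithin_iff.2 ⟨?_, ?_⟩
  · exact (NNReal.continuous_coe.tendsto' 0 0 rfl).mono_left nhdsWithin_le_nhds
  · filter_upwards [self_mem_nhdsWithin] with h hh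
    exact NNReal.coe_pos.2 hh

/-- A uniform error bound of smaller order than `r` gives uniform convergence of the quotient. -/
theorem tendstoUniformlyOn_div_of_isLittleO {ι : Type*} {F : ℝ≥0 → ι → ℝ} {E r : ℝ → ℝ} {s : Set ι}
    (hE : E =o[𝓝[>] 0] r) (hr : ∀ᶠ h in 𝓝[>] (0 : ℝ), 0 < r h)
    (hF : ∀ᶠ h in 𝓝[>] (0 : ℝ≥0), ∀ t ∈ s, |F h t| ≤ E h) :
    TendstoUniformlyOn (fun h t => F h t / r h) (fun _ => 0) (𝓝[>] 0) s := by
  rw [Metric.tendstoUniformlyOn_iff]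
  intro ε hε
  filter_upwards [hF, tendsto_coe_nhdsGT_zero.eventually (hE.bound (half_pos hε)),
    tendsto_coe_nhdsGT_zero.eventually hr] with h h1 h2 h3 t ht
  rw [dist_zero_left, norm_div, Real.norm_eq_abs, Real.norm_of_nonneg h3.le, div_lt_iff₀ h3]
  rw [Real.norm_of_nonneg h3.le] at h2
  calc |F h t| ≤ E h := h1 t ht
    _ ≤ ε / 2 * r h := (le_abs_self _).trans h2
    _ < ε * r h := mul_lt_mul_of_pos_right (half_lt_self hε) h3

/-- Averages of a function which is `C¹` in the interior approximate it to first order, uniformly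
on compact sets. -/
theorem exists_abs_avg_sub_le {g : ℝ → ℝ} {x y τ : ℝ} (hx : 0 < x) (hy : y < τ)
    (hg : ContDiffOn ℝ 1 g (Set.Ioo 0 τ)) :
    ∃ D, 0 ≤ D ∧ ∀ t h, 0 < h → x ≤ t → t + h ≤ y → |avg g t h - g t| ≤ D * h := by
  obtain ⟨D, hD0, hD⟩ := exists_lipschitz_bound hx hy hg
  refine ⟨D, hD0, fun t h hh ht hth => abs_avg_sub_le hh ?_ fun u hu => ?_⟩
  · refine (hg.continuousOn.mono fun u hu => ?_).intervalIntegrable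
    rw [Set.uIcc_of_le (by linarith)] at hu
    exact ⟨hx.trans_le (ht.trans hu.1), hu.2.trans_lt (hth.trans_lt hy)⟩
  · refine (hD u ⟨ht.trans hu.1, hu.2.trans hth⟩ t ⟨ht, by linarith⟩).trans ?_
    rw [abs_of_nonneg (sub_nonneg.2 hu.1)]
    exact mul_le_mul_of_nonneg_left (by linarith [hu.2]) hD0

end Characterization

end OptimalThreshold

end

/-! ### The characterizations of the optimal threshold. -/

theorem mainTheorem2 {Ω : Type*} [MeasurableSpace Ω] (P : Measure Ω) [IsProbabilityMeasure P]
    (γ σ lam : ℝ → ℝ) (p : ℝ) (fp fm : ℝ → ℝ)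
    (W I : ℝ≥0 → Ω → ℝ) (N : ℝ≥0 → Ω → ℕ) (ζ : ℕ → Ω → ℝ) (X : ℝ≥0 → Ω → ℝ)
    (hcoef : OptimalThreshold.CoefficientConditions γ σ lam)
    (hdens : OptimalThreshold.JumpDensityConditions p fp fm)
    (hmodel : OptimalThreshold.IsJumpDiffusion γ σ lam (OptimalThreshold.jumpDensity p fp fm)
      W I N ζ X P)
    (T : ℝ≥0) (hT : 0 < T) :
    ∃ h₀ : ℝ≥0, 0 < h₀ ∧
      (∀ t ∈ Set.Icc 0 T, ∀ h ∈ Set.Ioo 0 h₀,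
        ∃! B : ℝ, OptimalThreshold.IsOptimalThreshold X N P t h B) ∧
      ∀ Bstar : ℝ≥0 → ℝ≥0 → ℝ,
        (∀ t ∈ Set.Icc 0 T, ∀ h ∈ Set.Ioo 0 h₀,
          OptimalThreshold.IsOptimalThreshold X N P t h (Bstar t h)) →
        -- the fixed-point equation, all of whose terms are well defined
        (∀ t ∈ Set.Icc 0 T, ∀ h ∈ Set.Ioo 0 h₀,
          Summable (OptimalThreshold.jumpSeriesTerm γ σ lam
            (OptimalThreshold.jumpDensity p fp fm) t h (Bstar t h)) ∧
          0 < ∑' k, OptimalThreshold.jumpSeriesTerm γ σ lam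
            (OptimalThreshold.jumpDensity p fp fm) t h (Bstar t h) k ∧
          0 ≤ OptimalThreshold.fixedPointBracket γ σ lam
            (OptimalThreshold.jumpDensity p fp fm) t h (Bstar t h) ∧
          Bstar t h = h * OptimalThreshold.avg γ t h +
            √(2 * h * OptimalThreshold.avgVar σ t h) *
              √(OptimalThreshold.fixedPointBracket γ σ lam
                (OptimalThreshold.jumpDensity p fp fm) t h (Bstar t h))) ∧
        -- the second-order expansion, uniformly in `t ∈ [0, T]`
        (∀ α ∈ Set.Ioo (0 : ℝ) (1 / 2),
          TendstoUniformlyOn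
            (fun (h t : ℝ≥0) => (Bstar t h - OptimalThreshold.secondOrderApprox
              (OptimalThreshold.massAtZero (OptimalThreshold.jumpDensity p fp fm))
              (OptimalThreshold.avgVol σ t h) (OptimalThreshold.avg lam t h) h) /
                (h : ℝ) ^ (1 / 2 + α))
            (fun _ => 0) (𝓝[>] 0) (Set.Icc 0 T)) ∧
        -- the expansion with spot values, locally uniformly in `t ∈ (0, T)`
        (ContDiffOn ℝ 1 (fun u => σ u ^ 2) (Set.Ioo 0 (T : ℝ)) →
          ContDiffOn ℝ 1 lam (Set.Ioo 0 (T : ℝ)) →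
          ContinuousOn (fun u => σ u ^ 2) (Set.Icc 0 (T : ℝ)) →
          ContinuousOn lam (Set.Icc 0 (T : ℝ)) →
          ∀ α ∈ Set.Ioo (0 : ℝ) (1 / 2), ∀ K ⊆ Set.Ioo 0 T, IsCompact K →
            TendstoUniformlyOn
              (fun (h t : ℝ≥0) => (Bstar t h - OptimalThreshold.secondOrderApprox
                (OptimalThreshold.massAtZero (OptimalThreshold.jumpDensity p fp fm))
                (σ t) (lam t) h) / (h : ℝ) ^ (1 / 2 + α))
              (fun _ => 0) (𝓝[>] 0) K) := by
  -- Bounds are taken on `[0, T + 1]` so that every window `[t, t + h]` with `t ≤ T` and `h < 1` is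
  -- covered.
  obtain ⟨γ₀, Γ, hγ₀, hγ⟩ := OptimalThreshold.exists_bounds
    (hcoef.γ_inf (T + 1) (by positivity)) (hcoef.γ_sup (T + 1) (by positivity))
  obtain ⟨σ₀, σ₁, hσ₀, hσ⟩ := OptimalThreshold.exists_bounds
    (hcoef.σ_inf (T + 1) (by positivity)) (hcoef.σ_sup (T + 1) (by positivity))
  obtain ⟨l₀, Λ, hl₀, hlam⟩ := OptimalThreshold.exists_bounds
    (hcoef.lam_inf (T + 1) (by positivity)) (hcoef.lam_sup (T + 1) (by positivity))
  obtain ⟨M, K, hprof⟩ := hdens.exists_isJumpProfile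
  obtain ⟨c, δ, hc, hδ, hlow⟩ := hprof.exists_lower_bound
  have hmass := OptimalThreshold.massAtZero_eq hdens
  set a := p * fp 0
  set b := (1 - p) * fm 0
  set f := OptimalThreshold.jumpDensity p fp fm
  have hσ2 : ∀ u ∈ Set.Icc 0 ((T : ℝ) + 1), σ u ^ 2 ∈ Set.Icc (σ₀ ^ 2) (σ₁ ^ 2) := fun u hu =>
    ⟨pow_le_pow_left₀ hσ₀.le (hσ u hu).1 2,
      pow_le_pow_left₀ (hσ₀.le.trans (hσ u hu).1) (hσ u hu).2 2⟩
  have hs0 : 0 < σ₀ ^ 2 := by positivity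
  have hsmall := OptimalThreshold.eventually_isSmallStep (c := c) (δ := δ) (S := σ₁ ^ 2) M K Γ Λ
    hprof.add_pos hc hδ hs0 hl₀
  obtain ⟨h₁, hh₁, hsub⟩ := mem_nhdsGT_iff_exists_Ioo_subset.1 hsmall
  have hh₁' : 0 < h₁ := hh₁
  have hstep : ∀ h ∈ Set.Ioo 0 h₁.toNNReal,
      OptimalThreshold.IsSmallStep M K a b c δ Γ (σ₀ ^ 2) (σ₁ ^ 2) l₀ Λ h := fun h hh =>
    hsub ⟨NNReal.coe_pos.2 hh.1, Real.lt_toNNReal_iff_coe_lt.1 hh.2⟩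
  have hregime : ∀ t ∈ Set.Icc 0 T, ∀ h ∈ Set.Ioo 0 h₁.toNNReal,
      OptimalThreshold.IsRegime Γ (σ₀ ^ 2) (σ₁ ^ 2) l₀ Λ h (OptimalThreshold.avg γ t h)
        (OptimalThreshold.avgVar σ t h) (OptimalThreshold.avg lam t h) := by
    intro t ht h hh
    have hs := hstep h hh
    have htT : (t : ℝ) ≤ T := by exact_mod_cast ht.2
    exact OptimalThreshold.isRegime_avg hcoef hγ₀ hs0 hl₀ hγ hσ2 hlam t.2 hs.pos hs.lt_one
      (by linarith [hs.lt_one]) hs.mul_le_one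
  have hmain : ∀ t ∈ Set.Icc 0 T, ∀ h ∈ Set.Ioo 0 h₁.toNNReal,
      ∃ B ∈ Set.Ioo (h * OptimalThreshold.avg γ t h)
        (OptimalThreshold.thresholdBound Γ (σ₁ ^ 2) h),
      OptimalThreshold.evenSum (OptimalThreshold.conv (OptimalThreshold.incrementDensity γ σ t h)
          (OptimalThreshold.jumpMixture (h * OptimalThreshold.avg lam t h) f)) B =
        OptimalThreshold.evenSum (OptimalThreshold.incrementDensity γ σ t h) B ∧
      ∀ B', OptimalThreshold.IsOptimalThreshold X N P t h B' ↔ B' = B := by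
    intro t ht h hh
    have hs := hstep h hh
    have htT : (t : ℝ) ≤ T := by exact_mod_cast ht.2
    exact OptimalThreshold.exists_isOptimalThreshold_iff hmodel hs (hregime t ht h hh) hprof hc
      hlow hcoef.σ_cont
      (OptimalThreshold.intervalIntegrable_of_bounds hcoef.γ_meas hγ le_rfl t.2 (by linarith))
      (OptimalThreshold.intervalIntegrable_of_bounds hcoef.γ_meas hγ t.2 (by linarith [hs.pos])
        (by linarith [hs.lt_one]))
  refine ⟨h₁.toNNReal, Real.toNNReal_pos.2 hh₁', fun t ht h hh => ?_, fun Bstar hBstar => ?_⟩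
  · obtain ⟨B, -, -, hB⟩ := hmain t ht h hh
    exact ⟨B, (hB B).2 rfl, fun B' hB' => (hB B').1 hB'⟩
  have hspec : ∀ t ∈ Set.Icc 0 T, ∀ h ∈ Set.Ioo 0 h₁.toNNReal,
      Bstar t h ∈ Set.Ioo (h * OptimalThreshold.avg γ t h)
        (OptimalThreshold.thresholdBound Γ (σ₁ ^ 2) h) ∧
      OptimalThreshold.evenSum (OptimalThreshold.conv (OptimalThreshold.incrementDensity γ σ t h)
          (OptimalThreshold.jumpMixture (h * OptimalThreshold.avg lam t h) f)) (Bstar t h) =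
        OptimalThreshold.evenSum (OptimalThreshold.incrementDensity γ σ t h) (Bstar t h) := by
    intro t ht h hh
    obtain ⟨B, hB, hst, hiff⟩ := hmain t ht h hh
    -- Uniqueness identifies an arbitrary selection of minimizers with the crossing points.
    rw [(hiff _).1 (hBstar t ht h hh)]
    exact ⟨hB, hst⟩
  have happrox : ∀ t ∈ Set.Icc 0 T, ∀ h ∈ Set.Ioo 0 h₁.toNNReal,
      |Bstar t h - OptimalThreshold.secondOrderApprox (OptimalThreshold.massAtZero f)
        (OptimalThreshold.avgVol σ t h) (OptimalThreshold.avg lam t h) h| ≤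
      OptimalThreshold.thresholdError M K (a + b) Γ (σ₀ ^ 2) (σ₁ ^ 2) Λ h := by
    intro t ht h hh
    obtain ⟨hB, hst⟩ := hspec t ht h hh
    rw [hmass]
    exact (hregime t ht h hh).abs_sub_secondOrderApprox_le hprof hB hst (hstep h hh).error_le
      (hstep h hh).log_le
  have hIoo : ∀ᶠ h in 𝓝[>] (0 : ℝ≥0), h ∈ Set.Ioo 0 h₁.toNNReal :=
    Ioo_mem_nhdsGT (Real.toNNReal_pos.2 hh₁')
  have hpow (α : ℝ) : ∀ᶠ h in 𝓝[>] (0 : ℝ), 0 < h ^ (1 / 2 + α) := by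
    filter_upwards [self_mem_nhdsWithin] with h hh using Real.rpow_pos_of_pos hh _
  refine ⟨fun t ht h hh => ?_, fun α hα => ?_, fun hσC hlamC _ _ α hα C hC hCc => ?_⟩
  · obtain ⟨hB, hst⟩ := hspec t ht h hh
    have hr := hregime t ht h hh
    exact OptimalThreshold.fixedPoint_of_eq_evenSum hprof.toIsBoundedDensity hr.h_pos hr.w_pos
      hr.rate_pos.le hB.1.le hst
  · refine OptimalThreshold.tendstoUniformlyOn_div_of_isLittleO
      (OptimalThreshold.isLittleO_thresholdError M K (a + b) Γ (σ₀ ^ 2) (σ₁ ^ 2) Λ hα.2) (hpow α) ?_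
    filter_upwards [hIoo] with h hh t ht using happrox t ht h hh
  · rcases C.eq_empty_or_nonempty with rfl | hne
    · exact tendstoUniformlyOn_empty
    obtain ⟨t₀, ht₀, hmin⟩ := hCc.exists_isLeast hne
    obtain ⟨t₁, ht₁, hmax⟩ := hCc.exists_isGreatest hne
    have ht₀' : (0 : ℝ) < t₀ := NNReal.coe_pos.2 (hC ht₀).1
    have ht₁' : (t₁ : ℝ) < T := NNReal.coe_lt_coe.2 (hC ht₁).2
    -- The midpoint between the largest point of the compact set and `T` leaves room for the windows
    -- `[t, t + h]` inside a compact interval where the coefficients are Lipschitz.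
    have hy : ((t₁ : ℝ) + T) / 2 < T := by linarith
    obtain ⟨D₁, hD₁, hσD⟩ := OptimalThreshold.exists_abs_avg_sub_le ht₀' hy hσC
    obtain ⟨D₂, hD₂, hlamD⟩ := OptimalThreshold.exists_abs_avg_sub_le ht₀' hy hlamC
    refine OptimalThreshold.tendstoUniformlyOn_div_of_isLittleO
      ((OptimalThreshold.isLittleO_thresholdError M K (a + b) Γ (σ₀ ^ 2) (σ₁ ^ 2) Λ hα.2).add
        (OptimalThreshold.isLittleO_spotError ((a + b) / 2) (σ₀ ^ 2) (σ₁ ^ 2) l₀ (max D₁ D₂) hα.2))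
      (hpow α) ?_
    have hgap : ∀ᶠ h : ℝ≥0 in 𝓝[>] 0, (h : ℝ) < ((T : ℝ) - t₁) / 2 :=
      OptimalThreshold.tendsto_coe_nhdsGT_zero.eventually (nhdsWithin_le_nhds
        (eventually_lt_nhds (show (0 : ℝ) < ((T : ℝ) - t₁) / 2 by linarith)))
    filter_upwards [hIoo, hgap] with h hh hlt t htC
    have htT : t ∈ Set.Icc 0 T := ⟨zero_le, (hC htC).2.le⟩
    have htT' : (t : ℝ) ≤ T := by exact_mod_cast htT.2
    have hr := hregime t htT h hh
    have h1 : (t₀ : ℝ) ≤ t := by exact_mod_cast hmin htC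
    have h2 : (t : ℝ) ≤ t₁ := by exact_mod_cast hmax htC
    have hmem : (t : ℝ) ∈ Set.Icc 0 ((T : ℝ) + 1) := ⟨t.2, by linarith⟩
    have h3 := OptimalThreshold.abs_secondOrderApprox_sub_le (c := (a + b) / 2)
      (D := max D₁ D₂) (half_pos hprof.add_pos) hs0 hl₀ ⟨hr.s_le, hr.le_S⟩ (hσ2 t hmem)
      ⟨hr.l₀_le, hr.le_Λ⟩ (hlam t hmem)
      ((hσD t h hr.h_pos h1 (by linarith)).trans
        (mul_le_mul_of_nonneg_right (le_max_left _ _) hr.h_pos.le))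
      ((hlamD t h hr.h_pos h1 (by linarith)).trans
        (mul_le_mul_of_nonneg_right (le_max_right _ _) hr.h_pos.le)) (hstep h hh).log_le
    rw [Real.sqrt_sq (hσ₀.le.trans (hσ t hmem).1)] at h3
    have h4 := happrox t htT h hh
    rw [hmass] at h4 ⊢
    exact (abs_sub_le _ _ _).trans (add_le_add h4 h3)
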